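/- Let $u\ge 1$, let $\mathcal P$ be the set of partitions, and let $\mathbb{Z}^u_+=\{\lambda\in\mathbb{Z}^u : \lambda_1\ge\cdots\ge\lambda_u\}$. For $\lambda\in\mathbb{Z}^u_+$ put $\lambda^*=(-\lambda_u,\dots,-\lambda_1)$; a partition of length at most $u$ is regarded as an element of $\mathbb{Z}^u_+$. **Tableaux.** Let $\mathbf B=\{\cdots<\overline 2<\overline 1<1<2<\cdots\}$, with $|\overline k|=0$ and $|k|=1$ for $k\ge1$; let $\mathbf B^+$ (resp. $\mathbf B^-$) be the set of letters of degree $0$ (resp. $1$). A semi-infinite word of charge $c\in\mathbb Z$ is a sequence $w=\cdots w_3w_2w_1$ in $\mathbf B$ with $w_{i+1}\le w_i$ for all $i\geq 1$, with $w_{i+1}=w_i$ only if $|w_i|=1$, and with $w_i=\overline{i+c}$ for all $i\gg1$. Its weight is $\mathrm{wt}(w)=\Lambda+\sum_{b}m_b\epsilon_b\in\mathbb{Z}\Lambda\oplus\bigoplus_{b\in\mathbf B}\mathbb{Z}\epsilon_b$, where $m_b=|\{k: w_k=b\}|-\delta_{|b|,0}$. For $\lambda\in\mathbb{Z}^u_+$,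 let $\mathbf B(\lambda)$ be the $\mathfrak g$-crystal of semi-infinite semistandard tableaux of charge $\lambda$, i.e. the set of $u$-tuples $\mathbf w=(w^{(1)},\dots,w^{(u)})$ of semi-infinite words such that $w^{(i)}$ has charge $\lambda_i$ for $1\le i\le u$ and, for $1\le i<u$, $k\ge1$ and $d_i=\lambda_i-\lambda_{i+1}$, one has $w^{(i)}_k\ge w^{(i+1)}_{k+d_i}$, with equality only if $|w^{(i)}_k|=0$. Let $\mathrm{wt}(\mathbf w)=\sum_i\mathrm{wt}(w^{(i)})$, let $x^{k\Lambda+\sum m_b\epsilon_b}=\prod_b x_b^{m_b}$, and let $\mathrm{ch}\,\mathbf B(\lambda)=\sum_{\mathbf w\in\mathbf B(\lambda)}x^{\mathrm{wt}(\mathbf w)}$. **Rational Schur functions.** Let $\mathbf B_u=\{\overline u<\cdots<\overline1\}$ and let $\mathbf B_u^\vee=\{-\overline1<\cdots<-\overline u\}$. For $\lambda\in\mathbb{Z}^u_+$ a rational semistandard tableau of shape $\lambda$ is a filling of the boxes $(i,j)$, $1\le i\le u$, with $1\le j\le\lambda_i$ or $\lambda_i\le j\le-1$, where columns $j>0$ (resp.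 $j<0$) have entries in $\mathbf B_u$ (resp. $\mathbf B_u^\vee$), rows increase weakly from left to right, columns increase strictly from top to bottom, and, if $b_1<\cdots<b_s$ are the entries of column $1$, $-b'_1<\cdots<-b'_t$ those of column $-1$ and $\{b''_1<\cdots<b''_{u-t}\}=\mathbf B_u\setminus\{b'_1,\dots,b'_t\}$, then $b''_i\le b_i$ for $1\le i\le s$. Let $s_\lambda(y)=\sum_T y^{\mathrm{wt}(T)}$, the sum over all such $T$, where an entry $b$ contributes $y_b$ and an entry $-b$ contributes $y_b^{-1}$ to $y^{\mathrm{wt}(T)}$. For $\mu,\nu\in\mathcal P$ define $N^{\kappa}_{\mu\nu}\in\mathbb{Z}_{\ge0}$ ($\kappa\in\mathbb{Z}^u_+$, almost all zero) by $$s_{\mu^*}(y)\,s_\nu(y)=\sum_{\kappa\in\mathbb{Z}^u_+}N^{\kappa}_{\mu\nu}\,s_\kappa(y),$$ where $s_{\mu^*}(y)$, resp. $s_\nu(y)$, is understood to be $0$ if $\mu$, resp. $\nu$, has more than $u$ parts. **Statement.** The coefficients $N^\kappa_{\mu\nu}\in\mathbb{Z}_{\ge 0}$ exist and are unique. For every $\lambda\in\mathbb{Z}^u_+$,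 each monomial occurs only finitely often in $\mathrm{ch}\,\mathbf B(\lambda)$, and $$\mathrm{ch}\,\mathbf B(\lambda)=\sum_{\mu,\nu\in\mathcal P}N^{\lambda^*}_{\mu\nu}\,s_{\mu'}(x_+^{-1})\,s_\nu(x_-)$$ as formal series (the sum on the right converges coefficientwise). Here $\mu'$ is the conjugate partition, $s_{\mu'}$ and $s_\nu$ on the right are ordinary Schur functions in infinitely many variables, $x_+^{-1}=\{x_b^{-1}: b\in\mathbf B^+\}$ and $x_-=\{x_b: b\in\mathbf B^-\}$. -/

import Mathlib

noncomputable section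

namespace SemiInf

/-! ### The alphabet and semi-infinite words -/

/-- The linearly ordered alphabet `⋯ < 2̄ < 1̄ < 1 < 2 < ⋯`, realised as the non-zero integers:
the letter `k̄` (`k ≥ 1`) is `-k`, the letter `k` (`k ≥ 1`) is `k`. -/
abbrev Letter : Type := {b : ℤ // b ≠ 0}

/-- The degree `|b|`: `0` for the barred letters, `1` for the unbarred ones. -/
def deg (b : Letter) : ℕ := if (b : ℤ) < 0 then 0 else 1

/-- The barred letter with bar over `k + 1`. -/
def barLetter (k : ℕ) : Letter := ⟨-((k : ℤ) + 1), by omega⟩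

/-- The unbarred letter `k + 1`. -/
def posLetter (k : ℕ) : Letter := ⟨(k : ℤ) + 1, by omega⟩

/-- The word `⋯ w₃ w₂ w₁`, stored as the sequence `k ↦ w_{k+1}`, has charge `c`:
`w_i` is the barred letter `i + c` for all `i ≫ 1`. -/
def HasCharge (w : ℕ → Letter) (c : ℤ) : Prop :=
  ∀ᶠ k : ℕ in Filter.atTop, (w k : ℤ) = -(((k : ℤ) + 1) + c)

/-- Semi-infinite words `⋯ w₃ w₂ w₁`; `letter k` is `w_{k+1}`. -/
@[ext] structure Word where
  letter : ℕ → Letter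
  weak : ∀ k, letter (k + 1) ≤ letter k
  strict : ∀ k, letter (k + 1) = letter k → deg (letter k) = 1
  charged : ∃ c : ℤ, HasCharge letter c

/-- `m_b = |{k | w_k = b}| - δ_{|b|,0}`. -/
def Word.mult (w : Word) (b : Letter) : ℤ :=
  ({k : ℕ | w.letter k = b}.ncard : ℤ) - if deg b = 0 then 1 else 0

theorem Word.antitone (w : Word) : Antitone w.letter := antitone_nat_of_succ_le w.weak

theorem Word.finite_mult_support (w : Word) : (Function.support w.mult).Finite := by
  obtain ⟨c, hc⟩ := w.charged
  obtain ⟨K₀, hK₀⟩ := Filter.eventually_atTop.1 hc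
  obtain ⟨K, hKK, hK⟩ : ∃ K : ℕ, K₀ ≤ K ∧ -((K : ℤ) + 1 + c) < 0 :=
    ⟨max K₀ (c.natAbs), le_max_left _ _, by have := le_max_right K₀ c.natAbs; omega⟩
  have hw : ∀ k, K ≤ k → (w.letter k : ℤ) = -((k : ℤ) + 1 + c) :=
    fun k hk => hK₀ k (hKK.trans hk)
  have hfin : {b : Letter | (b : ℤ) ∈ Set.Icc (-((K : ℤ) + 1 + c)) (max (w.letter 0 : ℤ) 0)}.Finite :=
    (Set.finite_Icc _ _).preimage Subtype.val_injective.injOn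
  refine hfin.subset fun b hb => ?_
  by_contra hcon
  apply hb
  rw [Set.mem_ofPred_eq, Set.mem_Icc, not_and_or, not_le, not_le] at hcon
  have h0 := b.2
  rcases hcon with h | h
  · obtain ⟨j, hj⟩ : ∃ j : ℕ, (b : ℤ) = -((j : ℤ) + 1 + c) := ⟨(-(b : ℤ) - 1 - c).toNat, by omega⟩
    have hset : {k : ℕ | w.letter k = b} = {j} := by
      ext k
      simp only [Set.mem_ofPred_eq, Set.mem_singleton_iff, Subtype.ext_iff]
      constructor
      · intro hk
        by_cases hkK : K ≤ k
        · have := hw k hkK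
          omega
        · have h1 : (w.letter K : ℤ) ≤ w.letter k := w.antitone (by omega)
          have := hw K le_rfl
          omega
      · rintro rfl
        rw [hw k (by omega), hj]
    have hd : deg b = 0 := if_pos (by omega)
    simp [Word.mult, hset, hd]
  · have hset : {k : ℕ | w.letter k = b} = ∅ := by
      ext k
      simp only [Set.mem_ofPred_eq, Set.mem_empty_iff_false, iff_false, Subtype.ext_iff]
      intro hk
      have h1 : (w.letter k : ℤ) ≤ w.letter 0 := w.antitone (Nat.zero_le k)
      omega
    have hd : deg b = 1 := if_neg (by omega)
    simp [Word.mult, hset, hd]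

/-- The weight lattice `P = ℤΛ ⊕ ⨁_b ℤ ε_b`. -/
abbrev WeightLattice : Type := ℤ × (Letter →₀ ℤ)

/-- `wt(w) = Λ + ∑_b m_b ε_b`. -/
def Word.wt (w : Word) : WeightLattice :=
  (1, Finsupp.ofSupportFinite w.mult w.finite_mult_support)

/-! ### Generalized partitions and semi-infinite semistandard tableaux -/

/-- `ℤ^u_+`: weakly decreasing `u`-tuples of integers. -/
abbrev GenPartition (u : ℕ) : Type := {lam : Fin u → ℤ // Antitone lam}

/-- `λ* = (-λ_u, …, -λ_1)`. -/
def GenPartition.star {u : ℕ} (lam : GenPartition u) : GenPartition u :=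
  ⟨fun i => -(lam.1 i.rev), fun _ _ h => neg_le_neg (lam.2 (Fin.rev_le_rev.2 h))⟩

/-- The first `u` parts of a partition; this is the partition itself if its length is at
most `u`. -/
def GenPartition.ofPartition (u : ℕ) (μ : YoungDiagram) : GenPartition u :=
  ⟨fun i => (μ.rowLen i : ℤ), fun _ _ h => Int.ofNat_le.2 (μ.rowLen_anti _ _ h)⟩

/-- The set `B(λ)` of semi-infinite semistandard tableaux of charge `λ`. -/
def tableaux {u : ℕ} (lam : GenPartition u) : Set (Fin u → Word) :=
  {w | (∀ i, HasCharge (w i).letter (lam.1 i)) ∧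
    ∀ i j : Fin u, (i : ℕ) + 1 = (j : ℕ) → ∀ k : ℕ,
      (w j).letter (k + (lam.1 i - lam.1 j).toNat) ≤ (w i).letter k ∧
      ((w i).letter k = (w j).letter (k + (lam.1 i - lam.1 j).toNat) →
        deg ((w i).letter k) = 0)}

/-- The weight of a tuple of words, viewed in the `u`-fold tensor power. -/
def wt {u : ℕ} (w : Fin u → Word) : WeightLattice := ∑ i, (w i).wt

/-! ### Formal series in the variables `x_b` -/

/-- Formal, possibly infinite, integral linear combinations of the Laurent monomials
`x^γ = ∏_b x_b ^ γ_b`; the value at `γ` is the coefficient of `x^γ`. -/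
abbrev FormalSeries : Type := (Letter →₀ ℤ) → ℤ

/-- The tableaux in `B(λ)` whose weight `kΛ + ∑_b γ_b ε_b` has the given `ε`-part, that is,
those with `x^{wt(w)} = x^γ`. -/
def weightSpace {u : ℕ} (lam : GenPartition u) (γ : Letter →₀ ℤ) : Set (Fin u → Word) :=
  {w ∈ tableaux lam | (wt w).2 = γ}

/-- `ch B(λ) = ∑_{w ∈ B(λ)} x^{wt(w)}`. -/
def ch {u : ℕ} (lam : GenPartition u) : FormalSeries :=
  fun γ => ((weightSpace lam γ).ncard : ℤ)

/-- Power series in the variables `z_b`, read as formal series in the `x_b` by putting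
`z_b = x_b⁻¹` for `|b| = 0` and `z_b = x_b` for `|b| = 1`. -/
def toFormalSeries (F : MvPowerSeries Letter ℤ) : FormalSeries :=
  open Classical in
  fun γ =>
    if ∀ b, (deg b = 0 → γ b ≤ 0) ∧ (deg b = 1 → 0 ≤ γ b) then
      MvPowerSeries.coeff (γ.mapRange Int.natAbs Int.natAbs_zero) F
    else 0

/-- The Schur function `s_μ(z_{v 0}, z_{v 1}, …)`, the generating function of the semistandard
tableaux of shape `μ`, for an enumerated alphabet `v`. -/
def schur {σ : Type} (v : ℕ → σ) (μ : YoungDiagram) : MvPowerSeries σ ℤ :=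
  fun n => (Nat.card {T : SemistandardYoungTableau μ //
    ∑ c ∈ μ.cells, Finsupp.single (v (T c.1 c.2)) 1 = n} : ℤ)

/-- `s_{μ'}(x_+⁻¹) s_ν(x_-)`, where `μ'` is the conjugate of `μ`. -/
def schurProduct (μ ν : YoungDiagram) : FormalSeries :=
  toFormalSeries (schur barLetter μ.transpose * schur posLetter ν)

/-! ### Rational semistandard tableaux and rational Schur functions -/

/-- The boxes of the generalized Young diagram of `λ`: in row `i`, the columns `1, …, λ_i` if
`λ_i ≥ 0` and the columns `λ_i, …, -1` if `λ_i ≤ 0`. -/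
abbrev Box {u : ℕ} (lam : GenPartition u) : Type :=
  Σ i : Fin u, {j : ℤ // j ∈ Finset.Icc 1 (lam.1 i) ∪ Finset.Icc (lam.1 i) (-1)}

/-- The row of a box (from top to bottom, starting with `0`). -/
def Box.row {u : ℕ} {lam : GenPartition u} (p : Box lam) : Fin u := p.1

/-- The column of a box, a non-zero integer. -/
def Box.col {u : ℕ} {lam : GenPartition u} (p : Box lam) : ℤ := p.2.1

/-- The letters `b` whose duals `-b` occur in the column `-1`. -/
def entriesOfColNegOne {u : ℕ} {lam : GenPartition u} (T : Box lam → Fin u) : Finset (Fin u) :=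
  (Finset.univ.filter fun p : Box lam => p.col = -1).image T

/-- Rational semistandard fillings. The alphabet `ū < ⋯ < 1̄` is identified with `Fin u` as an
ordered set. The filling `T` has the entry `T p` in a box `p` of a positive column, and the dual
letter `-(T p)` in a box `p` of a negative column; dual letters are ordered by
`-b < -c` if and only if `c < b`. -/
structure IsRationalSemistandard {u : ℕ} {lam : GenPartition u} (T : Box lam → Fin u) : Prop where
  row_pos : ∀ p q : Box lam, p.row = q.row → 0 < p.col → p.col < q.col → T p ≤ T q
  row_neg : ∀ p q : Box lam, p.row = q.row → q.col < 0 → p.col < q.col → T q ≤ T p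
  col_pos : ∀ p q : Box lam, p.col = q.col → 0 < p.col → p.row < q.row → T p < T q
  col_neg : ∀ p q : Box lam, p.col = q.col → p.col < 0 → p.row < q.row → T q < T p
  /-- The `i`-th smallest letter whose dual is not in the column `-1` is at most the `i`-th entry
  of the column `1`. -/
  compat : ∀ p : Box lam, p.col = 1 →
    ∃ h : (p.row : ℕ) < (entriesOfColNegOne T)ᶜ.card,
      (entriesOfColNegOne T)ᶜ.orderEmbOfFin rfl ⟨p.row, h⟩ ≤ T p

/-- The set `B_u(λ)` of rational semistandard tableaux of shape `λ`. -/
abbrev RationalTableau {u : ℕ} (lam : GenPartition u) : Type :=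
  {T : Box lam → Fin u // IsRationalSemistandard T}

/-- The weight of a filling: an entry `b` contributes `ε_b`, an entry `-b` contributes `-ε_b`. -/
def rationalWt {u : ℕ} {lam : GenPartition u} (T : Box lam → Fin u) : Fin u →₀ ℤ :=
  ∑ p : Box lam, Finsupp.single (T p) (if 0 < p.col then 1 else -1)

/-- The Laurent polynomial ring in the variables `y_b`. -/
abbrev Laurent (u : ℕ) : Type := AddMonoidAlgebra ℤ (Fin u →₀ ℤ)

/-- The rational Schur function `s_λ(y) = ∑_{T ∈ B_u(λ)} y^{wt T}`. -/
def rationalSchur {u : ℕ} (lam : GenPartition u) : Laurent u :=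
  open Classical in
  ∑ T : RationalTableau lam, AddMonoidAlgebra.single (rationalWt T.1) 1

/-- `s_ν(y)` for a partition `ν`; it is zero if `ν` has more than `u` parts. -/
def schurY (u : ℕ) (ν : YoungDiagram) : Laurent u :=
  if ν.colLen 0 ≤ u then rationalSchur (GenPartition.ofPartition u ν) else 0

/-- `s_{μ*}(y) = s_μ(y⁻¹)` for a partition `μ`; it is zero if `μ` has more than `u` parts. -/
def schurYStar (u : ℕ) (μ : YoungDiagram) : Laurent u :=
  if μ.colLen 0 ≤ u then rationalSchur (GenPartition.ofPartition u μ).star else 0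

/-- `N μ ν κ` is the coefficient `N^κ_{μν}` in
`s_{μ*}(y) s_ν(y) = ∑_{κ ∈ ℤ^u_+} N^κ_{μν} s_κ(y)`, for all partitions `μ`, `ν`. -/
def IsLRCoefficients (u : ℕ) (N : YoungDiagram → YoungDiagram → GenPartition u →₀ ℕ) : Prop :=
  ∀ μ ν : YoungDiagram,
    schurYStar u μ * schurY u ν = (N μ ν).sum fun κ n => n • rationalSchur κ

end SemiInf

end

noncomputable section

namespace SemiInf

open Equiv Equiv.Perm Finset

/-! ### Monomials and alternants -/

/-! Fix a monomial `x^γ`. Describe each word of a tableau by the number `M_i(t)` of its letters at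
position at least `t`. After a shift, a negation and a reversal of the rows, the vectors `M(t)`,
read for `t` from `-N` to `N`, form a chain in `ℤ^u_+` from `0` to `λ*`: every barred letter `b`
removes a vertical strip, every unbarred one adds a horizontal strip, and the strip has size
`|γ_b|`. The conditions between neighbouring words are exactly the strip conditions
(`ncard_weightSpace`).

By the Pieri rules the number of these chains is the coefficient of `s_{λ*}(y)` in the product of
all `e_{|γ_b|}(y⁻¹)`, `b` barred, and all `h_{|γ_b|}(y)`, `b` unbarred (`finite_chains`). Chains
with only one kind of step are semistandard tableaux, so the two halves of the product expand in the
`s_{μ*}` and in the `s_ν`, the coefficients being the numbers of tableaux of shape `μ'`, resp. `ν`,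
with content given by `γ` (`prod_vert_eq_sum`, `prod_horiz_eq_sum`). Multiplying the halves and
inserting the definition of `N^{λ*}_{μν}` gives the coefficient of `x^γ` on the right. Only finitely
many pairs contribute, since `γ` fixes the sizes of `μ` and `ν`.

All this rests on the bialternant formula `a_ρ s_κ = a_{κ+ρ}` for rational Schur functions: it
allows coefficients of `s_κ` to be read off as coefficients of `y^{κ+ρ}` after multiplication by
`a_ρ` (`schurCoeff`). Rational tableaux are translated into Gelfand–Tsetlin patterns
(`rationalTableauEquiv`), where positive and negative columns are treated alike. Then a
sign-reversing involution in the style of Stembridge's proof of the Littlewood–Richardson rule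
yields `a_{τ+ρ} s_κ = ∑ a_{τ+wt+ρ}`, summed over the patterns dominant over `τ`
(`alternant_mul_sum_gt`). For `τ = 0` only the highest weight pattern survives, which is the
bialternant formula; for general `τ` the sum shows that products of rational Schur functions have
non-negative coefficients. -/

/-- The Laurent monomial `y^α`. -/
def mon {u : ℕ} (α : Fin u → ℤ) : Laurent u :=
  AddMonoidAlgebra.single (Finsupp.equivFunOnFinite.symm α) 1

theorem mon_mul_mon {u : ℕ} (α β : Fin u → ℤ) : mon α * mon β = mon (α + β) := by
  rw [mon, mon, mon, AddMonoidAlgebra.single_mul_single, mul_one]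
  congr 1
  ext
  rfl

theorem coeff_mon {u : ℕ} (α β : Fin u → ℤ) :
    (mon α).coeff (Finsupp.equivFunOnFinite.symm β) = if α = β then 1 else 0 := by
  classical
  rw [mon, AddMonoidAlgebra.coeff_single, Finsupp.single_apply]
  simp

/-- The alternant `∑_σ sgn(σ) y^{σ(α)}`. -/
def alternant {u : ℕ} (α : Fin u → ℤ) : Laurent u :=
  ∑ σ : Perm (Fin u), (sign σ : ℤ) • mon (α ∘ σ)

theorem alternant_comp {u : ℕ} (α : Fin u → ℤ) (τ : Perm (Fin u)) :
    alternant (α ∘ τ) = (sign τ : ℤ) • alternant α := by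
  rw [alternant, alternant, smul_sum]
  refine Fintype.sum_equiv (Equiv.mulLeft τ) _ _ fun σ => ?_
  rw [Equiv.coe_mulLeft, smul_smul, Perm.sign_mul, Units.val_mul, ← mul_assoc, ← Units.val_mul,
    Int.units_mul_self, Units.val_one, one_mul]
  rfl

theorem alternant_comp_swap {u : ℕ} (α : Fin u → ℤ) {i j : Fin u} (h : i ≠ j) :
    alternant (α ∘ swap i j) = -alternant α := by
  rw [alternant_comp, sign_swap h]
  simp

theorem eq_zero_of_eq_neg_self {u : ℕ} {P : Laurent u} (h : P = -P) : P = 0 := by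
  ext m
  have := congrArg (fun Q : Laurent u => Q.coeff m) h
  simp only [AddMonoidAlgebra.coeff_neg, Finsupp.neg_apply] at this
  simp only [AddMonoidAlgebra.coeff_zero, Finsupp.zero_apply]
  omega

theorem alternant_eq_zero {u : ℕ} {α : Fin u → ℤ} {i j : Fin u} (h : i ≠ j) (hα : α i = α j) :
    alternant α = 0 := by
  apply eq_zero_of_eq_neg_self
  rw [← alternant_comp_swap α h]
  congr 1
  ext k
  rw [Function.comp_apply, swap_apply_def]
  split_ifs with h1 h2
  · rw [h1, hα]
  · rw [h2, hα]
  · rfl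

/-- Multiplying an alternant by a symmetric sum of monomials. -/
theorem alternant_mul_sum {u : ℕ} {ι : Type*} (S : Finset ι) (f : ι → Fin u → ℤ)
    (hf : ∀ σ : Perm (Fin u), ∃ e : ι → ι, (∀ i ∈ S, e i ∈ S) ∧ Set.InjOn e S ∧
      ∀ i ∈ S, f (e i) = f i ∘ σ)
    (α : Fin u → ℤ) :
    alternant α * ∑ i ∈ S, mon (f i) = ∑ i ∈ S, alternant (α + f i) := by
  classical
  simp only [alternant]
  rw [sum_mul, sum_comm]
  refine sum_congr rfl fun σ _ => ?_
  obtain ⟨e, he, hinj, hfe⟩ := hf σ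
  rw [smul_mul_assoc, mul_sum, ← smul_sum]
  congr 1
  simp only [mon_mul_mon]
  symm
  -- Replacing `i` by `e i` turns `α ∘ σ + f i` into `(α + f i) ∘ σ`. Surjectivity of `e` follows
  -- from injectivity, `S` being finite.
  refine sum_bij (fun i _ => e i) he (fun a ha b hb h => hinj ha hb h) ?_ ?_
  · intro b hb
    obtain ⟨a, ha, h⟩ := surj_on_of_inj_on_of_card_le (fun i _ => e i) he
      (fun a b ha hb h => hinj ha hb h) le_rfl b hb
    exact ⟨a, ha, h.symm⟩
  · intro i hi
    rw [hfe i hi]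
    rfl

/-- The staircase vector `(0, -1, …, -(u-1))`. -/
def stair (u : ℕ) : Fin u → ℤ := fun i => -(i : ℤ)

theorem stair_strictAnti (u : ℕ) : StrictAnti (stair u) := fun i j h => by
  have : (i : ℕ) < j := h
  simp only [stair]
  omega

theorem strictAnti_add_stair {u : ℕ} {κ : Fin u → ℤ} (h : Antitone κ) :
    StrictAnti (κ + stair u) := fun i j hij => by
  have h1 := h hij.le
  have h2 := stair_strictAnti u hij
  simp only [Pi.add_apply]
  omega

theorem perm_eq_one_of_strictAnti {u : ℕ} {α : Fin u → ℤ} {σ : Perm (Fin u)}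
    (h : StrictAnti α) (hσ : StrictAnti (α ∘ σ)) : σ = 1 := by
  have hm : StrictMono σ := fun i j hij => by
    have := hσ hij
    exact (h.lt_iff_gt).1 this
  have := Subsingleton.elim (hm.orderIsoOfSurjective σ σ.surjective) (OrderIso.refl _)
  ext i
  exact congrArg (fun e : Fin u ≃o Fin u => ((e i : Fin u) : ℕ)) this

/-- The orbit of `α` under permutations contains only one strictly decreasing vector, so one
coefficient detects the alternant. -/
theorem coeff_alternant {u : ℕ} {α β : Fin u → ℤ} (hα : StrictAnti α) (hβ : StrictAnti β) :
    (alternant α).coeff (Finsupp.equivFunOnFinite.symm β) = if α = β then 1 else 0 := by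
  rw [alternant, AddMonoidAlgebra.coeff_sum, Finsupp.finsetSum_apply,
    sum_eq_single (1 : Perm (Fin u))]
  · rw [AddMonoidAlgebra.coeff_smul_apply, coeff_mon]
    simp
  · intro σ _ hσ
    rw [AddMonoidAlgebra.coeff_smul_apply, coeff_mon, if_neg, smul_zero]
    rintro rfl
    exact hσ (perm_eq_one_of_strictAnti hα hβ)
  · simp

/-- The coefficient of `y^{κ+ρ}` in `a_ρ P`, that is, the coefficient of `s_κ` in `P` if `P` is
symmetric. -/
def schurCoeff {u : ℕ} (κ : GenPartition u) : Laurent u →+ ℤ where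
  toFun P := (alternant (stair u) * P).coeff (Finsupp.equivFunOnFinite.symm (κ.1 + stair u))
  map_zero' := by simp
  map_add' P Q := by
    rw [mul_add, AddMonoidAlgebra.coeff_add, Finsupp.add_apply]

theorem alternant_stair_ne_zero (u : ℕ) : alternant (stair u) ≠ 0 := fun h => by
  have := coeff_alternant (stair_strictAnti u) (stair_strictAnti u)
  rw [h] at this
  simp at this

/-- The bridge from algebra to counting: once `a_ρ P` is written with dominant alternants, the
coefficients of `P` are cardinalities. -/
theorem schurCoeff_of_eq_sum {u : ℕ} {ι : Type*} (S : Finset ι) (f : ι → Fin u → ℤ)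
    (hf : ∀ i ∈ S, Antitone (f i)) {P : Laurent u}
    (hP : alternant (stair u) * P = ∑ i ∈ S, alternant (f i + stair u)) (κ : GenPartition u) :
    schurCoeff κ P = #{i ∈ S | f i = κ.1} := by
  have : schurCoeff κ P = ∑ i ∈ S, if f i = κ.1 then 1 else 0 := by
    simp only [schurCoeff, AddMonoidHom.coe_mk, ZeroHom.coe_mk]
    rw [hP, AddMonoidAlgebra.coeff_sum, Finsupp.finsetSum_apply]
    refine sum_congr rfl fun i hi => ?_
    rw [coeff_alternant (strictAnti_add_stair (hf i hi)) (strictAnti_add_stair κ.2)]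
    simp only [add_left_inj]
  rw [this, sum_boole]

/-! ### Gelfand–Tsetlin patterns -/

/-- Gelfand–Tsetlin patterns with top row `κ`: the row `k ≤ u` has the entries `g k i`, `i < k`. -/
structure IsGT {u : ℕ} (κ : Fin u → ℤ) (g : ℕ → ℕ → ℤ) : Prop where
  top : ∀ i : Fin u, g u i = κ i
  upper : ∀ k i, i < k → k < u → g k i ≤ g (k + 1) i
  lower : ∀ k i, i < k → k < u → g (k + 1) (i + 1) ≤ g k i
  outside : ∀ k i, u < k ∨ k ≤ i → g k i = 0

/-- The type of Gelfand–Tsetlin patterns with top row `κ`. -/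
abbrev GTPattern {u : ℕ} (κ : Fin u → ℤ) : Type := {g : ℕ → ℕ → ℤ // IsGT κ g}

/-- The sum of row `k`. -/
def rowSum (g : ℕ → ℕ → ℤ) (k : ℕ) : ℤ := ∑ i ∈ range k, g k i

/-- The weight of a pattern: the differences of successive row sums. -/
def gtWt (u : ℕ) (g : ℕ → ℕ → ℤ) : Fin u → ℤ := fun a => rowSum g (a + 1) - rowSum g a

/-- The part of a pattern below the cut `c`. -/
def minSum (g : ℕ → ℕ → ℤ) (c : ℤ) (k : ℕ) : ℤ := ∑ i ∈ range k, min (g k i) c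

/-- The part of a pattern above the cut `c`. -/
def maxSum (g : ℕ → ℕ → ℤ) (c : ℤ) (k : ℕ) : ℤ := ∑ i ∈ range k, max (g k i) c

theorem minSum_add_maxSum (g : ℕ → ℕ → ℤ) (c : ℤ) (k : ℕ) :
    minSum g c k + maxSum g c k = rowSum g k + k * c := by
  rw [minSum, maxSum, rowSum, ← sum_add_distrib]
  simp only [min_add_max, sum_add_distrib, sum_const, card_range, nsmul_eq_mul]

/-- The lower end of the interval in which the entry `i` of row `k + 1` can move, below the
cut `c`. -/
def toggleLo (g : ℕ → ℕ → ℤ) (c : ℤ) (k i : ℕ) : ℤ :=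
  if i < k then max (min (g (k + 1 + 1) (i + 1)) c) (min (g k i) c) else min (g (k + 1 + 1) (i + 1)) c

/-- The upper end of the interval in which the entry `i` of row `k + 1` can move, below the
cut `c`. -/
def toggleHi (g : ℕ → ℕ → ℤ) (c : ℤ) (k i : ℕ) : ℤ :=
  if 0 < i then min (min (g (k + 1 + 1) i) c) (min (g k (i - 1)) c) else min (g (k + 1 + 1) i) c

/-- The Bender–Knuth involution on row `k + 1`, applied to the part below the cut `c`. -/
def toggle (c : ℤ) (k : ℕ) (g : ℕ → ℕ → ℤ) : ℕ → ℕ → ℤ := fun r i =>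
  if r = k + 1 ∧ i < k + 1 then
    -- Split an entry `x` as `(max x c - c) + min x c`; the first summand is kept and the second is
    -- reflected in its interval.
    max (g r i) c - c + (toggleLo g c k i + toggleHi g c k i - min (g r i) c)
  else g r i

/-- Whenever an entry of row `k + 1` is above the cut `c`, so is the entry below it. -/
def Cuttable (c : ℤ) (k : ℕ) (g : ℕ → ℕ → ℤ) : Prop :=
  ∀ i < k + 1, c < g (k + 1) i → i < k ∧ c < g k i

theorem toggle_of_ne {c : ℤ} {k r : ℕ} (g : ℕ → ℕ → ℤ) (h : r ≠ k + 1) (i : ℕ) :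
    toggle c k g r i = g r i := by
  rw [toggle, if_neg (fun hh => h hh.1)]

/-- The lower end at `i` and the upper end at `i + 1` are the maximum and the minimum of the same
two neighbours, so together they contribute the sum of these; the two outermost ends supply the
remaining entries of row `k + 2`. -/
theorem sum_toggleLo_add_toggleHi (g : ℕ → ℕ → ℤ) (c : ℤ) (k : ℕ) :
    ∑ i ∈ range (k + 1), (toggleLo g c k i + toggleHi g c k i) =
      minSum g c (k + 1 + 1) + minSum g c k := by
  have h1 : ∑ i ∈ range (k + 1), toggleLo g c k i =
      ∑ i ∈ range k, max (min (g (k + 1 + 1) (i + 1)) c) (min (g k i) c) +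
        min (g (k + 1 + 1) (k + 1)) c := by
    rw [sum_range_succ]
    congr 1
    · exact sum_congr rfl fun i hi => if_pos (mem_range.1 hi)
    · exact if_neg (lt_irrefl k)
  have h2 : ∑ i ∈ range (k + 1), toggleHi g c k i =
      ∑ i ∈ range k, min (min (g (k + 1 + 1) (i + 1)) c) (min (g k i) c) + min (g (k + 1 + 1) 0) c := by
    rw [sum_range_succ']
    rfl
  have h3 : ∑ i ∈ range k, max (min (g (k + 1 + 1) (i + 1)) c) (min (g k i) c) +
      ∑ i ∈ range k, min (min (g (k + 1 + 1) (i + 1)) c) (min (g k i) c) =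
      ∑ i ∈ range k, min (g (k + 1 + 1) (i + 1)) c + ∑ i ∈ range k, min (g k i) c := by
    rw [← sum_add_distrib, ← sum_add_distrib]
    exact sum_congr rfl fun i _ => max_add_min _ _
  rw [sum_add_distrib, h1, h2, minSum, minSum, sum_range_succ, sum_range_succ']
  linarith

/-! ### The Bender–Knuth involution below a cut -/

section Toggle

variable {u : ℕ} {κ : Fin u → ℤ} {g : ℕ → ℕ → ℤ} {c : ℤ} {k : ℕ}

theorem IsGT.toggleLo_le (hg : IsGT κ g) (hk : k + 1 < u) {i : ℕ} (hi : i < k + 1) :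
    toggleLo g c k i ≤ min (g (k + 1) i) c := by
  have h1 := hg.lower (k + 1) i hi hk
  rw [toggleLo]
  split_ifs with h
  · have h2 := hg.upper k i h (by omega)
    omega
  · omega

theorem IsGT.le_toggleHi (hg : IsGT κ g) (hk : k + 1 < u) {i : ℕ} (hi : i < k + 1) :
    min (g (k + 1) i) c ≤ toggleHi g c k i := by
  have h1 := hg.upper (k + 1) i hi hk
  rw [toggleHi]
  split_ifs with h
  · have h2 := hg.lower k (i - 1) (by omega) (by omega)
    rw [Nat.sub_add_cancel h] at h2
    omega
  · omega

theorem toggleHi_le (g : ℕ → ℕ → ℤ) (c : ℤ) (k i : ℕ) : toggleHi g c k i ≤ c := by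
  rw [toggleHi]
  split_ifs <;> omega

/-- Cuttability pushes the lower end of the interval up to `c`, which the upper end never exceeds;
reflection in this one-point interval does nothing. -/
theorem IsGT.toggle_of_lt (hg : IsGT κ g) (hk : k + 1 < u) (hc : Cuttable c k g) {i : ℕ}
    (hi : i < k + 1) (h : c < g (k + 1) i) :
    toggle c k g (k + 1) i = g (k + 1) i ∧ toggleLo g c k i + toggleHi g c k i = c + c := by
  have h1 := hg.le_toggleHi (c := c) hk hi
  have h2 := toggleHi_le g c k i
  have h3 : c ≤ toggleLo g c k i := by
    obtain ⟨h4, h5⟩ := hc i hi h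
    rw [toggleLo, if_pos h4]
    omega
  have h4 := hg.toggleLo_le (c := c) hk hi
  rw [toggle, if_pos ⟨rfl, hi⟩]
  omega

theorem toggle_of_le {i : ℕ} (hi : i < k + 1) (h : g (k + 1) i ≤ c) :
    toggle c k g (k + 1) i = toggleLo g c k i + toggleHi g c k i - g (k + 1) i := by
  rw [toggle, if_pos ⟨rfl, hi⟩]
  omega

theorem IsGT.toggle_mem (hg : IsGT κ g) (hk : k + 1 < u) {i : ℕ}
    (hi : i < k + 1) (h : g (k + 1) i ≤ c) :
    toggleLo g c k i ≤ toggle c k g (k + 1) i ∧ toggle c k g (k + 1) i ≤ toggleHi g c k i := by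
  have h1 := hg.le_toggleHi (c := c) hk hi
  have h2 := hg.toggleLo_le (c := c) hk hi
  rw [toggle_of_le hi h]
  omega

/-- Only the inequalities with rows `k` and `k + 2` are at stake. Entries above the cut do not move,
and the others stay between ends that encode these inequalities. -/
theorem IsGT.toggle (hg : IsGT κ g) (hk : k + 1 < u) (hc : Cuttable c k g) :
    IsGT κ (toggle c k g) where
  top i := by rw [toggle_of_ne g (by omega), hg.top]
  upper r i hi hr := by
    by_cases h1 : r = k + 1
    · subst h1
      rw [toggle_of_ne g (r := k + 1 + 1) (by omega)]
      rcases lt_or_ge c (g (k + 1) i) with h | h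
      · rw [(hg.toggle_of_lt hk hc hi h).1]
        exact hg.upper _ _ hi hr
      · refine (hg.toggle_mem hk hi h).2.trans ?_
        rw [toggleHi]
        split_ifs <;> omega
    · by_cases h2 : r = k
      · subst h2
        rw [toggle_of_ne g (r := r) (by omega)]
        have hu := hg.upper r i hi hr
        rcases lt_or_ge c (g (r + 1) i) with h | h
        · rw [(hg.toggle_of_lt hk hc (by omega) h).1]
          exact hu
        · refine le_trans ?_ (hg.toggle_mem hk (by omega) h).1
          rw [toggleLo, if_pos hi]
          omega
      · rw [toggle_of_ne g h1, toggle_of_ne g (by omega)]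
        exact hg.upper r i hi hr
  lower r i hi hr := by
    by_cases h1 : r = k + 1
    · subst h1
      rw [toggle_of_ne g (r := k + 1 + 1) (by omega)]
      have hl := hg.lower _ _ hi hr
      rcases lt_or_ge c (g (k + 1) i) with h | h
      · rw [(hg.toggle_of_lt hk hc hi h).1]
        exact hl
      · refine le_trans ?_ (hg.toggle_mem hk hi h).1
        rw [toggleLo]
        split_ifs <;> omega
    · by_cases h2 : r = k
      · subst h2
        rw [toggle_of_ne g (r := r) (by omega)]
        rcases lt_or_ge c (g (r + 1) (i + 1)) with h | h
        · rw [(hg.toggle_of_lt hk hc (by omega) h).1]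
          exact hg.lower r i hi hr
        · refine (hg.toggle_mem hk (by omega) h).2.trans ?_
          rw [toggleHi, if_pos (Nat.succ_pos i), Nat.add_sub_cancel]
          omega
      · rw [toggle_of_ne g h1, toggle_of_ne g (by omega)]
        exact hg.lower r i hi hr
  outside r i h := by
    rw [SemiInf.toggle, if_neg (by omega)]
    exact hg.outside r i h

/-- The part above the cut is untouched; hence the toggle cannot disturb what is observed at cuts `≥
c`. -/
theorem IsGT.max_toggle (hg : IsGT κ g) (hk : k + 1 < u) (hc : Cuttable c k g) (r i : ℕ) :
    max (SemiInf.toggle c k g r i) c = max (g r i) c := by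
  by_cases h1 : r = k + 1 ∧ i < k + 1
  · obtain ⟨rfl, hi⟩ := h1
    rcases lt_or_ge c (g (k + 1) i) with h | h
    · rw [(hg.toggle_of_lt hk hc hi h).1]
    · have := (hg.toggle_mem hk hi h).2.trans (toggleHi_le g c k i)
      omega
  · rw [SemiInf.toggle, if_neg h1]

theorem Cuttable.toggle (hc : Cuttable c k g) (hg : IsGT κ g) (hk : k + 1 < u) :
    Cuttable c k (toggle c k g) := by
  intro i hi h
  have h1 := hg.max_toggle hk hc (k + 1) i
  rw [toggle_of_ne g (by omega)]
  exact hc i hi (by omega)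

theorem IsGT.toggle_toggle (hg : IsGT κ g) (hk : k + 1 < u) (hc : Cuttable c k g) :
    SemiInf.toggle c k (SemiInf.toggle c k g) = g := by
  funext r i
  by_cases h1 : r = k + 1 ∧ i < k + 1
  · obtain ⟨rfl, hi⟩ := h1
    rcases lt_or_ge c (g (k + 1) i) with h | h
    · have h2 := (hg.toggle_of_lt hk hc hi h).1
      rw [((hg.toggle hk hc).toggle_of_lt hk (hc.toggle hg hk) hi (by rwa [h2])).1, h2]
    · have h2 := (hg.toggle_mem hk hi h).2.trans (toggleHi_le g c k i)
      rw [toggle_of_le hi h2, toggle_of_le hi h]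
      have h3 : toggleLo (SemiInf.toggle c k g) c k i = toggleLo g c k i := by
        simp only [toggleLo]
        rw [toggle_of_ne g (by omega), toggle_of_ne g (by omega)]
      have h4 : toggleHi (SemiInf.toggle c k g) c k i = toggleHi g c k i := by
        simp only [toggleHi]
        rw [toggle_of_ne g (by omega), toggle_of_ne g (by omega)]
      omega
  · rw [SemiInf.toggle, if_neg h1, SemiInf.toggle, if_neg h1]

theorem IsGT.rowSum_toggle (hg : IsGT κ g) (hk : k + 1 < u) (hc : Cuttable c k g) :
    rowSum (SemiInf.toggle c k g) (k + 1) =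
      rowSum g (k + 1) + minSum g c (k + 1 + 1) - 2 * minSum g c (k + 1) + minSum g c k := by
  have h : ∀ i ∈ range (k + 1), SemiInf.toggle c k g (k + 1) i =
      g (k + 1) i - 2 * min (g (k + 1) i) c + (toggleLo g c k i + toggleHi g c k i) := by
    intro i hi
    have hi := mem_range.1 hi
    rcases lt_or_ge c (g (k + 1) i) with h | h
    · obtain ⟨h1, h2⟩ := hg.toggle_of_lt hk hc hi h
      rw [h1, h2, min_eq_right h.le]
      ring
    · rw [toggle_of_le hi h, min_eq_left h]
      ring
  rw [rowSum, sum_congr rfl h, sum_add_distrib, sum_sub_distrib, ← mul_sum,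
    sum_toggleLo_add_toggleHi, rowSum, minSum, minSum, minSum]
  ring

/-- The toggle exchanges two entries of a shifted weight. -/
theorem IsGT.add_gtWt_toggle (hg : IsGT κ g) (hk : k + 1 < u) (hc : Cuttable c k g)
    (β : Fin u → ℤ)
    (hβ : (β + gtWt u g) ⟨k + 1, hk⟩ - (β + gtWt u g) ⟨k, by omega⟩ =
      minSum g c (k + 1 + 1) - 2 * minSum g c (k + 1) + minSum g c k) :
    β + gtWt u (SemiInf.toggle c k g) =
      (β + gtWt u g) ∘ swap ⟨k, by omega⟩ ⟨k + 1, hk⟩ := by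
  -- The toggle adds the second difference of `minSum` to the weight at `k` and subtracts it at `k +
  -- 1`. By `hβ` this is the gap between the two shifted entries, which are therefore exchanged.
  have hr : ∀ r, r ≠ k + 1 → rowSum (SemiInf.toggle c k g) r = rowSum g r := fun r h =>
    sum_congr rfl fun i _ => toggle_of_ne g h i
  have hs := hg.rowSum_toggle hk hc
  simp only [Pi.add_apply, gtWt] at hβ
  ext a
  rw [Function.comp_apply, swap_apply_def]
  split_ifs with h1 h2
  · subst h1
    simp only [Pi.add_apply, gtWt]
    rw [hs, hr k (by omega)]
    linarith
  · subst h2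
    simp only [Pi.add_apply, gtWt]
    rw [hs, hr (k + 1 + 1) (by omega)]
    linarith
  · simp only [Pi.add_apply, gtWt]
    rw [Fin.ext_iff] at h1 h2
    simp only at h1 h2
    rw [hr _ (by omega), hr _ h2]

end Toggle

theorem IsGT.le_top {u : ℕ} {κ : Fin u → ℤ} {g : ℕ → ℕ → ℤ} (hg : IsGT κ g) {k i : ℕ}
    (hi : i < k) (hk : k ≤ u) : g k i ≤ κ ⟨i, by omega⟩ := by
  rw [← hg.top]
  have : ∀ r, k ≤ r → r ≤ u → g k i ≤ g r i := by
    intro r hr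
    induction r, hr using Nat.le_induction with
    | base => exact fun _ => le_rfl
    | succ r hr ih => exact fun h => (ih (by omega)).trans (hg.upper r i (by omega) (by omega))
  exact this u hk le_rfl

theorem exists_upper_bound {u : ℕ} (κ : Fin u → ℤ) : ∃ c, ∀ i, κ i ≤ c := by
  obtain ⟨c, hc⟩ := (Set.finite_range κ).bddAbove
  exact ⟨c, fun i => hc ⟨i, rfl⟩⟩

/-- The multiset of weights of the patterns is symmetric. -/
theorem exists_perm_gtWt {u : ℕ} (κ : Fin u → ℤ) (σ : Perm (Fin u)) :
    ∃ e : Perm (GTPattern κ), ∀ T, gtWt u (e T).1 = gtWt u T.1 ∘ σ := by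
  rcases u with _ | u
  · exact ⟨1, fun T => Subsingleton.elim _ _⟩
  have hσ : σ ∈ Submonoid.closure (Set.range fun i : Fin u => swap i.castSucc i.succ) := by
    rw [mclosure_swap_castSucc_succ]
    trivial
  induction hσ using Submonoid.closure_induction with
  | one => exact ⟨1, fun T => rfl⟩
  | mul σ τ _ _ h1 h2 =>
    obtain ⟨e1, h1⟩ := h1
    obtain ⟨e2, h2⟩ := h2
    refine ⟨e2 * e1, fun T => ?_⟩
    rw [Perm.mul_apply, h2, h1]
    rfl
  | mem σ h =>
    obtain ⟨k, rfl⟩ := h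
    -- With a cut above all entries, cuttability is vacuous, `minSum` is the row sum, and the toggle
    -- is the classical Bender–Knuth involution.
    obtain ⟨c, hκ⟩ := exists_upper_bound κ
    have hle : ∀ T : GTPattern κ, ∀ r i, i < r → r ≤ u + 1 → T.1 r i ≤ c :=
      fun T r i hi hr => (T.2.le_top hi hr).trans (hκ _)
    have hc : ∀ T : GTPattern κ, Cuttable c k T.1 := fun T i hi h =>
      absurd (hle T _ i hi (by omega)) (not_le.2 h)
    have hk : (k : ℕ) + 1 < u + 1 := by omega
    have hinv : Function.Involutive
        (fun T : GTPattern κ => (⟨toggle c k T.1, T.2.toggle hk (hc T)⟩ : GTPattern κ)) :=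
      fun T => Subtype.ext (T.2.toggle_toggle hk (hc T))
    refine ⟨hinv.toPerm, fun T => ?_⟩
    have hm : ∀ r ≤ u + 1, minSum T.1 c r = rowSum T.1 r := fun r hr =>
      sum_congr rfl fun i hi => min_eq_left (hle T r i (mem_range.1 hi) hr)
    have := T.2.add_gtWt_toggle hk (hc T) 0 (by
      rw [hm _ (by omega), hm _ (by omega), hm _ (by omega)]
      simp only [zero_add, gtWt]
      ring)
    rw [zero_add, zero_add] at this
    exact this

/-! ### Multiplying an alternant by the generating function of the patterns -/

/-- The weight of the part of a pattern above the cut `c`, up to a constant. -/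
def upperWt (g : ℕ → ℕ → ℤ) (c : ℤ) (a : ℕ) : ℤ := maxSum g c (a + 1) - maxSum g c a

/-- The part above the cut `c` destroys the dominance of `τ` at the position `k`. -/
def Violates {u : ℕ} (τ : Fin u → ℤ) (g : ℕ → ℕ → ℤ) (c : ℤ) (k : ℕ) : Prop :=
  ∃ h : k + 1 < u, τ ⟨k, by omega⟩ + upperWt g c k < τ ⟨k + 1, h⟩ + upperWt g c (k + 1)

/-- The first violation, when the cut moves down. -/
structure IsFirstViolation {u : ℕ} (τ : Fin u → ℤ) (g : ℕ → ℕ → ℤ) (c : ℤ) (k : ℕ) : Prop where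
  violates : Violates τ g c k
  above : ∀ c' k', c < c' → ¬ Violates τ g c' k'
  before : ∀ k' < k, ¬ Violates τ g c k'

/-- A pattern is dominant over `τ` if no cut violates the dominance. -/
def IsDominantOver {u : ℕ} (τ : Fin u → ℤ) (g : ℕ → ℕ → ℤ) : Prop := ∀ c k, ¬ Violates τ g c k

/-! ### The first violation of dominance and its invariance under the toggle -/

section Violation

variable {u : ℕ} {τ κ : Fin u → ℤ} {g : ℕ → ℕ → ℤ} {c : ℤ} {k : ℕ}

theorem IsFirstViolation.unique {c' : ℤ} {k' : ℕ} (h : IsFirstViolation τ g c k)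
    (h' : IsFirstViolation τ g c' k') : c = c' ∧ k = k' := by
  have hc : c = c' := by
    rcases lt_trichotomy c c' with hlt | heq | hlt
    · exact absurd h'.violates (h.above _ _ hlt)
    · exact heq
    · exact absurd h.violates (h'.above _ _ hlt)
  subst hc
  refine ⟨rfl, ?_⟩
  rcases lt_trichotomy k k' with hlt | heq | hlt
  · exact absurd h.violates (h'.before _ hlt)
  · exact heq
  · exact absurd h'.violates (h.before _ hlt)

theorem IsGT.upperWt_of_bound (hg : IsGT κ g) (hκ : ∀ i, κ i ≤ c) {a : ℕ} (ha : a < u) :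
    upperWt g c a = c := by
  have : ∀ r ≤ u, maxSum g c r = r * c := fun r hr => by
    rw [maxSum, sum_congr rfl fun i hi =>
      max_eq_right ((hg.le_top (mem_range.1 hi) hr).trans (hκ _))]
    simp
  rw [upperWt, this _ (by omega), this _ ha.le]
  push_cast
  ring

/-- Above all entries of the pattern the upper part has constant weight, and `τ` alone is dominant;
so the violating cuts are bounded above and there is a greatest one. -/
theorem IsGT.exists_isFirstViolation (hg : IsGT κ g) (hτ : Antitone τ)
    (h : ¬ IsDominantOver τ g) : ∃ c k, IsFirstViolation τ g c k := by
  classical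
  obtain ⟨b, hb⟩ := exists_upper_bound κ
  simp only [IsDominantOver, not_forall, not_not] at h
  obtain ⟨c₀, k₀, h₀⟩ := h
  have hbd : ∀ c, (∃ k, Violates τ g c k) → c ≤ b := by
    rintro c ⟨k, hk, hv⟩
    by_contra hcb
    rw [hg.upperWt_of_bound (fun i => (hb i).trans (by omega)) (by omega),
      hg.upperWt_of_bound (fun i => (hb i).trans (by omega)) hk] at hv
    have := hτ (Fin.mk_le_mk.2 (Nat.le_succ k) : (⟨k, by omega⟩ : Fin u) ≤ ⟨k + 1, hk⟩)
    omega
  obtain ⟨c, hc, hmax⟩ := Int.exists_greatest_of_bdd ⟨b, hbd⟩ ⟨c₀, k₀, h₀⟩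
  refine ⟨c, Nat.find hc, Nat.find_spec hc, fun c' k' hlt hv => ?_, fun k' hk' => Nat.find_min hc hk'⟩
  have := hmax c' ⟨k', hv⟩
  omega

/-- The number of entries of row `r` that are at most `c`. -/
def countLe (g : ℕ → ℕ → ℤ) (c : ℤ) (r : ℕ) : ℤ := ∑ i ∈ range r, if g r i ≤ c then 1 else 0

theorem upperWt_succ (g : ℕ → ℕ → ℤ) (c : ℤ) (a : ℕ) :
    upperWt g (c + 1) a = upperWt g c a + (countLe g c (a + 1) - countLe g c a) := by
  have : ∀ r, maxSum g (c + 1) r = maxSum g c r + countLe g c r := fun r => by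
    rw [maxSum, maxSum, countLe, ← sum_add_distrib]
    refine sum_congr rfl fun i _ => ?_
    split_ifs <;> omega
  rw [upperWt, upperWt, this, this]
  ring

/-- Interlacing makes the count grow by `0` or `1` from row `a` to row `a + 1` (see also
`countLe_succ_le`). In tableau language, a letter occurs at most once in the column `c + 1`; the
count grows exactly if it does not occur there. -/
theorem IsGT.countLe_le (hg : IsGT κ g) {a : ℕ} (ha : a < u) :
    countLe g c a ≤ countLe g c (a + 1) := by
  rw [countLe, countLe, sum_range_succ']
  have : ∑ i ∈ range a, (if g a i ≤ c then (1 : ℤ) else 0) ≤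
      ∑ i ∈ range a, if g (a + 1) (i + 1) ≤ c then (1 : ℤ) else 0 := by
    refine sum_le_sum fun i hi => ?_
    have := hg.lower a i (mem_range.1 hi) ha
    split_ifs <;> omega
  split_ifs <;> omega

theorem IsGT.sum_countLe_le (hg : IsGT κ g) {a : ℕ} (ha : a < u) :
    ∀ i ∈ range a, (if g (a + 1) i ≤ c then (1 : ℤ) else 0) ≤ if g a i ≤ c then 1 else 0 := by
  intro i hi
  have := hg.upper a i (mem_range.1 hi) ha
  split_ifs <;> omega

theorem IsGT.countLe_succ_le (hg : IsGT κ g) {a : ℕ} (ha : a < u) :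
    countLe g c (a + 1) ≤ countLe g c a + 1 := by
  have h := sum_le_sum (hg.sum_countLe_le (c := c) ha)
  rw [countLe, countLe, sum_range_succ]
  split_ifs <;> omega

/-- The extreme case forces the last entry of row `k + 1` to be at most `c` and the termwise
comparison of the two rows to be an equality, which is cuttability. -/
theorem IsGT.cuttable_of_countLe (hg : IsGT κ g) (hk : k < u)
    (h : countLe g c (k + 1) = countLe g c k + 1) : Cuttable c k g := by
  have h1 := sum_le_sum (hg.sum_countLe_le (c := c) hk)
  rw [countLe, countLe, sum_range_succ] at h
  have h2 : g (k + 1) k ≤ c := by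
    by_contra hcon
    rw [if_neg hcon] at h
    omega
  rw [if_pos h2] at h
  have h3 := (sum_eq_sum_iff_of_le (hg.sum_countLe_le (c := c) hk)).1 (by omega)
  intro i hi hci
  have hik : i < k := by
    rcases Nat.lt_succ_iff_lt_or_eq.1 hi with h | rfl
    · exact h
    · omega
  have h4 := h3 i (mem_range.2 hik)
  rw [if_neg (not_le.2 hci)] at h4
  refine ⟨hik, ?_⟩
  by_contra hcon
  rw [if_pos (not_lt.1 hcon)] at h4
  omega

/-- There is a violation at `c` but none at `c + 1`, while each of the two weights changes by `0` or
`1` between these cuts. So the weight at `k` changes by `1`, the one at `k + 1` does not, and the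
defect is exactly `1`. -/
theorem IsFirstViolation.cuttable (h : IsFirstViolation τ g c k) (hg : IsGT κ g) :
    ∃ hk : k + 1 < u, Cuttable c k g ∧
      τ ⟨k, by omega⟩ + upperWt g c k + 1 = τ ⟨k + 1, hk⟩ + upperWt g c (k + 1) := by
  obtain ⟨hk, hv⟩ := h.violates
  have hnv := h.above (c + 1) k (by omega)
  simp only [Violates, not_exists, not_lt] at hnv
  have hnv := hnv hk
  rw [upperWt_succ, upperWt_succ] at hnv
  have h1 := hg.countLe_le (c := c) (a := k) (by omega)
  have h2 := hg.countLe_succ_le (c := c) (a := k) (by omega)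
  have h3 := hg.countLe_le (c := c) hk
  have h4 := hg.countLe_succ_le (c := c) hk
  exact ⟨hk, hg.cuttable_of_countLe (by omega) (by omega), by omega⟩

theorem IsFirstViolation.toggle (h : IsFirstViolation τ g c k) (hg : IsGT κ g) :
    IsFirstViolation τ (toggle c k g) c k := by
  obtain ⟨hk, hc, -⟩ := h.cuttable hg
  have hV : ∀ c', c ≤ c' → ∀ a, upperWt (SemiInf.toggle c k g) c' a = upperWt g c' a := by
    intro c' hc' a
    have : ∀ r, maxSum (SemiInf.toggle c k g) c' r = maxSum g c' r := fun r =>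
      sum_congr rfl fun i _ => by
        have := hg.max_toggle hk hc r i
        omega
    rw [upperWt, upperWt, this, this]
  have hV' : ∀ c', c ≤ c' → ∀ a, Violates τ (SemiInf.toggle c k g) c' a ↔ Violates τ g c' a := by
    intro c' hc' a
    simp only [Violates, hV c' hc']
  exact ⟨(hV' c le_rfl k).2 h.violates, fun c' k' hlt => by
    rw [hV' c' hlt.le]; exact h.above c' k' hlt, fun k' hk' => by
    rw [hV' c le_rfl]; exact h.before k' hk'⟩

/-- Adding `ρ` cancels the defect `1`, so `τ + ρ` plus the upper weight agrees at `k` and `k + 1`.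
The gap between these entries of the full vector then comes from the lower part alone, and toggling
the lower part swaps them. -/
theorem IsFirstViolation.alternant_toggle (h : IsFirstViolation τ g c k) (hg : IsGT κ g) :
    alternant (τ + gtWt u (SemiInf.toggle c k g) + stair u) =
      -alternant (τ + gtWt u g + stair u) := by
  obtain ⟨hk, hc, heq⟩ := h.cuttable hg
  rw [add_right_comm τ _ (stair u), add_right_comm τ _ (stair u), hg.add_gtWt_toggle hk hc (τ + stair u),
    alternant_comp_swap]
  · rw [Ne, Fin.mk.injEq]
    omega
  · have h1 := minSum_add_maxSum g c k
    have h2 := minSum_add_maxSum g c (k + 1)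
    have h3 := minSum_add_maxSum g c (k + 1 + 1)
    simp only [upperWt] at heq
    simp only [Pi.add_apply, gtWt, stair]
    push_cast at h2 h3 ⊢
    linarith

end Violation

open Classical in
/-- Multiplying an alternant by the generating function of the patterns with top row `κ`. -/
theorem alternant_mul_sum_gt {u : ℕ} {τ κ : Fin u → ℤ} [Fintype (GTPattern κ)]
    (hτ : Antitone τ) :
    alternant (τ + stair u) * ∑ T : GTPattern κ, mon (gtWt u T.1) =
      ∑ T : GTPattern κ with IsDominantOver τ T.1, alternant (τ + gtWt u T.1 + stair u) := by
  rw [alternant_mul_sum]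
  · simp only [add_right_comm τ (stair u)]
    rw [← sum_filter_add_sum_filter_not univ (fun T : GTPattern κ => IsDominantOver τ T.1)]
    convert add_zero _
    have hex : ∀ T : GTPattern κ, T ∈ ({T | ¬ IsDominantOver τ T.1} : Finset (GTPattern κ)) →
        ∃ p : ℤ × ℕ, IsFirstViolation τ T.1 p.1 p.2 := fun T hT => by
      obtain ⟨c, k, h⟩ := T.2.exists_isFirstViolation hτ (mem_filter.1 hT).2
      exact ⟨(c, k), h⟩
    choose! p hp using hex
    have hmem : ∀ T ∈ ({T | ¬ IsDominantOver τ T.1} : Finset (GTPattern κ)),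
        IsGT κ (toggle (p T).1 (p T).2 T.1) := fun T hT => by
      obtain ⟨hk, hc, -⟩ := (hp T hT).cuttable T.2
      exact T.2.toggle hk hc
    have hnd : ∀ T (hT : T ∈ ({T | ¬ IsDominantOver τ T.1} : Finset (GTPattern κ))),
        (⟨_, hmem T hT⟩ : GTPattern κ) ∈ ({T | ¬ IsDominantOver τ T.1} : Finset (GTPattern κ)) :=
      fun T hT => mem_filter.2 ⟨mem_univ _, fun h =>
        h _ _ ((hp T hT).toggle T.2).violates⟩
    -- Toggling at the first violation keeps that violation first and changes the sign. A fixed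
    -- pattern has an alternant equal to its own negative, hence zero.
    refine sum_involution (fun T hT => ⟨_, hmem T hT⟩) (fun T hT => ?_) (fun T hT h0 heq => ?_)
      hnd (fun T hT => ?_)
    · rw [(hp T hT).alternant_toggle T.2, add_neg_cancel]
    · apply h0
      apply eq_zero_of_eq_neg_self
      rw [← (hp T hT).alternant_toggle T.2]
      have := congrArg Subtype.val heq
      simp only at this
      rw [this]
    · obtain ⟨h1, h2⟩ := ((hp T hT).toggle T.2).unique (hp _ (hnd T hT))
      obtain ⟨hk, hc, -⟩ := (hp T hT).cuttable T.2
      apply Subtype.ext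
      simp only
      rw [← h1, ← h2, T.2.toggle_toggle hk hc]
  · intro σ
    obtain ⟨e, he⟩ := exists_perm_gtWt κ σ
    exact ⟨e, fun _ _ => mem_univ _, e.injective.injOn, fun T _ => he T⟩

/-- A cut below all entries leaves the whole pattern above it. -/
theorem IsDominantOver.antitone {u : ℕ} {τ : Fin u → ℤ} {g : ℕ → ℕ → ℤ}
    (h : IsDominantOver τ g) : Antitone (τ + gtWt u g) := by
  obtain ⟨c, hc⟩ : ∃ c, ∀ r ≤ u, ∀ i < r, c ≤ g r i := by
    obtain ⟨c, hc⟩ := (((range (u + 1)) ×ˢ (range u)).image fun p => g p.1 p.2).bddBelow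
    refine ⟨c, fun r hr i hi => hc ?_⟩
    simp only [coe_image, Set.mem_image, mem_coe, mem_product, mem_range, Prod.exists]
    exact ⟨r, i, ⟨by omega, by omega⟩, rfl⟩
  have hs : ∀ r ≤ u, maxSum g c r = rowSum g r := fun r hr =>
    sum_congr rfl fun i hi => max_eq_left (hc r hr i (mem_range.1 hi))
  rcases u with _ | u
  · exact Subsingleton.antitone _
  refine Fin.antitone_iff_succ_le.2 fun i => ?_
  have := h c i
  simp only [Violates, not_exists, not_lt] at this
  have := this (by omega)
  simp only [upperWt] at this
  rw [hs _ (by omega), hs _ (by omega), hs _ (by omega)] at this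
  exact this

/-! ### The only pattern dominant over zero -/

/-- The pattern of highest weight. -/
def topPattern {u : ℕ} (κ : Fin u → ℤ) : ℕ → ℕ → ℤ := fun k i =>
  if h : i < k ∧ k ≤ u then κ ⟨i, by omega⟩ else 0

theorem isGT_topPattern {u : ℕ} {κ : Fin u → ℤ} (hκ : Antitone κ) : IsGT κ (topPattern κ) where
  top i := by rw [topPattern, dif_pos ⟨i.2, le_rfl⟩]
  upper k i hi hk := by rw [topPattern, topPattern, dif_pos (by omega), dif_pos (by omega)]
  lower k i hi hk := by
    rw [topPattern, topPattern, dif_pos (by omega), dif_pos (by omega)]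
    exact hκ (Fin.mk_le_mk.2 (by omega))
  outside k i h := by rw [topPattern, dif_neg (by omega)]

theorem upperWt_topPattern {u : ℕ} (κ : Fin u → ℤ) (c : ℤ) {a : ℕ} (ha : a < u) :
    upperWt (topPattern κ) c a = max (κ ⟨a, ha⟩) c := by
  rw [upperWt, maxSum, maxSum, sum_range_succ]
  have : ∀ i ∈ range a, max (topPattern κ (a + 1) i) c = max (topPattern κ a i) c := by
    intro i hi
    have := mem_range.1 hi
    rw [topPattern, topPattern, dif_pos (by omega), dif_pos (by omega)]
  rw [sum_congr rfl this, add_sub_cancel_left, topPattern, dif_pos (by omega)]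

theorem gtWt_topPattern {u : ℕ} (κ : Fin u → ℤ) : gtWt u (topPattern κ) = κ := by
  ext a
  rw [gtWt, rowSum, rowSum, sum_range_succ]
  have : ∀ i ∈ range (a : ℕ), topPattern κ (a + 1) i = topPattern κ a i := by
    intro i hi
    have := mem_range.1 hi
    rw [topPattern, topPattern, dif_pos (by omega), dif_pos (by omega)]
  rw [sum_congr rfl this, add_sub_cancel_left, topPattern, dif_pos (by omega)]

theorem isDominantOver_topPattern {u : ℕ} {κ : Fin u → ℤ} (hκ : Antitone κ) :
    IsDominantOver (0 : Fin u → ℤ) (topPattern κ) := by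
  rintro c k ⟨hk, h⟩
  rw [upperWt_topPattern κ c (by omega), upperWt_topPattern κ c hk] at h
  have := hκ (Fin.mk_le_mk.2 (Nat.le_succ k) : (⟨k, by omega⟩ : Fin u) ≤ ⟨k + 1, hk⟩)
  simp only [Pi.zero_apply] at h
  omega

theorem IsGT.antitone_row {u : ℕ} {κ : Fin u → ℤ} {g : ℕ → ℕ → ℤ} (hg : IsGT κ g)
    (hκ : Antitone κ) {k i j : ℕ} (hij : i ≤ j) (hj : j < k) (hk : k ≤ u) : g k j ≤ g k i := by
  induction j, hij using Nat.le_induction with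
  | base => exact le_rfl
  | succ j hij ih =>
    refine le_trans ?_ (ih (by omega))
    rcases hk.lt_or_eq with h | rfl
    · exact (hg.upper k _ hj h).trans (hg.lower k j (by omega) h)
    · rw [hg.top ⟨j + 1, hj⟩, hg.top ⟨j, by omega⟩]
      exact hκ (Fin.mk_le_mk.2 (Nat.le_succ j))

/-- Otherwise some entry increases from a row to the next. The increase that reaches the largest
value, and among these the one in the earliest row, produces a violation at the cut just below that
value. -/
theorem IsGT.eq_topPattern {u : ℕ} {κ : Fin u → ℤ} {g : ℕ → ℕ → ℤ} (hg : IsGT κ g)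
    (hκ : Antitone κ) (hd : IsDominantOver (0 : Fin u → ℤ) g) : g = topPattern κ := by
  have key : ∀ k i, i < k → k < u → g k i = g (k + 1) i := by
    by_contra hcon
    push Not at hcon
    obtain ⟨k₁, i₁, hi₁, hk₁, hne₁⟩ := hcon
    set D : Finset (ℕ × ℕ) := (range u ×ˢ range u).filter fun p => p.2 < p.1 ∧
      g p.1 p.2 < g (p.1 + 1) p.2 with hD
    have memD : ∀ k i, (k, i) ∈ D ↔ k < u ∧ i < k ∧ g k i < g (k + 1) i := by
      intro k i
      simp only [hD, mem_filter, mem_product, mem_range]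
      exact ⟨fun h => ⟨h.1.1, h.2⟩, fun h => ⟨⟨h.1, by omega⟩, h.2⟩⟩
    have hD₁ : D.Nonempty := ⟨(k₁, i₁), (memD _ _).2
      ⟨hk₁, hi₁, lt_of_le_of_ne (hg.upper _ _ hi₁ hk₁) hne₁⟩⟩
    obtain ⟨p, hp, hpmax⟩ := exists_max_image D (fun p => g (p.1 + 1) p.2) hD₁
    obtain ⟨q, hq, hqmin⟩ := exists_min_image (D.filter fun q => g (q.1 + 1) q.2 = g (p.1 + 1) p.2)
      (fun q => q.1) ⟨p, mem_filter.2 ⟨hp, rfl⟩⟩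
    obtain ⟨k, i⟩ := q
    obtain ⟨hq, hJ⟩ := mem_filter.1 hq
    obtain ⟨hk, hi, hlt⟩ := (memD _ _).1 hq
    simp only at hJ
    obtain ⟨a, rfl⟩ : ∃ a, k = a + 1 := ⟨k - 1, by omega⟩
    set c : ℤ := g (a + 1 + 1) i - 1 with hc
    -- By the choice of `(a + 1, i)`, no increase from row `a` to row `a + 1` reaches above `c`, and
    -- the new last entry is at most `c`; so nothing happens above the cut in this row, while the
    -- next row rises above it.
    have h1 : upperWt g c a = c := by
      have hlast : g (a + 1) a ≤ c := by
        have := hg.antitone_row hκ (i := i) (j := a) (k := a + 1) (by omega) (by omega) hk.le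
        omega
      have : ∀ j ∈ range a, max (g (a + 1) j) c = max (g a j) c := by
        intro j hj
        have hj := mem_range.1 hj
        have hle := hg.upper a j hj (by omega)
        rcases hle.lt_or_eq with hlt' | heq
        · have hmem := (memD a j).2 ⟨by omega, hj, hlt'⟩
          have h2 := hpmax _ hmem
          simp only at h2
          rcases h2.lt_or_eq with h3 | h3
          · omega
          · have := hqmin (a, j) (mem_filter.2 ⟨hmem, h3⟩)
            simp only at this
            omega
        · rw [heq]
      rw [upperWt, maxSum, maxSum, sum_range_succ, sum_congr rfl this, add_sub_cancel_left,
        max_eq_right hlast]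
    have h2 : c + 1 ≤ upperWt g c (a + 1) := by
      have : ∑ j ∈ range (a + 1), max (g (a + 1) j) c <
          ∑ j ∈ range (a + 1), max (g (a + 1 + 1) j) c := by
        refine sum_lt_sum (fun j hj => max_le_max_right _ (hg.upper _ _ (mem_range.1 hj) hk))
          ⟨i, mem_range.2 hi, ?_⟩
        omega
      rw [upperWt, maxSum, maxSum, sum_range_succ]
      have := le_max_right (g (a + 1 + 1) (a + 1)) c
      omega
    refine hd c a ⟨hk, ?_⟩
    simp only [Pi.zero_apply]
    omega
  funext k i
  by_cases h : i < k ∧ k ≤ u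
  · rw [topPattern, dif_pos h, ← hg.top]
    have : ∀ r, k ≤ r → r ≤ u → g k i = g r i := by
      intro r hr
      induction r, hr using Nat.le_induction with
      | base => exact fun _ => rfl
      | succ r hr ih => exact fun h => (ih (by omega)).trans (key r i (by omega) (by omega))
    exact this u h.2 le_rfl
  · rw [topPattern, dif_neg h]
    exact hg.outside k i (by omega)

/-- The bialternant formula for the generating function of the patterns. -/
theorem alternant_stair_mul_sum_gt {u : ℕ} {κ : Fin u → ℤ} [Fintype (GTPattern κ)]
    (hκ : Antitone κ) :
    alternant (stair u) * ∑ T : GTPattern κ, mon (gtWt u T.1) = alternant (κ + stair u) := by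
  classical
  have h := alternant_mul_sum_gt (τ := 0) (κ := κ) (fun _ _ _ => le_rfl)
  rw [zero_add] at h
  rw [h, sum_eq_single (⟨topPattern κ, isGT_topPattern hκ⟩ : GTPattern κ)]
  · simp only [gtWt_topPattern, zero_add]
  · intro T hT hne
    exact absurd (Subtype.ext (T.2.eq_topPattern hκ (mem_filter.1 hT).2)) hne
  · intro hn
    exact absurd (isDominantOver_topPattern hκ) (by simpa using hn)

/-! ### Rational tableaux and Gelfand–Tsetlin patterns -/

section Box

variable {u : ℕ} {lam : GenPartition u}

theorem Box.ext_row_col {p q : Box lam} (hr : p.row = q.row) (hc : p.col = q.col) : p = q := by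
  obtain ⟨i, j, hj⟩ := p
  obtain ⟨i', j', hj'⟩ := q
  obtain rfl : i = i' := hr
  obtain rfl : j = j' := hc
  rfl

theorem Box.col_cases (p : Box lam) :
    (1 ≤ p.col ∧ p.col ≤ lam.1 p.row) ∨ (lam.1 p.row ≤ p.col ∧ p.col ≤ -1) := by
  have := p.2.2
  rw [mem_union, mem_Icc, mem_Icc] at this
  exact this

theorem Box.le_of_pos {p : Box lam} (h : 0 < p.col) : p.col ≤ lam.1 p.row := by
  have := p.col_cases
  omega

theorem Box.le_of_neg {p : Box lam} (h : p.col < 0) : lam.1 p.row ≤ p.col := by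
  have := p.col_cases
  omega

theorem Box.exists_pos {i : ℕ} (hi : i < u) {j : ℤ} (h1 : 1 ≤ j) (h2 : j ≤ lam.1 ⟨i, hi⟩) :
    ∃ p : Box lam, (p.row : ℕ) = i ∧ p.col = j :=
  ⟨⟨⟨i, hi⟩, j, mem_union_left _ (mem_Icc.2 ⟨h1, h2⟩)⟩, rfl, rfl⟩

theorem Box.exists_neg {i : ℕ} (hi : i < u) {j : ℤ} (h1 : j ≤ -1) (h2 : lam.1 ⟨i, hi⟩ ≤ j) :
    ∃ p : Box lam, (p.row : ℕ) = i ∧ p.col = j :=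
  ⟨⟨⟨i, hi⟩, j, mem_union_right _ (mem_Icc.2 ⟨h2, h1⟩)⟩, rfl, rfl⟩

/-- The condition on the row `t` of the pattern `g` that expresses that the entry in the box `p`
is less than `t`. -/
def Box.Below (g : ℕ → ℕ → ℤ) (p : Box lam) (t : ℕ) : Prop :=
  (0 < p.col ∧ (p.row : ℕ) < t ∧ p.col ≤ g t p.row) ∨
    -- Negative columns are aligned at the bottom: the last of the `t` entries of row `t` belongs to
    -- the last of the `u` rows of the shape, whence the shift by `u - t`.
    (p.col < 0 ∧ u ≤ t + p.row ∧ g t (t + p.row - u) ≤ p.col)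

/-- The pattern `g` records the sub-tableaux of `T` formed by the small letters. -/
def Corresponds (T : Box lam → Fin u) (g : ℕ → ℕ → ℤ) : Prop :=
  ∀ p : Box lam, ∀ t ≤ u, (T p : ℕ) < t ↔ p.Below g t

theorem IsGT.top_le {κ : Fin u → ℤ} {g : ℕ → ℕ → ℤ} (hg : IsGT κ g) {i t : ℕ} (hi : i < u)
    (hit : u ≤ t + i) (ht : t ≤ u) : κ ⟨i, hi⟩ ≤ g t (t + i - u) := by
  rw [← hg.top]
  have : ∀ r, t ≤ r → r ≤ u → g r (r + i - u) ≤ g t (t + i - u) := by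
    intro r hr
    induction r, hr using Nat.le_induction with
    | base => exact fun _ => le_rfl
    | succ r hr ih =>
      refine fun h => le_trans ?_ (ih (by omega))
      rw [show r + 1 + i - u = r + i - u + 1 by omega]
      exact hg.lower r _ (by omega) (by omega)
  have := this u ht le_rfl
  rwa [Nat.add_sub_cancel_left] at this

variable {g : ℕ → ℕ → ℤ} {T : Box lam → Fin u}

theorem Box.Below.mono (hg : IsGT lam.1 g) {p : Box lam} {t s : ℕ} (h : p.Below g t)
    (hts : t ≤ s) (hs : s ≤ u) : p.Below g s := by
  induction s, hts using Nat.le_induction with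
  | base => exact h
  | succ s hts ih =>
    have hp := p.row.2
    rcases ih (by omega) with ⟨h1, h2, h3⟩ | ⟨h1, h2, h3⟩
    · exact Or.inl ⟨h1, by omega, h3.trans (hg.upper s _ h2 (by omega))⟩
    · refine Or.inr ⟨h1, by omega, le_trans ?_ h3⟩
      rw [show s + 1 + p.row - u = s + p.row - u + 1 by omega]
      exact hg.lower s _ (by omega) (by omega)

theorem Box.below_top (hg : IsGT lam.1 g) (p : Box lam) : p.Below g u := by
  have := hg.top p.row
  rcases p.col_cases with ⟨h1, h2⟩ | ⟨h1, h2⟩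
  · exact Or.inl ⟨by omega, p.row.2, by omega⟩
  · refine Or.inr ⟨by omega, by omega, ?_⟩
    rw [Nat.add_sub_cancel_left]
    omega

theorem Box.not_below_zero (p : Box lam) : ¬ p.Below g 0 := by
  have := p.row.2
  rintro (⟨-, h, -⟩ | ⟨-, h, -⟩) <;> omega

/-- Turns the compatibility of the columns `1` and `-1` into a count of letters. -/
theorem orderEmbOfFin_le_iff (S : Finset (Fin u)) (i : ℕ) (s : Fin u) :
    (∃ h : i < S.card, S.orderEmbOfFin rfl ⟨i, h⟩ ≤ s) ↔ i < #{x ∈ S | x ≤ s} := by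
  have hcard : #{x ∈ S | x ≤ s} = #{x : Fin #S | S.orderEmbOfFin rfl x ≤ s} := by
    rw [← card_map (S.orderEmbOfFin rfl).toEmbedding]
    congr 1
    ext x
    simp only [mem_filter, mem_map, mem_univ, true_and, RelEmbedding.coe_toEmbedding]
    constructor
    · rintro ⟨hx, hxs⟩
      have : x ∈ Set.range (S.orderEmbOfFin rfl) := by rwa [range_orderEmbOfFin]
      obtain ⟨y, rfl⟩ := this
      exact ⟨y, hxs, rfl⟩
    · rintro ⟨y, hy, rfl⟩
      exact ⟨orderEmbOfFin_mem S rfl y, hy⟩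
  rw [hcard]
  constructor
  · rintro ⟨h, hle⟩
    have : Iic (⟨i, h⟩ : Fin #S) ⊆ ({x | S.orderEmbOfFin rfl x ≤ s} : Finset (Fin #S)) := fun x hx =>
      mem_filter.2 ⟨mem_univ _, ((S.orderEmbOfFin rfl).monotone (mem_Iic.1 hx)).trans hle⟩
    have := card_le_card this
    rw [Fin.card_Iic] at this
    simp only at this
    omega
  · intro hi
    have h : i < #S := by
      have := card_le_univ {x : Fin #S | S.orderEmbOfFin rfl x ≤ s}
      rw [Fintype.card_fin] at this
      omega
    refine ⟨h, ?_⟩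
    by_contra hcon
    have : ({x : Fin #S | S.orderEmbOfFin rfl x ≤ s} : Finset _) ⊆ Iio ⟨i, h⟩ := fun x hx => by
      rw [mem_Iio]
      by_contra hx'
      exact hcon (((S.orderEmbOfFin rfl).monotone (not_lt.1 hx')).trans (mem_filter.1 hx).2)
    have := card_le_card this
    rw [Fin.card_Iio] at this
    simp only at this
    omega

theorem card_filter_le_add_compl (S : Finset (Fin u)) (s : Fin u) :
    #{x ∈ S | x ≤ s} + #{x ∈ Sᶜ | x ≤ s} = s + 1 := by
  rw [← card_union_of_disjoint, ← filter_union, union_compl]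
  · have : ({x | x ≤ s} : Finset (Fin u)) = Iic s := by ext; simp
    rw [this, Fin.card_Iic]
  · exact disjoint_filter_filter disjoint_compl_right

/-! ### From patterns to rational tableaux -/

/-- A filling that corresponds to a pattern is rational semistandard. -/
theorem Corresponds.isRationalSemistandard (h : Corresponds T g) (hg : IsGT lam.1 g) :
    IsRationalSemistandard T where
  row_pos p q hr hp hpq := by
    by_contra hcon
    have h1 := (h q (T p) (T p).2.le).1 (not_le.1 hcon)
    refine lt_irrefl (T p : ℕ) ((h p (T p) (T p).2.le).2 ?_)
    rcases h1 with ⟨h2, h3, h4⟩ | ⟨h2, h3, h4⟩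
    · exact Or.inl ⟨hp, by rw [hr]; exact h3, by rw [hr]; exact hpq.le.trans h4⟩
    · omega
  row_neg p q hr hq hpq := by
    by_contra hcon
    have h1 := (h p (T q) (T q).2.le).1 (not_le.1 hcon)
    refine lt_irrefl (T q : ℕ) ((h q (T q) (T q).2.le).2 ?_)
    rcases h1 with ⟨h2, h3, h4⟩ | ⟨h2, h3, h4⟩
    · omega
    · exact Or.inr ⟨hq, by rw [← hr]; exact h3, by rw [← hr]; exact h4.trans hpq.le⟩
  col_pos p q hc hp hpq := by
    have hpq : (p.row : ℕ) < q.row := hpq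
    refine (h p (T q) (T q).2.le).2 ?_
    rcases (h q (T q + 1) (T q).2).1 (Nat.lt_succ_self _) with ⟨h2, h3, h4⟩ | ⟨h2, h3, h4⟩
    · refine Or.inl ⟨hp, by omega, ?_⟩
      have h5 := hg.lower (T q) (q.row - 1) (by omega) (T q).2
      rw [show (q.row - 1 + 1 : ℕ) = q.row by omega] at h5
      have h6 := hg.antitone_row lam.2 (k := T q) (i := p.row) (j := q.row - 1) (by omega)
        (by omega) (T q).2.le
      omega
    · omega
  col_neg p q hc hp hpq := by
    have hpq : (p.row : ℕ) < q.row := hpq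
    have hq := q.row.2
    refine (h q (T p) (T p).2.le).2 ?_
    rcases (h p (T p + 1) (T p).2).1 (Nat.lt_succ_self _) with ⟨h2, h3, h4⟩ | ⟨h2, h3, h4⟩
    · omega
    · refine Or.inr ⟨by omega, by omega, ?_⟩
      have h5 := hg.upper (T p) (T p + 1 + p.row - u) (by omega) (T p).2
      have h6 := hg.antitone_row lam.2 (k := T p) (i := T p + 1 + p.row - u)
        (j := T p + q.row - u) (by omega) (by omega) (T p).2.le
      omega
  compat p hp := by
    rw [orderEmbOfFin_le_iff]
    have hs := (T p).2
    rcases (h p (T p + 1) (T p).2).1 (Nat.lt_succ_self _) with ⟨h2, h3, h4⟩ | ⟨h2, h3, h4⟩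
    swap
    · omega
    have hcard := card_filter_le_add_compl (entriesOfColNegOne T) (T p)
    -- In row `T p + 1` of the pattern the entries up to index `p.row` are positive. A box of column
    -- `-1` with entry at most `T p` belongs to a negative entry of that row, so its index exceeds
    -- `p.row`, leaving `T p - p.row` possibilities.
    have hle : #{x ∈ entriesOfColNegOne T | x ≤ T p} ≤ (T p : ℕ) - p.row := by
      have hsub : {x ∈ entriesOfColNegOne T | x ≤ T p} ⊆
          ({q : Box lam | q.col = -1 ∧ T q ≤ T p} : Finset (Box lam)).image T := by
        intro x hx
        simp only [entriesOfColNegOne, mem_filter, mem_image, mem_univ, true_and] at hx ⊢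
        obtain ⟨⟨q, hq, rfl⟩, hx⟩ := hx
        exact ⟨q, ⟨hq, hx⟩, rfl⟩
      refine ((card_le_card hsub).trans card_image_le).trans ?_
      have hmaps : ∀ q ∈ ({q : Box lam | q.col = -1 ∧ T q ≤ T p} : Finset (Box lam)),
          (q.row : ℕ) ∈ Ioo (p.row + u - (T p + 1) : ℕ) u := by
        intro q hq
        obtain ⟨hq1, hq2⟩ := (mem_filter.1 hq).2
        have hq3 := q.row.2
        rw [mem_Ioo]
        refine ⟨?_, q.row.2⟩
        have hq2 : (T q : ℕ) < T p + 1 := Nat.lt_succ_of_le hq2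
        rcases (h q (T p + 1) (T p).2).1 hq2 with ⟨h5, h6, h7⟩ | ⟨h5, h6, h7⟩
        · omega
        · by_contra hcon
          have h8 := hg.antitone_row lam.2 (k := T p + 1) (i := T p + 1 + q.row - u)
            (j := p.row) (by omega) (by omega) (T p).2
          omega
      have := card_le_card_of_injOn (fun q : Box lam => (q.row : ℕ)) hmaps (fun q hq r hr hqr =>
        Box.ext_row_col (Fin.ext hqr) (by
          rw [(mem_filter.1 (mem_coe.1 hq)).2.1, (mem_filter.1 (mem_coe.1 hr)).2.1]))
      rw [Nat.card_Ioo] at this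
      omega
    omega

/-- `Below` is monotone in `t`, false at `0` and true at `u`; the entry is one less than the first
`t` at which it holds. -/
theorem IsGT.exists_corresponds (hg : IsGT lam.1 g) : ∃ T : Box lam → Fin u, Corresponds T g := by
  classical
  have hex : ∀ p : Box lam, ∃ t, p.Below g t := fun p => ⟨u, p.below_top hg⟩
  have hpos : ∀ p : Box lam, 0 < Nat.find (hex p) := fun p => by
    rw [Nat.pos_iff_ne_zero]
    intro h0
    have := Nat.find_spec (hex p)
    rw [h0] at this
    exact p.not_below_zero this
  have hle : ∀ p : Box lam, Nat.find (hex p) ≤ u := fun p => Nat.find_min' _ (p.below_top hg)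
  refine ⟨fun p => ⟨Nat.find (hex p) - 1, by have := hpos p; have := hle p; omega⟩,
    fun p t ht => ?_⟩
  have := hpos p
  constructor
  · intro h
    exact (Nat.find_spec (hex p)).mono hg (by simp only at h; omega) ht
  · intro h
    have := Nat.find_min' (hex p) h
    simp only
    omega

theorem Corresponds.unique {T' : Box lam → Fin u} (h : Corresponds T g) (h' : Corresponds T' g) :
    T = T' := by
  funext p
  apply Fin.ext
  have h1 := (h p _ (T' p).2).trans (h' p _ (T' p).2).symm
  have h2 := (h p _ (T p).2).trans (h' p _ (T p).2).symm
  omega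

/-- Test values are columns, and there is no column `0`; comparing from both sides makes up for
this. -/
theorem le_of_forall_signed {a b : ℤ} (h1 : ∀ j, 0 < j → j ≤ a → j ≤ b)
    (h2 : ∀ j, j < 0 → b ≤ j → a ≤ j) : a ≤ b := by
  by_contra hcon
  rcases lt_or_ge 0 a with ha | ha
  · exact hcon (h1 a ha le_rfl)
  · exact hcon (h2 b (by omega) le_rfl)

theorem Corresponds.le_iff_pos (h : Corresponds T g) (hg : IsGT lam.1 g) {i t : ℕ} (hi : i < t)
    (ht : t ≤ u) {j : ℤ} (hj : 0 < j) :
    j ≤ g t i ↔ ∃ p : Box lam, (p.row : ℕ) = i ∧ p.col = j ∧ (T p : ℕ) < t := by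
  constructor
  · intro hle
    obtain ⟨p, hp1, hp2⟩ := Box.exists_pos (lam := lam) (i := i) (by omega) (j := j) (by omega)
      (hle.trans (hg.le_top hi ht))
    exact ⟨p, hp1, hp2, (h p t ht).2 (Or.inl ⟨by omega, by omega, by rw [hp1, hp2]; exact hle⟩)⟩
  · rintro ⟨p, rfl, rfl, hp⟩
    rcases (h p t ht).1 hp with ⟨h1, h2, h3⟩ | ⟨h1, h2, h3⟩
    · exact h3
    · omega

theorem Corresponds.le_iff_neg (h : Corresponds T g) (hg : IsGT lam.1 g) {i t : ℕ} (hi : i < t)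
    (ht : t ≤ u) {j : ℤ} (hj : j < 0) :
    g t i ≤ j ↔ ∃ p : Box lam, (p.row : ℕ) + t = i + u ∧ p.col = j ∧ (T p : ℕ) < t := by
  constructor
  · intro hle
    have h1 := hg.top_le (i := i + u - t) (t := t) (by omega) (by omega) ht
    rw [show t + (i + u - t) - u = i by omega] at h1
    obtain ⟨p, hp1, hp2⟩ := Box.exists_neg (lam := lam) (i := i + u - t) (by omega) (j := j)
      (by omega) (h1.trans hle)
    refine ⟨p, by omega, hp2, (h p t ht).2 (Or.inr ⟨by omega, by omega, ?_⟩)⟩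
    rw [show t + p.row - u = i by omega, hp2]
    exact hle
  · rintro ⟨p, hr, rfl, hp⟩
    rcases (h p t ht).1 hp with ⟨h1, h2, h3⟩ | ⟨h1, h2, h3⟩
    · omega
    · rwa [show t + p.row - u = i by omega] at h3

theorem Corresponds.unique_right {g' : ℕ → ℕ → ℤ} (h : Corresponds T g) (h' : Corresponds T g')
    (hg : IsGT lam.1 g) (hg' : IsGT lam.1 g') : g = g' := by
  funext t i
  by_cases hti : i < t ∧ t ≤ u
  · obtain ⟨hi, ht⟩ := hti
    apply le_antisymm
    · exact le_of_forall_signed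
        (fun j hj hle => (h'.le_iff_pos hg' hi ht hj).2 ((h.le_iff_pos hg hi ht hj).1 hle))
        (fun j hj hle => (h.le_iff_neg hg hi ht hj).2 ((h'.le_iff_neg hg' hi ht hj).1 hle))
    · exact le_of_forall_signed
        (fun j hj hle => (h.le_iff_pos hg hi ht hj).2 ((h'.le_iff_pos hg' hi ht hj).1 hle))
        (fun j hj hle => (h'.le_iff_neg hg' hi ht hj).2 ((h.le_iff_neg hg hi ht hj).1 hle))
  · rw [hg.outside t i (by omega), hg'.outside t i (by omega)]

/-! ### From rational tableaux to patterns -/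

theorem le_card_iff_mem {S : Finset ℤ} (h1 : ∀ x ∈ S, 1 ≤ x)
    (h2 : ∀ x ∈ S, ∀ y, 1 ≤ y → y ≤ x → y ∈ S) {j : ℤ} (hj : 1 ≤ j) : j ≤ #S ↔ j ∈ S := by
  rcases S.eq_empty_or_nonempty with rfl | hne
  · simp only [card_empty, Nat.cast_zero, notMem_empty, iff_false]
    omega
  have hS : S = Icc 1 (S.max' hne) := by
    ext x
    rw [mem_Icc]
    exact ⟨fun hx => ⟨h1 x hx, S.le_max' x hx⟩, fun hx => h2 _ (S.max'_mem hne) x hx.1 hx.2⟩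
  have hm := h1 _ (S.max'_mem hne)
  have hcard : (#S : ℤ) = S.max' hne := by
    conv_lhs => rw [hS]
    rw [Int.card_Icc]
    omega
  rw [hcard]
  conv_rhs => rw [hS, mem_Icc]
  omega

/-- A row of the pattern has no entry with both a positive and a negative part. Otherwise column
`-1` contains, in the rows from `q.row` on, `u - q.row = t - p.row` of the `t` letters below `t`; at
most `p.row` of these letters are missing from it, but compatibility at row `p.row` of column `1`
needs more. -/
theorem IsRationalSemistandard.not_both (hT : IsRationalSemistandard T) {p q : Box lam} {t : ℕ}
    (ht : t ≤ u) (hq : (q.row : ℕ) + t = p.row + u) (hp0 : 0 < p.col)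
    (hq0 : q.col < 0) (hTp : (T p : ℕ) < t) (hTq : (T q : ℕ) < t) : False := by
  obtain ⟨p1, hp1, hp2⟩ := Box.exists_pos (lam := lam) p.row.2 (j := 1) le_rfl
    (by have := Box.le_of_pos hp0; simp only [Fin.eta]; omega)
  have hp1 : p1.row = p.row := Fin.ext hp1
  have hTp1 : (T p1 : ℕ) < t := by
    rcases (show (1 : ℤ) ≤ p.col by omega).lt_or_eq with h | h
    · exact lt_of_le_of_lt (hT.row_pos p1 p hp1 (by omega) (by omega)) hTp
    · rwa [Box.ext_row_col hp1 (by omega : p1.col = p.col)]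
  have hrows : ∀ r : ℕ, (q.row : ℕ) ≤ r → r < u → ∃ q' : Box lam, (q'.row : ℕ) = r ∧
      q'.col = -1 ∧ (T q' : ℕ) < t := by
    intro r hr hru
    have hlam : lam.1 ⟨r, hru⟩ ≤ q.col := (lam.2 (Fin.mk_le_mk.2 hr : q.row ≤ ⟨r, hru⟩)).trans
      (Box.le_of_neg hq0)
    obtain ⟨q1, hq1, hq2⟩ := Box.exists_neg (lam := lam) q.row.2 (j := -1) le_rfl
      (by have := Box.le_of_neg hq0; simp only [Fin.eta]; omega)
    have hq1 : q1.row = q.row := Fin.ext hq1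
    have hTq1 : (T q1 : ℕ) < t := by
      rcases (show q.col ≤ -1 by omega).lt_or_eq with h | h
      · exact lt_of_le_of_lt (hT.row_neg q q1 hq1.symm (by omega) (by omega)) hTq
      · rwa [Box.ext_row_col hq1 (by omega : q1.col = q.col)]
    obtain ⟨q', hq'1, hq'2⟩ := Box.exists_neg (lam := lam) hru (j := -1) le_rfl (by omega)
    refine ⟨q', hq'1, hq'2, ?_⟩
    rcases hr.lt_or_eq with h | h
    · have : T q' < T q1 := hT.col_neg q1 q' (by omega) (by omega) (by
        rw [hq1, Fin.lt_def, hq'1]; exact h)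
      have : (T q' : ℕ) < T q1 := this
      omega
    · have : q' = q1 := Box.ext_row_col (by rw [hq1]; exact Fin.ext (by omega)) (by omega)
      rwa [this]
  have hc := (orderEmbOfFin_le_iff _ _ _).1 (hT.compat p1 hp2)
  set s : Fin u := ⟨t - 1, by omega⟩ with hs
  have hc2 : #{x ∈ (entriesOfColNegOne T)ᶜ | x ≤ T p1} ≤ #{x ∈ (entriesOfColNegOne T)ᶜ | x ≤ s} := by
    refine card_le_card fun x hx => ?_
    simp only [mem_filter] at hx ⊢
    exact ⟨hx.1, hx.2.trans (Fin.le_def.2 (by simp only [hs]; omega))⟩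
  have hcard := card_filter_le_add_compl (entriesOfColNegOne T) s
  have hge : #(Ico (q.row : ℕ) u) ≤ #{x ∈ entriesOfColNegOne T | x ≤ s} := by
    have : Nonempty (Box lam) := ⟨p⟩
    choose! f hf using hrows
    refine card_le_card_of_injOn (fun r => T (f r)) (fun r hr => ?_) (fun r hr r' hr' heq => ?_)
    · obtain ⟨h1, h2, h3⟩ := hf r (mem_Ico.1 hr).1 (mem_Ico.1 hr).2
      refine mem_filter.2 ⟨mem_image.2 ⟨f r, mem_filter.2 ⟨mem_univ _, h2⟩, rfl⟩, ?_⟩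
      exact Fin.le_def.2 (by simp only [hs]; omega)
    · have hr := mem_Ico.1 (mem_coe.1 hr)
      have hr' := mem_Ico.1 (mem_coe.1 hr')
      obtain ⟨h1, h2, h3⟩ := hf r hr.1 hr.2
      obtain ⟨h1', h2', h3'⟩ := hf r' hr'.1 hr'.2
      simp only at heq
      rcases lt_trichotomy r r' with h | h | h
      · have := hT.col_neg (f r) (f r') (by omega) (by omega) (Fin.lt_def.2 (by omega))
        rw [heq] at this
        exact absurd this (lt_irrefl _)
      · exact h
      · have := hT.col_neg (f r') (f r) (by omega) (by omega) (Fin.lt_def.2 (by omega))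
        rw [heq] at this
        exact absurd this (lt_irrefl _)
  rw [Nat.card_Ico] at hge
  rw [hp1] at hc
  have hsv : (s : ℕ) = t - 1 := rfl
  omega

/-- The columns of the boxes in row `i`, with entry less than `t`, of sign `ε`. -/
def signedCols (T : Box lam → Fin u) (ε : ℤ) (i t : ℕ) : Finset ℤ :=
  ({p : Box lam | (p.row : ℕ) = i ∧ 0 < ε * p.col ∧ (T p : ℕ) < t} : Finset (Box lam)).image
    fun p => ε * p.col

theorem mem_signedCols_one {i t : ℕ} {j : ℤ} : j ∈ signedCols T 1 i t ↔
    ∃ p : Box lam, (p.row : ℕ) = i ∧ 0 < p.col ∧ (T p : ℕ) < t ∧ p.col = j := by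
  simp only [signedCols, mem_image, mem_filter, mem_univ, true_and, one_mul, and_assoc]

theorem mem_signedCols_neg {i t : ℕ} {j : ℤ} : j ∈ signedCols T (-1) i t ↔
    ∃ p : Box lam, (p.row : ℕ) = i ∧ p.col < 0 ∧ (T p : ℕ) < t ∧ p.col = -j := by
  simp only [signedCols, mem_image, mem_filter, mem_univ, true_and, neg_mul, one_mul, and_assoc,
    Left.neg_pos_iff, neg_eq_iff_eq_neg]

theorem IsRationalSemistandard.le_card_signedCols_one (hT : IsRationalSemistandard T) {i t : ℕ}
    {j : ℤ} (hj : 1 ≤ j) : j ≤ #(signedCols T 1 i t) ↔ j ∈ signedCols T 1 i t := by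
  refine le_card_iff_mem (fun x hx => ?_) (fun x hx y hy hyx => ?_) hj
  · obtain ⟨p, -, h, -, rfl⟩ := mem_signedCols_one.1 hx
    exact h
  · obtain ⟨p, h1, h2, h3, rfl⟩ := mem_signedCols_one.1 hx
    obtain ⟨q, hq1, hq2⟩ := Box.exists_pos (lam := lam) p.row.2 hy
      (hyx.trans (Box.le_of_pos h2))
    refine mem_signedCols_one.2 ⟨q, by omega, by omega, ?_, hq2⟩
    rcases hyx.lt_or_eq with h | h
    · exact lt_of_le_of_lt (hT.row_pos q p (Fin.ext hq1) (by omega) (by omega)) h3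
    · rwa [Box.ext_row_col (Fin.ext hq1) (by omega : q.col = p.col)]

theorem IsRationalSemistandard.le_card_signedCols_neg (hT : IsRationalSemistandard T) {i t : ℕ}
    {j : ℤ} (hj : 1 ≤ j) : j ≤ #(signedCols T (-1) i t) ↔ j ∈ signedCols T (-1) i t := by
  refine le_card_iff_mem (fun x hx => ?_) (fun x hx y hy hyx => ?_) hj
  · obtain ⟨p, -, h, -, h'⟩ := mem_signedCols_neg.1 hx
    omega
  · obtain ⟨p, h1, h2, h3, h4⟩ := mem_signedCols_neg.1 hx
    obtain ⟨q, hq1, hq2⟩ := Box.exists_neg (lam := lam) p.row.2 (j := -y) (by omega)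
      (by have := Box.le_of_neg h2; simp only [Fin.eta]; omega)
    refine mem_signedCols_neg.2 ⟨q, by omega, by omega, ?_, hq2⟩
    rcases hyx.lt_or_eq with h | h
    · exact lt_of_le_of_lt (hT.row_neg p q (Fin.ext hq1.symm) (by omega) (by omega)) h3
    · rwa [Box.ext_row_col (Fin.ext hq1) (by omega : q.col = p.col)]

/-- The pattern of a rational tableau. -/
def patternOf (T : Box lam → Fin u) : ℕ → ℕ → ℤ := fun t i =>
  if i < t ∧ t ≤ u then #(signedCols T 1 i t) - #(signedCols T (-1) (i + u - t) t) else 0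

theorem IsRationalSemistandard.signedCols_eq_zero (hT : IsRationalSemistandard T) {i t : ℕ}
    (ht : t ≤ u) :
    #(signedCols T 1 i t) = 0 ∨ #(signedCols T (-1) (i + u - t) t) = 0 := by
  by_contra hcon
  push Not at hcon
  obtain ⟨h1, h2⟩ := hcon
  obtain ⟨x, hx⟩ := card_ne_zero.1 h1
  obtain ⟨y, hy⟩ := card_ne_zero.1 h2
  obtain ⟨p, hp1, hp2, hp3, -⟩ := mem_signedCols_one.1 hx
  obtain ⟨q, hq1, hq2, hq3, -⟩ := mem_signedCols_neg.1 hy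
  exact hT.not_both ht (by omega) hp2 hq2 hp3 hq3

theorem IsRationalSemistandard.le_patternOf (hT : IsRationalSemistandard T) {i t : ℕ}
    (hi : i < t) (ht : t ≤ u) {j : ℤ} (hj : 0 < j) : j ≤ patternOf T t i ↔
      ∃ p : Box lam, (p.row : ℕ) = i ∧ p.col = j ∧ (T p : ℕ) < t := by
  have h1 := hT.signedCols_eq_zero (i := i) ht
  have h2 := hT.le_card_signedCols_one (i := i) (t := t) (j := j) (by omega)
  rw [patternOf, if_pos ⟨hi, ht⟩]
  refine (show _ ↔ j ∈ signedCols T 1 i t by rw [← h2]; omega).trans ?_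
  rw [mem_signedCols_one]
  constructor
  · rintro ⟨p, h3, h4, h5, h6⟩
    exact ⟨p, h3, h6, h5⟩
  · rintro ⟨p, h3, h4, h5⟩
    exact ⟨p, h3, by omega, h5, h4⟩

theorem IsRationalSemistandard.patternOf_le (hT : IsRationalSemistandard T) {i t : ℕ}
    (hi : i < t) (ht : t ≤ u) {j : ℤ} (hj : j < 0) : patternOf T t i ≤ j ↔
      ∃ p : Box lam, (p.row : ℕ) + t = i + u ∧ p.col = j ∧ (T p : ℕ) < t := by
  have h1 := hT.signedCols_eq_zero (i := i) ht
  have h2 := hT.le_card_signedCols_neg (i := i + u - t) (t := t) (j := -j) (by omega)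
  rw [patternOf, if_pos ⟨hi, ht⟩]
  refine (show _ ↔ -j ∈ signedCols T (-1) (i + u - t) t by rw [← h2]; omega).trans ?_
  rw [mem_signedCols_neg]
  constructor
  · rintro ⟨p, h3, h4, h5, h6⟩
    exact ⟨p, by omega, by omega, h5⟩
  · rintro ⟨p, h3, h4, h5⟩
    exact ⟨p, by omega, by omega, h5, by omega⟩

theorem IsRationalSemistandard.corresponds (hT : IsRationalSemistandard T) :
    Corresponds T (patternOf T) := by
  intro p t ht
  have hp := p.row.2
  rcases p.col_cases with ⟨h1, h2⟩ | ⟨h1, h2⟩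
  · have hrow : (T p : ℕ) < t → (p.row : ℕ) < t := by
      intro h
      have hrec : ∀ i, ∀ q : Box lam, (q.row : ℕ) = i → 0 < q.col → i ≤ T q := by
        intro i
        induction i with
        | zero => exact fun _ _ _ => Nat.zero_le _
        | succ i ih =>
          intro q hq hq0
          have hlam := lam.2 (Fin.le_def.2 (by simp only; omega) : (⟨i, by omega⟩ : Fin u) ≤ q.row)
          obtain ⟨q', h3, h4⟩ := Box.exists_pos (lam := lam) (i := i) (by omega) (j := q.col)
            (by omega) ((Box.le_of_pos hq0).trans hlam)
          have h5 := ih q' h3 (by omega)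
          have h6 : (T q' : ℕ) < T q := hT.col_pos q' q h4 (by omega) (Fin.lt_def.2 (by omega))
          omega
      exact lt_of_le_of_lt (hrec _ p rfl (by omega)) h
    constructor
    · exact fun h => Or.inl ⟨by omega, hrow h,
        (hT.le_patternOf (hrow h) ht (by omega)).2 ⟨p, rfl, rfl, h⟩⟩
    · rintro (⟨h3, h4, h5⟩ | ⟨h3, h4, h5⟩)
      · obtain ⟨q, hq1, hq2, hq3⟩ := (hT.le_patternOf h4 ht (by omega)).1 h5
        rwa [← Box.ext_row_col (Fin.ext hq1) hq2]
      · omega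
  · have hrow : (T p : ℕ) < t → u ≤ t + p.row := by
      intro h
      have hrec : ∀ i, ∀ q : Box lam, (q.row : ℕ) + i + 1 = u → q.col < 0 → i ≤ T q := by
        intro i
        induction i with
        | zero => exact fun _ _ _ => Nat.zero_le _
        | succ i ih =>
          intro q hq hq0
          have hlam := lam.2 (Fin.le_def.2 (by simp only; omega) :
            q.row ≤ (⟨q.row + 1, by omega⟩ : Fin u))
          obtain ⟨q', h3, h4⟩ := Box.exists_neg (lam := lam) (i := q.row + 1) (by omega)
            (j := q.col) (by omega) (hlam.trans (Box.le_of_neg hq0))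
          have h5 := ih q' (by omega) (by omega)
          have h6 : (T q' : ℕ) < T q :=
            hT.col_neg q q' h4.symm (by omega) (Fin.lt_def.2 (by omega))
          omega
      have := hrec (u - 1 - p.row) p (by omega) (by omega)
      omega
    constructor
    · exact fun h => Or.inr ⟨by omega, hrow h, (hT.patternOf_le (by have := hrow h; omega) ht
        (by omega)).2 ⟨p, by have := hrow h; omega, rfl, h⟩⟩
    · rintro (⟨h3, h4, h5⟩ | ⟨h3, h4, h5⟩)
      · omega
      · obtain ⟨q, hq1, hq2, hq3⟩ := (hT.patternOf_le (by omega) ht (by omega)).1 h5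
        rwa [← Box.ext_row_col (Fin.ext (by omega)) hq2]

/-- Of each interlacing inequality, one sign is monotonicity in `t` and the other is strictness of
columns: negative columns give `upper`, positive ones `lower`. -/
theorem IsRationalSemistandard.isGT (hT : IsRationalSemistandard T) :
    IsGT lam.1 (patternOf T) where
  top i := by
    have h1 : ∀ j, 0 < j → (j ≤ patternOf T u i ↔ j ≤ lam.1 i) := by
      intro j hj
      rw [hT.le_patternOf i.2 le_rfl hj]
      constructor
      · rintro ⟨p, h1, rfl, h3⟩
        rw [← (Fin.ext h1 : p.row = i)]
        exact Box.le_of_pos hj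
      · intro h
        obtain ⟨p, h1, h2⟩ := Box.exists_pos (lam := lam) i.2 (j := j) (by omega) h
        exact ⟨p, h1, h2, (T p).2⟩
    have h2 : ∀ j, j < 0 → (patternOf T u i ≤ j ↔ lam.1 i ≤ j) := by
      intro j hj
      rw [hT.patternOf_le i.2 le_rfl hj]
      constructor
      · rintro ⟨p, h1, rfl, h3⟩
        rw [← (Fin.ext (by omega) : p.row = i)]
        exact Box.le_of_neg hj
      · intro h
        obtain ⟨p, h1, h2⟩ := Box.exists_neg (lam := lam) i.2 (j := j) (by omega) h
        exact ⟨p, by omega, h2, (T p).2⟩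
    exact le_antisymm
      (le_of_forall_signed (fun j hj => (h1 j hj).1) (fun j hj => (h2 j hj).2))
      (le_of_forall_signed (fun j hj => (h1 j hj).2) (fun j hj => (h2 j hj).1))
  upper k i hi hk := by
    refine le_of_forall_signed (fun j hj h => ?_) (fun j hj h => ?_)
    · rw [hT.le_patternOf (by omega) (by omega) hj] at h ⊢
      obtain ⟨p, h1, h2, h3⟩ := h
      exact ⟨p, h1, h2, by omega⟩
    · rw [hT.patternOf_le (by omega) (by omega) hj] at h ⊢
      obtain ⟨p, h1, rfl, h3⟩ := h
      have hlam := lam.2 (Fin.le_def.2 (by simp only; omega) :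
            p.row ≤ (⟨p.row + 1, by omega⟩ : Fin u))
      obtain ⟨q, h4, h5⟩ := Box.exists_neg (lam := lam) (i := p.row + 1) (by omega)
        (j := p.col) (by omega) (hlam.trans (Box.le_of_neg hj))
      have h6 : (T q : ℕ) < T p := hT.col_neg p q h5.symm hj (Fin.lt_def.2 (by omega))
      exact ⟨q, by omega, h5, by omega⟩
  lower k i hi hk := by
    refine le_of_forall_signed (fun j hj h => ?_) (fun j hj h => ?_)
    · rw [hT.le_patternOf (by omega) (by omega) hj] at h ⊢
      obtain ⟨p, h1, rfl, h3⟩ := h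
      have hlam := lam.2 (Fin.le_def.2 (by simp only; omega) : (⟨i, by omega⟩ : Fin u) ≤ p.row)
      obtain ⟨q, h4, h5⟩ := Box.exists_pos (lam := lam) (i := i) (by omega)
        (j := p.col) (by omega) ((Box.le_of_pos hj).trans hlam)
      have h6 : (T q : ℕ) < T p := hT.col_pos q p h5 (by omega) (Fin.lt_def.2 (by omega))
      exact ⟨q, h4, h5, by omega⟩
    · rw [hT.patternOf_le (by omega) (by omega) hj] at h ⊢
      obtain ⟨p, h1, h2, h3⟩ := h
      exact ⟨p, by omega, h2, by omega⟩
  outside k i h := by rw [patternOf, if_neg (by omega)]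

/-! ### Comparison of the weights and the bialternant formula -/

theorem Corresponds.card_pos (h : Corresponds T g) (hg : IsGT lam.1 g) {t : ℕ} (ht : t ≤ u) :
    #{p : Box lam | (T p : ℕ) < t ∧ 0 < p.col} = ∑ i ∈ range t, (g t i).toNat := by
  have : ∀ i ∈ range t, (g t i).toNat = #(Icc 1 (g t i)) := fun i _ => by
    rw [Int.card_Icc]
    omega
  rw [sum_congr rfl this, ← card_sigma]
  refine card_bij (fun p _ => ⟨(p.row : ℕ), p.col⟩) (fun p hp => ?_) (fun p _ q _ hpq => ?_)
    (fun x hx => ?_)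
  · obtain ⟨h1, h2⟩ := (mem_filter.1 hp).2
    rcases (h p t ht).1 h1 with ⟨h3, h4, h5⟩ | ⟨h3, h4, h5⟩
    · exact mem_sigma.2 ⟨mem_range.2 h4, mem_Icc.2 ⟨h3, h5⟩⟩
    · omega
  · rw [Sigma.mk.injEq] at hpq
    exact Box.ext_row_col (Fin.ext hpq.1) (eq_of_heq hpq.2)
  · obtain ⟨i, j⟩ := x
    obtain ⟨hi, hj⟩ := mem_sigma.1 hx
    obtain ⟨hj1, hj2⟩ := mem_Icc.1 hj
    obtain ⟨p, h1, h2, h3⟩ := (h.le_iff_pos hg (mem_range.1 hi) ht hj1).1 hj2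
    exact ⟨p, mem_filter.2 ⟨mem_univ _, h3, by rw [h2]; exact hj1⟩, by rw [h1, h2]⟩

theorem Corresponds.card_neg (h : Corresponds T g) (hg : IsGT lam.1 g) {t : ℕ} (ht : t ≤ u) :
    #{p : Box lam | (T p : ℕ) < t ∧ ¬ 0 < p.col} = ∑ i ∈ range t, (-g t i).toNat := by
  have : ∀ i ∈ range t, (-g t i).toNat = #(Icc (g t i) (-1)) := fun i _ => by
    rw [Int.card_Icc]
    omega
  rw [sum_congr rfl this, ← card_sigma]
  have hcol : ∀ p : Box lam, ¬ 0 < p.col → p.col < 0 := fun p hp => by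
    have := p.col_cases
    omega
  refine card_bij (fun p _ => ⟨(t + p.row - u : ℕ), p.col⟩) (fun p hp => ?_)
    (fun p hp q hq hpq => ?_) (fun x hx => ?_)
  · obtain ⟨h1, h2⟩ := (mem_filter.1 hp).2
    have hr := p.row.2
    rcases (h p t ht).1 h1 with ⟨h3, h4, h5⟩ | ⟨h3, h4, h5⟩
    · omega
    · exact mem_sigma.2 ⟨mem_range.2 (by simp only; omega), mem_Icc.2 ⟨h5, by simp only; omega⟩⟩
  · obtain ⟨hp1, hp2⟩ := (mem_filter.1 hp).2
    obtain ⟨hq1, hq2⟩ := (mem_filter.1 hq).2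
    have hp3 := (h p t ht).1 hp1
    have hq3 := (h q t ht).1 hq1
    rw [Box.Below] at hp3 hq3
    rw [Sigma.mk.injEq] at hpq
    refine Box.ext_row_col (Fin.ext ?_) (eq_of_heq hpq.2)
    have := hpq.1
    omega
  · obtain ⟨i, j⟩ := x
    obtain ⟨hi, hj⟩ := mem_sigma.1 hx
    obtain ⟨hj1, hj2⟩ := mem_Icc.1 hj
    simp only at hi hj1 hj2
    obtain ⟨p, h1, h2, h3⟩ := (h.le_iff_neg hg (mem_range.1 hi) ht (by omega)).1 hj1
    exact ⟨p, mem_filter.2 ⟨mem_univ _, h3, by omega⟩, by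
      rw [h2, show t + p.row - u = i by omega]⟩

theorem Corresponds.rationalWt_eq (h : Corresponds T g) (hg : IsGT lam.1 g) :
    rationalWt T = Finsupp.equivFunOnFinite.symm (gtWt u g) := by
  have hsum : ∀ t ≤ u, ∑ p : Box lam with (T p : ℕ) < t, (if 0 < p.col then (1 : ℤ) else -1) =
      rowSum g t := by
    intro t ht
    rw [sum_ite, sum_const, sum_const, filter_filter, filter_filter, h.card_pos hg ht,
      h.card_neg hg ht, rowSum]
    simp only [nsmul_eq_mul, mul_one, mul_neg, Nat.cast_sum]
    rw [← sub_eq_add_neg, ← sum_sub_distrib]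
    exact sum_congr rfl fun i _ => by omega
  ext a
  rw [rationalWt, Finsupp.finsetSum_apply, Finsupp.equivFunOnFinite_symm_apply_apply, gtWt,
    ← hsum _ a.2, ← hsum _ a.2.le]
  have hsplit : univ.filter (fun p : Box lam => (T p : ℕ) < (a : ℕ).succ) =
      univ.filter (fun p : Box lam => (T p : ℕ) < a) ∪ univ.filter fun p : Box lam => T p = a := by
    ext p
    simp only [mem_filter, mem_univ, true_and, mem_union, Fin.ext_iff]
    omega
  rw [hsplit, sum_union, add_sub_cancel_left, sum_filter]
  · exact sum_congr rfl fun p _ => by rw [Finsupp.single_apply]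
  · rw [disjoint_filter]
    rintro p - h1 h2
    rw [h2] at h1
    exact lt_irrefl _ h1

end Box

/-- Rational tableaux correspond to Gelfand–Tsetlin patterns. -/
def rationalTableauEquiv {u : ℕ} (lam : GenPartition u) : RationalTableau lam ≃ GTPattern lam.1 :=
  Equiv.ofBijective (fun T => ⟨patternOf T.1, T.2.isGT⟩) ⟨fun T T' h => by
    have h := congrArg Subtype.val h
    simp only at h
    have h1 := T.2.corresponds
    rw [h] at h1
    exact Subtype.ext (h1.unique T'.2.corresponds), fun g => by
    obtain ⟨T, hT⟩ := g.2.exists_corresponds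
    have hss := hT.isRationalSemistandard g.2
    exact ⟨⟨T, hss⟩, Subtype.ext (hss.corresponds.unique_right hT hss.isGT g.2)⟩⟩

instance {u : ℕ} (lam : GenPartition u) : Fintype (GTPattern lam.1) :=
  open Classical in Fintype.ofEquiv _ (rationalTableauEquiv lam)

theorem rationalSchur_eq_sum_gt {u : ℕ} (lam : GenPartition u) :
    rationalSchur lam = ∑ T : GTPattern lam.1, mon (gtWt u T.1) := by
  classical
  rw [rationalSchur]
  refine Fintype.sum_equiv (rationalTableauEquiv lam) _ _ fun T => ?_
  rw [T.2.corresponds.rationalWt_eq T.2.isGT]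
  rfl

/-- The bialternant formula for rational Schur functions. -/
theorem alternant_stair_mul_rationalSchur {u : ℕ} (lam : GenPartition u) :
    alternant (stair u) * rationalSchur lam = alternant (lam.1 + stair u) := by
  rw [rationalSchur_eq_sum_gt, alternant_stair_mul_sum_gt lam.2]

theorem schurCoeff_rationalSchur {u : ℕ} (κ lam : GenPartition u) :
    schurCoeff κ (rationalSchur lam) = if lam = κ then 1 else 0 := by
  have h := schurCoeff_of_eq_sum {()} (fun _ => lam.1) (fun _ _ => lam.2)
    (P := rationalSchur lam) (by rw [alternant_stair_mul_rationalSchur, sum_singleton]) κ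
  rw [h, filter_singleton]
  simp only [Subtype.ext_iff]
  split_ifs <;> rfl

/-- A symmetric Laurent polynomial whose product with `a_ρ` is a sum of alternants is a sum of
rational Schur functions. -/
theorem eq_sum_rationalSchur {u : ℕ} {ι : Type*} (S : Finset ι) (f : ι → GenPartition u)
    {P : Laurent u}
    (hP : alternant (stair u) * P = ∑ i ∈ S, alternant ((f i).1 + stair u)) :
    P = ∑ i ∈ S, rationalSchur (f i) := by
  apply mul_left_cancel₀ (alternant_stair_ne_zero u)
  rw [hP, mul_sum]
  exact sum_congr rfl fun i _ => (alternant_stair_mul_rationalSchur _).symm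

/-- Products of rational Schur functions are sums of rational Schur functions. -/
theorem exists_rationalSchur_mul {u : ℕ} (τ κ : GenPartition u) :
    ∃ n : GenPartition u →₀ ℕ,
      rationalSchur τ * rationalSchur κ = n.sum fun ν m => m • rationalSchur ν := by
  classical
  -- Since `a_{τ+ρ} = a_ρ s_τ`, this is an expansion of `a_ρ s_τ s_κ` in dominant alternants.
  have h := alternant_mul_sum_gt (κ := κ.1) τ.2
  rw [← rationalSchur_eq_sum_gt, ← alternant_stair_mul_rationalSchur, mul_assoc] at h
  let f : {T : GTPattern κ.1 // IsDominantOver τ.1 T.1} → GenPartition u :=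
    fun T => ⟨_, T.2.antitone⟩
  rw [← sum_subtype_eq_sum_filter] at h
  have h' := eq_sum_rationalSchur _ f h
  refine ⟨∑ T ∈ Finset.subtype _ univ, Finsupp.single (f T) 1, ?_⟩
  rw [h', ← Finsupp.sum_finsetSum_index]
  · refine sum_congr rfl fun T _ => ?_
    rw [Finsupp.sum_single_index (by rw [zero_smul]), one_smul]
  · exact fun ν => zero_smul _ _
  · exact fun ν a b => add_smul _ _ _

/-! ### Chains of generalized partitions -/

/-- A step removes a vertical strip or adds a horizontal strip, of a given size. -/
inductive StepKind : Type
  | vert (r : ℕ)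
  | horiz (r : ℕ)

/-- `κ'` arises from `κ` by a step of the given kind. -/
def IsStep {u : ℕ} : StepKind → (Fin u → ℤ) → (Fin u → ℤ) → Prop
  | .vert r, κ, κ' => (∀ i, κ' i ≤ κ i ∧ κ i ≤ κ' i + 1) ∧ Antitone κ' ∧ ∑ i, κ i = ∑ i, κ' i + r
  | .horiz r, κ, κ' => (∀ i, κ i ≤ κ' i) ∧ (∀ i j : Fin u, (i : ℕ) + 1 = j → κ' j ≤ κ i) ∧
      ∑ i, κ' i = ∑ i, κ i + r

/-- The possible displacements of a step, without the dominance conditions. -/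
def StepKind.disp (u : ℕ) : StepKind → Finset (Fin u → ℤ)
  | .vert r => {d ∈ Fintype.piFinset fun _ => Icc (-1) 0 | ∑ i, d i = -(r : ℤ)}
  | .horiz r => {d ∈ Fintype.piFinset fun _ => Icc 0 (r : ℤ) | ∑ i, d i = (r : ℤ)}

/-- The symmetric Laurent polynomial of a step: `e_r(y⁻¹)` or `h_r(y)`. -/
def StepKind.poly (u : ℕ) (s : StepKind) : Laurent u := ∑ d ∈ s.disp u, mon d

/-! ### The Pieri rules -/

theorem mem_disp_vert {u r : ℕ} {d : Fin u → ℤ} :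
    d ∈ (StepKind.vert r).disp u ↔ (∀ i, -1 ≤ d i ∧ d i ≤ 0) ∧ ∑ i, d i = -(r : ℤ) := by
  simp only [StepKind.disp, mem_filter, Fintype.mem_piFinset, mem_Icc]

theorem mem_disp_horiz {u r : ℕ} {d : Fin u → ℤ} :
    d ∈ (StepKind.horiz r).disp u ↔ (∀ i, 0 ≤ d i) ∧ ∑ i, d i = (r : ℤ) := by
  simp only [StepKind.disp, mem_filter, Fintype.mem_piFinset, mem_Icc]
  refine ⟨fun h => ⟨fun i => (h.1 i).1, h.2⟩, fun h => ⟨fun i => ⟨h.1 i, ?_⟩, h.2⟩⟩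
  rw [← h.2]
  exact single_le_sum (fun i _ => h.1 i) (mem_univ i)

theorem comp_mem_disp {u : ℕ} (s : StepKind) {d : Fin u → ℤ} (hd : d ∈ s.disp u)
    (σ : Perm (Fin u)) : d ∘ σ ∈ s.disp u := by
  have hsum : ∑ i, (d ∘ σ) i = ∑ i, d i := Equiv.sum_comp σ d
  cases s with
  | vert r =>
    rw [mem_disp_vert] at hd ⊢
    exact ⟨fun i => hd.1 _, hsum.trans hd.2⟩
  | horiz r =>
    rw [mem_disp_horiz] at hd ⊢
    exact ⟨fun i => hd.1 _, hsum.trans hd.2⟩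

theorem alternant_mul_poly {u : ℕ} (s : StepKind) (α : Fin u → ℤ) :
    alternant α * s.poly u = ∑ d ∈ s.disp u, alternant (α + d) :=
  alternant_mul_sum (s.disp u) id (fun σ => ⟨fun d => d ∘ σ, fun _ hd => comp_mem_disp s hd σ,
    fun _ _ _ _ h => σ.surjective.injective_comp_right h, fun _ _ => rfl⟩) α

theorem antitone_of_succ {u : ℕ} {κ : Fin u → ℤ}
    (h : ∀ i j : Fin u, (i : ℕ) + 1 = j → κ j ≤ κ i) : Antitone κ := by
  rcases u with _ | u
  · exact Subsingleton.antitone _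
  · exact Fin.antitone_iff_succ_le.2 fun i => h _ _ (by simp)

theorem IsStep.antitone {u : ℕ} {s : StepKind} {κ κ' : Fin u → ℤ} (h : IsStep s κ κ') :
    Antitone κ' := by
  cases s with
  | vert r => exact h.2.1
  | horiz r => exact antitone_of_succ fun i j hij => (h.2.1 i j hij).trans (h.1 i)

theorem IsStep.sub_mem_disp {u : ℕ} {s : StepKind} {κ κ' : Fin u → ℤ} (h : IsStep s κ κ') :
    κ' - κ ∈ s.disp u := by
  cases s with
  | vert r =>
    rw [mem_disp_vert]
    refine ⟨fun i => ?_, ?_⟩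
    · have := h.1 i
      simp only [Pi.sub_apply]
      omega
    · simp only [Pi.sub_apply, sum_sub_distrib]
      have := h.2.2
      omega
  | horiz r =>
    rw [mem_disp_horiz]
    refine ⟨fun i => ?_, ?_⟩
    · have := h.1 i
      simp only [Pi.sub_apply]
      omega
    · simp only [Pi.sub_apply, sum_sub_distrib]
      have := h.2.2
      omega

/-- Entries of `d` lie in `{-1, 0}`, so dominance fails only where `κ i = κ (i + 1)`, `d i = -1` and
`d (i + 1) = 0`; adding `ρ` makes these two exponents equal. -/
theorem alternant_eq_zero_of_not_isStep_vert {u r : ℕ} {κ d : Fin u → ℤ} (hκ : Antitone κ)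
    (hd : d ∈ (StepKind.vert r).disp u) (h : ¬ IsStep (.vert r) κ (κ + d)) :
    alternant (κ + stair u + d) = 0 := by
  rw [mem_disp_vert] at hd
  have : ¬ Antitone (κ + d) := fun hanti => h ⟨fun i => by
    have := hd.1 i
    simp only [Pi.add_apply]
    omega, hanti, by simp only [Pi.add_apply, sum_add_distrib]; omega⟩
  have hex : ∃ i j : Fin u, (i : ℕ) + 1 = j ∧ (κ + d) i < (κ + d) j := by
    by_contra hcon
    push Not at hcon
    exact this (antitone_of_succ hcon)
  obtain ⟨i, j, hij, hlt⟩ := hex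
  have h1 := hκ (Fin.le_def.2 (by omega) : i ≤ j)
  have h2 := hd.1 i
  have h3 := hd.1 j
  simp only [Pi.add_apply] at hlt
  refine alternant_eq_zero (i := i) (j := j) (fun h => by rw [h] at hij; omega) ?_
  simp only [Pi.add_apply, stair]
  omega

/-- The displacement `d` goes too far in the row `j`. -/
def Overshoots {u : ℕ} (κ d : Fin u → ℤ) (j : Fin u) : Prop :=
  ∃ i : Fin u, (i : ℕ) + 1 = j ∧ κ i < κ j + d j

-- The displacements that are not horizontal strips cancel in pairs: at the last overshooting row
-- `j`, swap the entries `j - 1` and `j` of `κ + ρ + d`. The overshoot is what keeps the new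
-- displacement non-negative; row `j` still overshoots, and later rows are unaffected.
open Classical in
theorem sum_alternant_not_isStep_horiz {u : ℕ} (r : ℕ) {κ : Fin u → ℤ} (hκ : Antitone κ) :
    ∑ d ∈ (StepKind.horiz r).disp u with ¬ IsStep (.horiz r) κ (κ + d),
      alternant (κ + stair u + d) = 0 := by
  set S := {d ∈ (StepKind.horiz r).disp u | ¬ IsStep (.horiz r) κ (κ + d)} with hS
  have memS : ∀ d, d ∈ S ↔ d ∈ (StepKind.horiz r).disp u ∧ ∃ j, Overshoots κ d j := by
    intro d
    rw [hS, mem_filter]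
    refine and_congr_right fun hd => ?_
    rw [mem_disp_horiz] at hd
    constructor
    · intro h
      by_contra hcon
      simp only [Overshoots, not_exists, not_and, not_lt] at hcon
      refine h ⟨fun i => ?_, fun i j hij => hcon j i hij, ?_⟩
      · have := hd.1 i
        simp only [Pi.add_apply]
        omega
      · simp only [Pi.add_apply, sum_add_distrib]
        omega
    · rintro ⟨j, i, hij, hlt⟩ h
      have := h.2.1 i j hij
      simp only [Pi.add_apply] at this
      omega
  have hex : ∀ d, d ∈ S → ∃ p : Fin u × Fin u, (p.1 : ℕ) + 1 = p.2 ∧ κ p.1 < κ p.2 + d p.2 ∧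
      ∀ j', p.2 < j' → ¬ Overshoots κ d j' := by
    intro d hd
    obtain ⟨-, j₀, hj₀⟩ := (memS d).1 hd
    obtain ⟨j, hj, hmax⟩ := exists_max_image ({j | Overshoots κ d j} : Finset (Fin u)) id
      ⟨j₀, mem_filter.2 ⟨mem_univ _, hj₀⟩⟩
    obtain ⟨i, hij, hlt⟩ := (mem_filter.1 hj).2
    exact ⟨(i, j), hij, hlt, fun j' hj' ho =>
      absurd (hmax j' (mem_filter.2 ⟨mem_univ _, ho⟩)) (not_le.2 hj')⟩
  rcases S.eq_empty_or_nonempty with hempty | ⟨d₀, hd₀⟩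
  · rw [hempty, sum_empty]
  have : Nonempty (Fin u × Fin u) := ⟨(hex d₀ hd₀).choose⟩
  choose! p hp using hex
  let φ : Fin u × Fin u → (Fin u → ℤ) → (Fin u → ℤ) := fun q d =>
    (κ + stair u + d) ∘ swap q.1 q.2 - (κ + stair u)
  have hφ : ∀ q d, κ + stair u + φ q d = (κ + stair u + d) ∘ swap q.1 q.2 := fun q d => by
    simp only [φ]
    abel
  have hinv : ∀ q d, φ q (φ q d) = d := fun q d => by
    have h1 := hφ q (φ q d)
    rw [hφ q d, Function.comp_assoc, ← Perm.coe_mul, swap_mul_self, Perm.coe_one,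
      Function.comp_id] at h1
    exact add_left_cancel h1
  have hfst : ∀ q d, φ q d q.1 = κ q.2 + stair u q.2 + d q.2 - κ q.1 - stair u q.1 :=
    fun q d => by
      simp only [φ, Pi.sub_apply, Function.comp_apply, swap_apply_left, Pi.add_apply]
      ring
  have hsnd : ∀ q d, φ q d q.2 = κ q.1 + stair u q.1 + d q.1 - κ q.2 - stair u q.2 :=
    fun q d => by
      simp only [φ, Pi.sub_apply, Function.comp_apply, swap_apply_right, Pi.add_apply]
      ring
  have hother : ∀ q d j, j ≠ q.1 → j ≠ q.2 → φ q d j = d j := fun q d j h1 h2 => by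
    simp only [φ, Pi.sub_apply, Function.comp_apply, swap_apply_of_ne_of_ne h1 h2, Pi.add_apply]
    ring
  have hne : ∀ d ∈ S, (p d).1 ≠ (p d).2 := fun d hd h => by
    have := (hp d hd).1
    rw [h] at this
    omega
  have hφS : ∀ d (hd : d ∈ S), φ (p d) d ∈ S ∧ p (φ (p d) d) = p d := by
    intro d hd
    obtain ⟨h1, h2, h3⟩ := hp d hd
    have hdd := mem_disp_horiz.1 ((memS d).1 hd).1
    have e1 := hfst (p d) d
    have e2 := hsnd (p d) d
    simp only [stair] at e1 e2
    have hκ' := hκ (Fin.le_def.2 (by omega) : (p d).1 ≤ (p d).2)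
    have d1 := hdd.1 (p d).1
    have hov : κ (p d).1 < κ (p d).2 + φ (p d) d (p d).2 := by omega
    have hover : ∀ j', (p d).2 < j' → ¬ Overshoots κ (φ (p d) d) j' := by
      intro j' hj' ho
      have hj'' : ((p d).2 : ℕ) < j' := hj'
      refine h3 j' hj' ?_
      obtain ⟨i, hi, hlt⟩ := ho
      rw [hother _ _ j' (fun h => by rw [h] at hj''; omega)
        (fun h => by rw [h] at hj''; omega)] at hlt
      exact ⟨i, hi, hlt⟩
    have hmem : φ (p d) d ∈ S := by
      rw [memS, mem_disp_horiz]
      refine ⟨⟨fun j => ?_, ?_⟩, (p d).2, (p d).1, h1, hov⟩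
      · by_cases hj1 : j = (p d).1
        · rw [hj1]
          omega
        · by_cases hj2 : j = (p d).2
          · rw [hj2]
            omega
          · rw [hother _ _ j hj1 hj2]
            exact hdd.1 j
      · rw [← hdd.2]
        simp only [φ, Pi.sub_apply, sum_sub_distrib, Function.comp_apply]
        rw [Equiv.sum_comp (swap (p d).1 (p d).2) (κ + stair u + d)]
        simp only [Pi.add_apply, sum_add_distrib]
        ring
    refine ⟨hmem, ?_⟩
    obtain ⟨h1', h2', h3'⟩ := hp _ hmem
    have hj : (p (φ (p d) d)).2 = (p d).2 := by
      rcases lt_trichotomy (p (φ (p d) d)).2 (p d).2 with h | h | h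
      · exact absurd ⟨_, h1, hov⟩ (h3' _ h)
      · exact h
      · exact absurd ⟨_, h1', h2'⟩ (hover _ h)
    refine Prod.ext (Fin.ext ?_) hj
    rw [hj] at h1'
    omega
  refine sum_involution (fun d _ => φ (p d) d) (fun d hd => ?_) (fun d hd h0 heq => ?_)
    (fun d hd => (hφS d hd).1) (fun d hd => ?_)
  · rw [hφ, alternant_comp_swap _ (hne d hd), add_neg_cancel]
  · apply h0
    apply eq_zero_of_eq_neg_self
    rw [← alternant_comp_swap _ (hne d hd), ← hφ, heq]
  · rw [(hφS d hd).2, hinv]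

open Classical in
/-- The Pieri rules for alternants. -/
theorem alternant_mul_poly_of_antitone {u : ℕ} (s : StepKind) {κ : Fin u → ℤ}
    (hκ : Antitone κ) : alternant (κ + stair u) * s.poly u =
      ∑ d ∈ s.disp u with IsStep s κ (κ + d), alternant (κ + d + stair u) := by
  rw [alternant_mul_poly, ← sum_filter_add_sum_filter_not _ (fun d => IsStep s κ (κ + d))]
  have h0 : ∑ d ∈ s.disp u with ¬ IsStep s κ (κ + d), alternant (κ + stair u + d) = 0 := by
    cases s with
    | vert r =>
      refine sum_eq_zero fun d hd => ?_
      rw [mem_filter] at hd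
      exact alternant_eq_zero_of_not_isStep_vert hκ hd.1 hd.2
    | horiz r => exact sum_alternant_not_isStep_horiz r hκ
  rw [h0, add_zero]
  exact sum_congr rfl fun d _ => by rw [add_right_comm]

/-! ### Counting chains -/

/-- Chains of `N` steps, starting at `0`; they are extended by constants. -/
structure IsChain {u : ℕ} (s : ℕ → StepKind) (N : ℕ) (α : ℕ → Fin u → ℤ) : Prop where
  zero : α 0 = 0
  step : ∀ n < N, IsStep (s n) (α n) (α (n + 1))
  const : ∀ n, N ≤ n → α n = α N

theorem IsChain.antitone {u : ℕ} {s : ℕ → StepKind} {N : ℕ} {α : ℕ → Fin u → ℤ}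
    (h : IsChain s N α) : Antitone (α N) := by
  rcases N with _ | N
  · rw [h.zero]
    exact fun _ _ _ => le_rfl
  · exact (h.step N (Nat.lt_succ_self N)).antitone

/-- The Pieri rules iterated: dominance of the current end allows the next multiplication. Extension
by constants makes a chain determined by its first `N + 1` members, so the set is finite. -/
theorem exists_chains {u : ℕ} (s : ℕ → StepKind) (N : ℕ) :
    ∃ C : Finset (ℕ → Fin u → ℤ), (∀ α, α ∈ C ↔ IsChain s N α) ∧
      alternant (stair u) * ∏ n ∈ range N, (s n).poly u = ∑ α ∈ C, alternant (α N + stair u) := by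
  classical
  induction N with
  | zero =>
    refine ⟨{0}, fun α => ?_, ?_⟩
    · rw [mem_singleton]
      constructor
      · rintro rfl
        exact ⟨rfl, fun n hn => absurd hn (Nat.not_lt_zero n), fun n _ => rfl⟩
      · intro h
        funext n
        rw [h.const n (Nat.zero_le n), h.zero]
        rfl
    · rw [prod_range_zero, mul_one, sum_singleton, Pi.zero_apply, zero_add]
  | succ N ih =>
    obtain ⟨C, hC, hsum⟩ := ih
    let ext : (Σ _ : ℕ → Fin u → ℤ, Fin u → ℤ) → ℕ → Fin u → ℤ := fun x n =>
      if n ≤ N then x.1 n else x.1 N + x.2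
    let D := C.sigma fun α => {d ∈ (s N).disp u | IsStep (s N) (α N) (α N + d)}
    have hinj : Set.InjOn ext D := by
      rintro ⟨α, d⟩ hx ⟨α', d'⟩ hx' h
      have h1 : ∀ n ≤ N, α n = α' n := fun n hn => by
        have := congrFun h n
        simpa only [ext, if_pos hn] using this
      have h2 := congrFun h (N + 1)
      simp only [ext, if_neg (show ¬ N + 1 ≤ N by omega)] at h2
      rw [h1 N le_rfl] at h2
      have hα : α = α' := by
        funext n
        rcases le_total n N with hn | hn
        · exact h1 n hn
        · have e1 := ((hC α).1 (mem_sigma.1 hx).1).const n hn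
          have e2 := ((hC α').1 (mem_sigma.1 hx').1).const n hn
          rw [e1, e2, h1 N le_rfl]
      rw [hα, add_left_cancel h2]
    refine ⟨D.image ext, fun β => ?_, ?_⟩
    · rw [mem_image]
      constructor
      · rintro ⟨⟨α, d⟩, hx, rfl⟩
        obtain ⟨hα, hd⟩ := mem_sigma.1 hx
        have hα := (hC α).1 hα
        have hd := (mem_filter.1 hd).2
        refine ⟨?_, fun n hn => ?_, fun n hn => ?_⟩
        · simp only [ext, if_pos (Nat.zero_le N)]
          exact hα.zero
        · rcases Nat.lt_succ_iff_lt_or_eq.1 hn with h | rfl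
          · simp only [ext, if_pos h.le, if_pos (Nat.succ_le_of_lt h)]
            exact hα.step n h
          · simp only [ext, if_pos le_rfl, if_neg (show ¬ n + 1 ≤ n by omega)]
            exact hd
        · simp only [ext, if_neg (show ¬ n ≤ N by omega), if_neg (show ¬ N + 1 ≤ N by omega)]
      · intro hβ
        refine ⟨⟨fun n => β (min n N), β (N + 1) - β N⟩, mem_sigma.2 ⟨(hC _).2 ?_, ?_⟩, ?_⟩
        · refine ⟨?_, fun n hn => ?_, fun n hn => ?_⟩
          · simp only [Nat.zero_min]
            exact hβ.zero
          · simp only [min_eq_left hn.le, min_eq_left (Nat.succ_le_of_lt hn)]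
            exact hβ.step n (by omega)
          · simp only [min_eq_right hn, min_self]
        · have := hβ.step N (Nat.lt_succ_self N)
          simp only [min_self, mem_filter, add_sub_cancel]
          exact ⟨this.sub_mem_disp, this⟩
        · funext n
          simp only [ext]
          split_ifs with h
          · rw [min_eq_left h]
          · rw [min_self, add_sub_cancel, hβ.const n (by omega)]
    · rw [sum_image hinj, sum_sigma, prod_range_succ, ← mul_assoc, hsum, sum_mul]
      refine sum_congr rfl fun α hα => ?_
      rw [alternant_mul_poly_of_antitone _ ((hC α).1 hα).antitone]
      refine sum_congr rfl fun d _ => ?_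
      simp only [ext, if_neg (show ¬ N + 1 ≤ N by omega)]

/-- The number of chains is a coefficient of a product of elementary and complete symmetric
polynomials. -/
theorem finite_chains {u : ℕ} (s : ℕ → StepKind) (N : ℕ) (κ : GenPartition u) :
    {α : ℕ → Fin u → ℤ | IsChain s N α ∧ α N = κ.1}.Finite ∧
    schurCoeff κ (∏ n ∈ range N, (s n).poly u) =
      {α : ℕ → Fin u → ℤ | IsChain s N α ∧ α N = κ.1}.ncard := by
  classical
  obtain ⟨C, hC, hsum⟩ := exists_chains (u := u) s N
  have hset : {α : ℕ → Fin u → ℤ | IsChain s N α ∧ α N = κ.1} = ↑({α ∈ C | α N = κ.1}) := by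
    ext α
    simp only [Set.mem_ofPred_eq, coe_filter, hC]
  rw [hset]
  refine ⟨finite_toSet _, ?_⟩
  rw [Set.ncard_coe_finset]
  exact schurCoeff_of_eq_sum C (fun α => α N) (fun α hα => ((hC α).1 hα).antitone) hsum κ

/-! ### Semistandard tableaux and chains -/

/-- The correspondences below are given by a relation with existence and uniqueness on both sides,
so that no inverse map has to be written down. -/
theorem ncard_eq_of_relation {A B : Type*} {s : Set A} {t : Set B} (R : A → B → Prop)
    (h1 : ∀ a ∈ s, ∃ b ∈ t, R a b) (h2 : ∀ b ∈ t, ∃ a ∈ s, R a b)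
    (h3 : ∀ a ∈ s, ∀ b ∈ t, ∀ b' ∈ t, R a b → R a b' → b = b')
    (h4 : ∀ a ∈ s, ∀ a' ∈ s, ∀ b ∈ t, R a b → R a' b → a = a') :
    s.ncard = t.ncard ∧ (t.Finite → s.Finite) := by
  choose f hf hR using h1
  have hinj : ∀ a b (ha : a ∈ s) (hb : b ∈ s), f a ha = f b hb → a = b := fun a b ha hb h =>
    h4 a ha b hb (f a ha) (hf a ha) (hR a ha) (by rw [h]; exact hR b hb)
  refine ⟨Set.ncard_congr f hf hinj fun b hb => ?_, fun ht => ?_⟩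
  · obtain ⟨a, ha, hab⟩ := h2 b hb
    exact ⟨a, ha, h3 a ha _ (hf a ha) b hb (hR a ha) hab⟩
  · have := ht.to_subtype
    have hfin : Finite s := Finite.of_injective (fun a : s => (⟨f a a.2, hf a a.2⟩ : t))
      fun a b h => Subtype.ext (hinj a b a.2 b.2 (congrArg Subtype.val h))
    exact s.toFinite

theorem lt_card_iff_mem {S : Finset ℕ} (h : ∀ x ∈ S, ∀ y, y ≤ x → y ∈ S) {j : ℕ} :
    j < #S ↔ j ∈ S := by
  rcases S.eq_empty_or_nonempty with rfl | hne
  · simp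
  have hS : S = range (S.max' hne + 1) := by
    ext x
    rw [mem_range, Nat.lt_succ_iff]
    exact ⟨fun hx => S.le_max' x hx, fun hx => h _ (S.max'_mem hne) x hx⟩
  have hcard : #S = S.max' hne + 1 := by
    conv_lhs => rw [hS]
    rw [card_range]
  rw [hcard]
  conv_rhs => rw [hS, mem_range]

/-- The row `i` of `F` has `β n i` entries less than `n`. -/
def RowCounts {u : ℕ} (ν : YoungDiagram) (F : ℕ → ℕ → ℕ) (β : ℕ → Fin u → ℤ) : Prop :=
  ∀ n (i : Fin u) (j : ℕ), ((i : ℕ), j) ∈ ν → (F i j < n ↔ (j : ℤ) < β n i)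

section RowCounts

variable {u : ℕ} {ν : YoungDiagram} {F F' : ℕ → ℕ → ℕ} {β β' : ℕ → Fin u → ℤ}

theorem row_lt_of_mem (hν : ν.colLen 0 ≤ u) {i j : ℕ} (h : (i, j) ∈ ν) : i < u :=
  (YoungDiagram.mem_iff_lt_colLen.1 h).trans_le ((ν.colLen_anti 0 j (Nat.zero_le j)).trans hν)

theorem exists_rowCounts (hF : ∀ i j j', j ≤ j' → (i, j') ∈ ν → F i j ≤ F i j') :
    ∃ β : ℕ → Fin u → ℤ, RowCounts ν F β ∧ ∀ n i, 0 ≤ β n i ∧ β n i ≤ ν.rowLen i := by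
  refine ⟨fun n i => (#{j ∈ range (ν.rowLen i) | F i j < n} : ℕ), fun n i j hij => ?_,
    fun n i => ⟨Int.natCast_nonneg _, ?_⟩⟩
  · rw [Nat.cast_lt, lt_card_iff_mem, mem_filter, mem_range, ← YoungDiagram.mem_iff_lt_rowLen]
    · exact ⟨fun h => ⟨hij, h⟩, fun h => h.2⟩
    · intro x hx y hy
      rw [mem_filter, mem_range] at hx ⊢
      exact ⟨by omega, (hF i y x hy (YoungDiagram.mem_iff_lt_rowLen.2 hx.1)).trans_lt hx.2⟩
  · rw [Nat.cast_le]
    exact (card_filter_le _ _).trans (card_range _).le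

/-- The entry in the cell `(i, j)` is the step at which the row `i` grows past `j`. -/
theorem exists_filling (hν : ν.colLen 0 ≤ u) (h0 : ∀ i, β 0 i = 0)
    (hmono : ∀ n i, β n i ≤ β (n + 1) i) {N : ℕ} (hN : ∀ i : Fin u, β N i = ν.rowLen i) :
    ∃ F : ℕ → ℕ → ℕ, RowCounts ν F β ∧ ∀ i j, (i, j) ∉ ν → F i j = 0 := by
  classical
  have hmono' : ∀ i, Monotone fun n => β n i := fun i => monotone_nat_of_le_succ fun n => hmono n i
  have hex : ∀ i j, (h : (i, j) ∈ ν) → ∃ n, (j : ℤ) < β (n + 1) ⟨i, row_lt_of_mem hν h⟩ := by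
    intro i j h
    have h1 := YoungDiagram.mem_iff_lt_rowLen.1 h
    have h2 := hmono N ⟨i, row_lt_of_mem hν h⟩
    rw [hN] at h2
    exact ⟨N, by simp only at h2; omega⟩
  refine ⟨fun i j => if h : (i, j) ∈ ν then Nat.find (hex i j h) else 0, fun n i j hij => ?_,
    fun i j h => dif_neg h⟩
  simp only
  rw [dif_pos hij]
  constructor
  · intro h
    exact (Nat.find_spec (hex i j hij)).trans_le (hmono' i (Nat.succ_le_of_lt h))
  · intro h
    rcases n with _ | n
    · rw [h0] at h
      omega
    · exact Nat.lt_succ_of_le (Nat.find_min' _ h)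

theorem RowCounts.filling_unique (hν : ν.colLen 0 ≤ u) (h : RowCounts ν F β)
    (h' : RowCounts ν F' β) {i j : ℕ} (hij : (i, j) ∈ ν) : F i j = F' i j := by
  have hi := row_lt_of_mem hν hij
  have h1 := (h (F i j + 1) ⟨i, hi⟩ j hij).trans (h' (F i j + 1) ⟨i, hi⟩ j hij).symm
  have h2 := (h (F' i j + 1) ⟨i, hi⟩ j hij).trans (h' (F' i j + 1) ⟨i, hi⟩ j hij).symm
  simp only at h1 h2
  omega

theorem RowCounts.lt_iff (h : RowCounts ν F β) (hβ : ∀ n i, β n i ≤ ν.rowLen i) {n : ℕ}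
    {i : Fin u} {j : ℕ} : (j : ℤ) < β n i ↔ ((i : ℕ), j) ∈ ν ∧ F i j < n := by
  constructor
  · intro hj
    have : ((i : ℕ), j) ∈ ν := YoungDiagram.mem_iff_lt_rowLen.2 (by have := hβ n i; omega)
    exact ⟨this, (h n i j this).2 hj⟩
  · exact fun hj => (h n i j hj.1).1 hj.2

theorem le_of_forall_nat_lt {a b : ℤ} (hb : 0 ≤ b) (h : ∀ j : ℕ, (j : ℤ) < a → (j : ℤ) < b) :
    a ≤ b := by
  by_contra hcon
  have := h b.toNat (by omega)
  omega

theorem RowCounts.counts_unique (h : RowCounts ν F β) (h' : RowCounts ν F β')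
    (hβ : ∀ n i, 0 ≤ β n i ∧ β n i ≤ ν.rowLen i) (hβ' : ∀ n i, 0 ≤ β' n i ∧ β' n i ≤ ν.rowLen i) :
    β = β' := by
  funext n i
  refine le_antisymm (le_of_forall_nat_lt (hβ' n i).1 fun j hj => ?_)
    (le_of_forall_nat_lt (hβ n i).1 fun j hj => ?_)
  · exact (h'.lt_iff fun n i => (hβ' n i).2).2 ((h.lt_iff fun n i => (hβ n i).2).1 hj)
  · exact (h.lt_iff fun n i => (hβ n i).2).2 ((h'.lt_iff fun n i => (hβ' n i).2).1 hj)

theorem RowCounts.card_lt (hν : ν.colLen 0 ≤ u) (h : RowCounts ν F β)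
    (hβ : ∀ n i, 0 ≤ β n i ∧ β n i ≤ ν.rowLen i) (n : ℕ) :
    (#{x ∈ ν.cells | F x.1 x.2 < n} : ℤ) = ∑ i, β n i := by
  have hcard : #{x ∈ ν.cells | F x.1 x.2 < n} =
      #(univ.sigma fun i : Fin u => range (β n i).toNat) := by
    symm
    refine card_bij (fun x _ => ((x.1 : ℕ), x.2)) (fun x hx => ?_) (fun x _ y _ hxy => ?_)
      (fun x hx => ?_)
    · have := mem_range.1 (mem_sigma.1 hx).2
      have := (h.lt_iff (fun n i => (hβ n i).2) (n := n) (i := x.1) (j := x.2)).1 (by omega)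
      exact mem_filter.2 ⟨(YoungDiagram.mem_cells _).2 this.1, this.2⟩
    · obtain ⟨i, j⟩ := x
      obtain ⟨i', j'⟩ := y
      rw [Prod.mk.injEq] at hxy
      obtain rfl := Fin.ext hxy.1
      obtain rfl := hxy.2
      rfl
    · obtain ⟨i, j⟩ := x
      obtain ⟨h1, h2⟩ := mem_filter.1 hx
      have h1 := (YoungDiagram.mem_cells _).1 h1
      have hi := row_lt_of_mem hν h1
      have := (h.lt_iff (fun n i => (hβ n i).2) (n := n) (i := ⟨i, hi⟩) (j := j)).2 ⟨h1, h2⟩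
      exact ⟨⟨⟨i, hi⟩, j⟩, mem_sigma.2 ⟨mem_univ _, mem_range.2 (by simp only; omega)⟩, rfl⟩
  rw [hcard, card_sigma]
  push_cast
  refine sum_congr rfl fun i _ => ?_
  rw [card_range, Int.toNat_of_nonneg (hβ n i).1]

theorem RowCounts.sum_succ (hν : ν.colLen 0 ≤ u) (h : RowCounts ν F β)
    (hβ : ∀ n i, 0 ≤ β n i ∧ β n i ≤ ν.rowLen i) (n : ℕ) :
    ∑ i, β (n + 1) i = ∑ i, β n i + #{x ∈ ν.cells | F x.1 x.2 = n} := by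
  rw [← h.card_lt hν hβ, ← h.card_lt hν hβ, ← Nat.cast_add, ← card_union_of_disjoint]
  · congr 2
    ext x
    simp only [mem_filter, mem_union, ← and_or_left]
    exact and_congr_right fun _ => by omega
  · rw [disjoint_filter]
    intro x _ h1 h2
    omega

theorem RowCounts.eq_rowLen (h : RowCounts ν F β)
    (hβ : ∀ n i, 0 ≤ β n i ∧ β n i ≤ ν.rowLen i) {N : ℕ}
    (hN : ∀ n, N ≤ n → #{x ∈ ν.cells | F x.1 x.2 = n} = 0) (n : ℕ) (hn : N ≤ n) (i : Fin u) :
    β n i = ν.rowLen i := by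
  refine le_antisymm (hβ n i).2 (le_of_forall_nat_lt (hβ n i).1 fun j hj => ?_)
  have hij : ((i : ℕ), j) ∈ ν := YoungDiagram.mem_iff_lt_rowLen.2 (by omega)
  rw [← h n i j hij]
  by_contra hcon
  have := hN (F i j) (by omega)
  rw [card_eq_zero] at this
  exact notMem_empty ((i : ℕ), j) (this ▸ mem_filter.2 ⟨(YoungDiagram.mem_cells _).2 hij, rfl⟩)

theorem RowCounts.zero_eq (h : RowCounts ν F β)
    (hβ : ∀ n i, 0 ≤ β n i ∧ β n i ≤ ν.rowLen i) (i : Fin u) : β 0 i = 0 := by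
  refine le_antisymm (le_of_forall_nat_lt le_rfl fun j hj => ?_) (hβ 0 i).1
  exact absurd ((h.lt_iff fun n i => (hβ n i).2).1 hj).2 (Nat.not_lt_zero _)

theorem RowCounts.mono (h : RowCounts ν F β)
    (hβ : ∀ n i, 0 ≤ β n i ∧ β n i ≤ ν.rowLen i) (n : ℕ) (i : Fin u) : β n i ≤ β (n + 1) i := by
  refine le_of_forall_nat_lt (hβ _ i).1 fun j hj => ?_
  rw [h.lt_iff fun n i => (hβ n i).2] at hj ⊢
  exact ⟨hj.1, by omega⟩

end RowCounts

theorem ssyt_row_le {ν : YoungDiagram} (T : SemistandardYoungTableau ν) {i j j' : ℕ}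
    (h : j ≤ j') (hm : (i, j') ∈ ν) : T i j ≤ T i j' := by
  rcases h.lt_or_eq with h | rfl
  · exact T.row_weak h hm
  · exact le_rfl

theorem ssyt_col_le {ν : YoungDiagram} (T : SemistandardYoungTableau ν) {i i' j : ℕ}
    (h : i ≤ i') (hm : (i', j) ∈ ν) : T i j ≤ T i' j := by
  rcases h.lt_or_eq with h | rfl
  · exact (T.col_strict h hm).le
  · exact le_rfl

/-- The semistandard tableaux of shape `ν` in which the letter `k` occurs `c k` times. -/
def ssytWithContent (ν : YoungDiagram) (c : ℕ → ℕ) : Set (SemistandardYoungTableau ν) :=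
  {T | ∀ k, #{x ∈ ν.cells | T x.1 x.2 = k} = c k}

theorem chain_monotone_horiz {u : ℕ} {c : ℕ → ℕ} {N : ℕ} {α : ℕ → Fin u → ℤ}
    (h : IsChain (fun n => .horiz (c n)) N α) (n : ℕ) (i : Fin u) : α n i ≤ α (n + 1) i := by
  rcases lt_or_ge n N with hn | hn
  · exact (h.step n hn).1 i
  · rw [h.const n hn, h.const (n + 1) (by omega)]

theorem chain_antitone_vert {u : ℕ} {c : ℕ → ℕ} {N : ℕ} {α : ℕ → Fin u → ℤ}
    (h : IsChain (fun n => .vert (c n)) N α) (n : ℕ) (i : Fin u) : α (n + 1) i ≤ α n i := by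
  rcases lt_or_ge n N with hn | hn
  · exact ((h.step n hn).1 i).1
  · rw [h.const n hn, h.const (n + 1) (by omega)]

/-- Semistandard tableaux are chains of horizontal strips. -/
theorem ncard_ssytWithContent_eq_horiz {u : ℕ} {ν : YoungDiagram} (hν : ν.colLen 0 ≤ u)
    {c : ℕ → ℕ} {N : ℕ} (hc : ∀ n, N ≤ n → c n = 0) :
    (ssytWithContent ν c).ncard = {α : ℕ → Fin u → ℤ | IsChain (fun n => .horiz (c n)) N α ∧
      α N = (GenPartition.ofPartition u ν).1}.ncard := by
  have hbd : ∀ α : ℕ → Fin u → ℤ, IsChain (fun n => .horiz (c n)) N α ∧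
      α N = (GenPartition.ofPartition u ν).1 → ∀ n i, 0 ≤ α n i ∧ α n i ≤ ν.rowLen i := by
    rintro α ⟨hα, hαN⟩ n i
    have hmono : Monotone fun n => α n i := monotone_nat_of_le_succ fun n =>
      chain_monotone_horiz hα n i
    constructor
    · have := hmono (Nat.zero_le n)
      simp only [hα.zero] at this
      exact this
    · have h1 : α N i = ν.rowLen i := congrFun hαN i
      rw [← h1]
      rcases le_total n N with hn | hn
      · exact hmono hn
      · rw [hα.const n hn]
  refine (ncard_eq_of_relation (fun T α => RowCounts ν (fun i j => T i j) α) ?_ ?_ ?_ ?_).1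
  · intro T hT
    obtain ⟨α, hα, hβ⟩ := exists_rowCounts (u := u) (ν := ν) (F := fun i j => T i j)
      (fun i j j' h hm => ssyt_row_le T h hm)
    have hN := hα.eq_rowLen hβ (N := N) (fun n hn => (hT n).trans (hc n hn))
    refine ⟨α, ⟨⟨funext (hα.zero_eq hβ), fun n hn => ⟨hα.mono hβ n, fun i j hij => ?_, ?_⟩,
      fun n hn => ?_⟩, funext (hN N le_rfl)⟩, hα⟩
    -- A cell of row `i + 1` with entry at most `n` has a smaller entry above it: columns are
    -- strict.
    · refine le_of_forall_nat_lt (hβ n i).1 fun k hk => ?_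
      rw [hα.lt_iff fun n i => (hβ n i).2] at hk ⊢
      rw [← hij] at hk
      refine ⟨ν.up_left_mem (Nat.le_succ i) le_rfl hk.1, ?_⟩
      have := T.col_strict (Nat.lt_add_one (i : ℕ)) hk.1
      have := hk.2
      omega
    · rw [hα.sum_succ hν hβ, ← hT n]
    · exact funext fun i => (hN n hn i).trans (hN N le_rfl i).symm
  · rintro α hα
    have hβ := hbd α hα
    obtain ⟨hα, hαN⟩ := hα
    obtain ⟨F, hF, hF0⟩ := exists_filling (ν := ν) hν (fun i => by rw [hα.zero]; rfl)
      (chain_monotone_horiz hα) (N := N) (congrFun hαN)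
    have key : ∀ {i i' j}, i < i' → (i', j) ∈ ν → F i j < F i' j := by
      intro i i' j hii' hm
      have hi' := row_lt_of_mem hν hm
      have hm' : (i, j) ∈ ν := ν.up_left_mem hii'.le le_rfl hm
      have hm'' : (i + 1, j) ∈ ν := ν.up_left_mem hii' le_rfl hm
      have h1 := (hF (F i' j + 1) ⟨i', hi'⟩ j hm).1 (Nat.lt_succ_self _)
      have hFN : F i' j < N := (hF N ⟨i', hi'⟩ j hm).2 (by
        rw [hαN]
        exact Nat.cast_lt.2 (YoungDiagram.mem_iff_lt_rowLen.1 hm))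
      have hst := hα.step (F i' j) hFN
      refine (hF (F i' j) ⟨i, by omega⟩ j hm').2 (h1.trans_le (le_trans ?_
        (hst.2.1 ⟨i, by omega⟩ ⟨i + 1, by omega⟩ rfl)))
      exact hst.antitone (Fin.mk_le_mk.2 hii')
    refine ⟨⟨F, ?_, key, fun h => hF0 _ _ h⟩, fun k => ?_, hF⟩
    · intro i j j' hjj' hm
      have hi := row_lt_of_mem hν hm
      have hm' : (i, j) ∈ ν := ν.up_left_mem le_rfl hjj'.le hm
      have h1 := (hF (F i j' + 1) ⟨i, hi⟩ j' hm).1 (Nat.lt_succ_self _)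
      exact Nat.lt_succ_iff.1 ((hF (F i j' + 1) ⟨i, hi⟩ j hm').2 (by omega))
    · have h1 := hF.sum_succ hν hβ k
      rcases lt_or_ge k N with hk | hk
      · have h2 := (hα.step k hk).2.2
        have : (#{x ∈ ν.cells | F x.1 x.2 = k} : ℤ) = c k := by omega
        exact_mod_cast this
      · rw [hα.const k hk, hα.const (k + 1) (by omega)] at h1
        have : (#{x ∈ ν.cells | F x.1 x.2 = k} : ℤ) = 0 := by omega
        rw [hc k hk]
        exact_mod_cast this
  · intro T _ α hα α' hα' h h'
    exact h.counts_unique h' (hbd α hα) (hbd α' hα')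
  · intro T _ T' _ α hα h h'
    ext i j
    by_cases hij : (i, j) ∈ ν
    · exact h.filling_unique hν h' hij
    · rw [T.zeros hij, T'.zeros hij]

/-- Semistandard tableaux of the conjugate shape are chains of vertical strips. -/
theorem ncard_ssytWithContent_transpose_eq_vert {u : ℕ} {μ : YoungDiagram}
    (hμ : μ.colLen 0 ≤ u) {c : ℕ → ℕ} {N : ℕ} (hc : ∀ n, N ≤ n → c n = 0) :
    (ssytWithContent μ.transpose c).ncard =
      {α : ℕ → Fin u → ℤ | IsChain (fun n => .vert (c n)) N α ∧
        α N = (GenPartition.ofPartition u μ).star.1}.ncard := by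
  have hrev : ∀ (f : Fin u → ℤ), ∑ i : Fin u, -f i.rev = -∑ i, f i := fun f => by
    rw [sum_neg_distrib, ← Equiv.sum_comp Fin.revPerm f]
    rfl
  have hcells : ∀ (F : ℕ → ℕ → ℕ) (k : ℕ), #{x ∈ μ.cells | F x.1 x.2 = k} =
      #{x ∈ μ.transpose.cells | F x.2 x.1 = k} := by
    intro F k
    refine card_bij (fun x _ => x.swap) (fun x hx => ?_) (fun x _ y _ h => Prod.swap_injective h)
      (fun x hx => ?_)
    · rw [mem_filter, YoungDiagram.mem_cells] at hx ⊢
      exact ⟨by rw [YoungDiagram.mem_transpose, Prod.swap_swap]; exact hx.1, hx.2⟩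
    · rw [mem_filter, YoungDiagram.mem_cells, YoungDiagram.mem_transpose] at hx
      exact ⟨x.swap, mem_filter.2 ⟨(YoungDiagram.mem_cells _).2 hx.1, hx.2⟩, Prod.swap_swap x⟩
  have hbd : ∀ α : ℕ → Fin u → ℤ, IsChain (fun n => .vert (c n)) N α ∧
      α N = (GenPartition.ofPartition u μ).star.1 → ∀ n (i : Fin u), 0 ≤ -α n i.rev ∧
        -α n i.rev ≤ μ.rowLen i := by
    rintro α ⟨hα, hαN⟩ n i
    have hanti : Antitone fun n => α n i.rev := antitone_nat_of_succ_le fun n =>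
      chain_antitone_vert hα n i.rev
    constructor
    · have := hanti (Nat.zero_le n)
      simp only [hα.zero, Pi.zero_apply] at this
      omega
    · have h1 : α N i.rev = -(μ.rowLen i : ℤ) := by
        rw [hαN]
        simp only [GenPartition.star, GenPartition.ofPartition, Fin.rev_rev]
      have : α N i.rev ≤ α n i.rev := by
        rcases le_total n N with hn | hn
        · exact hanti hn
        · rw [hα.const n hn]
      omega
  refine (ncard_eq_of_relation (fun (T : SemistandardYoungTableau μ.transpose) α =>
    RowCounts μ (fun i j => T j i) fun n (i : Fin u) => -α n i.rev) ?_ ?_ ?_ ?_).1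
  · intro T hT
    obtain ⟨β, hβR, hβ⟩ := exists_rowCounts (u := u) (ν := μ) (F := fun i j => T j i)
      (fun i j j' h hm => ssyt_col_le T h (by rwa [YoungDiagram.mem_transpose]))
    have hcont : ∀ k, #{x ∈ μ.cells | T x.2 x.1 = k} = c k := fun k => by
      rw [hcells (fun i j => T j i) k]
      exact hT k
    have hN := hβR.eq_rowLen hβ (N := N) (fun n hn => (hcont n).trans (hc n hn))
    -- Negation and reversal turn growth from the empty shape to `μ` into descent from `0` to `μ*`.
    -- Columns of the conjugate tableau are rows of `μ`, so each letter occurs at most once in a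
    -- row.
    refine ⟨fun n i => -β n i.rev, ⟨⟨?_, fun n hn => ⟨fun i => ⟨?_, ?_⟩, ?_, ?_⟩, fun n hn => ?_⟩,
      ?_⟩, ?_⟩
    · funext i
      rw [hβR.zero_eq hβ]
      rfl
    · exact neg_le_neg (hβR.mono hβ n i.rev)
    · suffices β (n + 1) i.rev - 1 ≤ β n i.rev by
        simp only
        omega
      refine le_of_forall_nat_lt (hβ _ _).1 fun k hk => ?_
      have hk' : ((k + 1 : ℕ) : ℤ) < β (n + 1) i.rev := by
        push_cast
        omega
      rw [hβR.lt_iff fun n i => (hβ n i).2] at hk' ⊢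
      refine ⟨μ.up_left_mem le_rfl (Nat.le_succ k) hk'.1, ?_⟩
      have := T.col_strict (i1 := k) (i2 := k + 1) (j := i.rev) (Nat.lt_succ_self k)
        (by rw [YoungDiagram.mem_transpose]; exact hk'.1)
      have := hk'.2
      omega
    · intro i i' hii'
      simp only [neg_le_neg_iff]
      refine le_of_forall_nat_lt (hβ _ _).1 fun k hk => ?_
      rw [hβR.lt_iff fun n i => (hβ n i).2] at hk ⊢
      have hle : ((i'.rev : Fin u) : ℕ) ≤ i.rev := Fin.rev_le_rev.2 hii'
      refine ⟨μ.up_left_mem hle le_rfl hk.1, lt_of_le_of_lt ?_ hk.2⟩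
      exact ssyt_row_le T hle (by rw [YoungDiagram.mem_transpose]; exact hk.1)
    · rw [hrev, hrev, hβR.sum_succ hμ hβ, hcont n]
      ring
    · funext i
      simp only [hN n hn, hN N le_rfl]
    · funext i
      simp only [hN N le_rfl]
      rfl
    · simp only [Fin.rev_rev, neg_neg]
      exact hβR
  · rintro α hα
    have hβ := hbd α hα
    obtain ⟨hα, hαN⟩ := hα
    have hαN' : ∀ i : Fin u, -α N i.rev = μ.rowLen i := fun i => by
      rw [hαN]
      simp only [GenPartition.star, GenPartition.ofPartition, Fin.rev_rev, neg_neg]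
    obtain ⟨F, hF, hF0⟩ := exists_filling (ν := μ) (β := fun n (i : Fin u) => -α n i.rev) hμ
      (fun i => by rw [hα.zero]; rfl) (fun n i => neg_le_neg (chain_antitone_vert hα n i.rev))
      (N := N) hαN'
    have key : ∀ {i i' j}, i < i' → (i', j) ∈ μ.transpose → F j i < F j i' := by
      intro i i' j hii' hm
      rw [YoungDiagram.mem_transpose, Prod.swap_prod_mk] at hm
      have hj := row_lt_of_mem hμ hm
      have hm' : (j, i) ∈ μ := μ.up_left_mem le_rfl hii'.le hm
      have h1 := (hF (F j i' + 1) ⟨j, hj⟩ i' hm).1 (Nat.lt_succ_self _)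
      have hFN : F j i' < N := (hF N ⟨j, hj⟩ i' hm).2 (by
        simp only
        rw [hαN']
        exact Nat.cast_lt.2 (YoungDiagram.mem_iff_lt_rowLen.1 hm))
      have hst := (hα.step (F j i') hFN).1 (Fin.rev ⟨j, hj⟩)
      exact (hF (F j i') ⟨j, hj⟩ i hm').2 (by simp only at h1 ⊢; omega)
    refine ⟨⟨fun i j => F j i, ?_, key, fun h => hF0 _ _ ?_⟩, fun k => ?_, hF⟩
    · intro i j j' hjj' hm
      rw [YoungDiagram.mem_transpose, Prod.swap_prod_mk] at hm
      have hj := row_lt_of_mem hμ hm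
      have hm' : (j, i) ∈ μ := μ.up_left_mem hjj'.le le_rfl hm
      have h1 := (hF (F j' i + 1) ⟨j', hj⟩ i hm).1 (Nat.lt_succ_self _)
      refine Nat.lt_succ_iff.1 ((hF (F j' i + 1) ⟨j, by omega⟩ i hm').2 (h1.trans_le ?_))
      have hFN : F j' i < N := (hF N ⟨j', hj⟩ i hm).2 (by
        simp only
        rw [hαN']
        exact Nat.cast_lt.2 (YoungDiagram.mem_iff_lt_rowLen.1 hm))
      exact neg_le_neg ((hα.step (F j' i) hFN).antitone (Fin.rev_le_rev.2
        (Fin.mk_le_mk.2 hjj'.le)))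
    · rw [YoungDiagram.mem_transpose] at h
      exact h
    · have h0 := hcells F k
      have h1 := hF.sum_succ hμ hβ k
      rw [hrev, hrev] at h1
      rcases lt_or_ge k N with hk | hk
      · have h2 := (hα.step k hk).2.2
        have : (#{x ∈ μ.cells | F x.1 x.2 = k} : ℤ) = c k := by omega
        rw [h0] at this
        exact_mod_cast this
      · rw [hα.const k hk, hα.const (k + 1) (by omega)] at h1
        have : (#{x ∈ μ.cells | F x.1 x.2 = k} : ℤ) = 0 := by omega
        rw [h0] at this
        rw [hc k hk]
        exact_mod_cast this
  · intro T _ α hα α' hα' h h'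
    have := h.counts_unique h' (hbd α hα) (hbd α' hα')
    funext n i
    have := congrFun (congrFun this n) i.rev
    simp only [Fin.rev_rev] at this
    omega
  · intro T _ T' _ α hα h h'
    ext i j
    by_cases hij : (i, j) ∈ μ.transpose
    · exact h.filling_unique hμ h' ((YoungDiagram.mem_transpose).1 hij)
    · rw [T.zeros hij, T'.zeros hij]

/-! ### Semi-infinite words and chains -/

/-- The position of a letter: the barred letters have negative positions, the unbarred letters
have the positions `0, 1, …`. -/
def position (b : Letter) : ℤ := if (b : ℤ) < 0 then b else b - 1

/-- The letter at a position. -/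
def letterAt (t : ℤ) : Letter :=
  if h : t < 0 then ⟨t, h.ne⟩ else ⟨t + 1, by omega⟩

theorem position_letterAt (t : ℤ) : position (letterAt t) = t := by
  rw [letterAt]
  split_ifs with h
  · exact if_pos h
  · rw [position, if_neg (by simp only; omega)]
    simp

theorem position_le_iff {b b' : Letter} : position b ≤ position b' ↔ b ≤ b' := by
  have h1 := b.2
  have h2 := b'.2
  rw [position, position, ← Subtype.coe_le_coe]
  split_ifs <;> omega

theorem position_injective : Function.Injective position := fun _ _ h =>
  le_antisymm (position_le_iff.1 h.le) (position_le_iff.1 h.ge)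

theorem deg_eq_zero_iff {b : Letter} : deg b = 0 ↔ position b < 0 := by
  have := b.2
  rw [deg, position]
  split_ifs <;> simp only [true_iff, false_iff] <;> omega

theorem deg_eq_one_iff {b : Letter} : deg b = 1 ↔ 0 ≤ position b := by
  have := b.2
  rw [deg, position]
  split_ifs <;> simp only [true_iff, false_iff] <;> omega

theorem position_barLetter (k : ℕ) : position (barLetter k) = -((k : ℤ) + 1) := by
  rw [position, barLetter, if_pos (by simp only; omega)]

theorem position_posLetter (k : ℕ) : position (posLetter k) = k := by
  rw [position, posLetter, if_neg (by simp only; omega)]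
  simp

/-- The word `w` has `M t` letters with position at least `t`. -/
def LetterCounts (w : ℕ → Letter) (M : ℤ → ℤ) : Prop :=
  ∀ t (k : ℕ), t ≤ position (w k) ↔ (k : ℤ) < M t

theorem HasCharge.position_eq {w : ℕ → Letter} {c : ℤ} (h : HasCharge w c) :
    ∃ K : ℕ, ∀ k : ℕ, K ≤ k → position (w k) = -((k : ℤ) + 1 + c) ∧ 0 < (k : ℤ) + 1 + c := by
  obtain ⟨K₀, hK₀⟩ := Filter.eventually_atTop.1 h
  refine ⟨max K₀ c.natAbs, fun k hk => ?_⟩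
  have h1 := hK₀ k (le_of_max_le_left hk)
  have h2 := le_of_max_le_right hk
  rw [position, if_pos (by omega)]
  omega

/-- The charge condition sends the positions to `-∞`, so the count is finite; as the word is
monotone, the counted indices form an initial segment. -/
theorem Word.exists_letterCounts (w : Word) :
    ∃ M : ℤ → ℤ, LetterCounts w.letter M ∧ ∀ t, 0 ≤ M t := by
  obtain ⟨c, hc⟩ := w.charged
  obtain ⟨K, hK⟩ := hc.position_eq
  have hfin : ∀ t, {k : ℕ | t ≤ position (w.letter k)}.Finite := by
    intro t
    refine (Set.finite_Iio (max K (-t - c).toNat)).subset fun k hk => ?_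
    rw [Set.mem_Iio]
    by_contra hcon
    have h1 := hK k (by omega)
    have h2 : t ≤ position (w.letter k) := hk
    omega
  refine ⟨fun t => (#(hfin t).toFinset : ℤ), fun t k => ?_, fun t => Int.natCast_nonneg _⟩
  simp only [Nat.cast_lt]
  rw [lt_card_iff_mem]
  · simp only [Set.Finite.mem_toFinset, Set.mem_ofPred_eq]
  · intro x hx y hy
    simp only [Set.Finite.mem_toFinset, Set.mem_ofPred_eq] at hx ⊢
    exact hx.trans (position_le_iff.2 (w.antitone hy))

section LetterCounts

variable {w w' : ℕ → Letter} {M M' : ℤ → ℤ}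

theorem LetterCounts.word_unique (h : LetterCounts w M) (h' : LetterCounts w' M) : w = w' := by
  funext k
  apply position_injective
  exact le_antisymm ((h' _ k).2 ((h _ k).1 le_rfl)) ((h _ k).2 ((h' _ k).1 le_rfl))

theorem LetterCounts.counts_unique (h : LetterCounts w M) (h' : LetterCounts w M')
    (h0 : ∀ t, 0 ≤ M t) (h0' : ∀ t, 0 ≤ M' t) : M = M' := by
  funext t
  exact le_antisymm (le_of_forall_nat_lt (h0' t) fun k hk => (h' t k).1 ((h t k).2 hk))
    (le_of_forall_nat_lt (h0 t) fun k hk => (h t k).1 ((h' t k).2 hk))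

theorem LetterCounts.succ_le (h : LetterCounts w M) (h0 : ∀ t, 0 ≤ M t) (t : ℤ) :
    M (t + 1) ≤ M t :=
  le_of_forall_nat_lt (h0 t) fun k hk => (h t k).1 (by have := (h (t + 1) k).2 hk; omega)

theorem LetterCounts.ncard (h : LetterCounts w M) (h0 : ∀ t, 0 ≤ M t) (b : Letter) :
    ({k : ℕ | w k = b}.ncard : ℤ) = M (position b) - M (position b + 1) := by
  have hset : {k : ℕ | w k = b} =
      ↑(Ico (M (position b + 1)).toNat (M (position b)).toNat) := by
    ext k
    simp only [Set.mem_ofPred_eq, coe_Ico, Set.mem_Ico, ← position_injective.eq_iff (a := w k)]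
    have h1 := h (position b) k
    have h2 := h (position b + 1) k
    have h3 := h0 (position b)
    have h4 := h0 (position b + 1)
    omega
  rw [hset, Set.ncard_coe_finset, Nat.card_Ico]
  have h1 := h.succ_le h0 (position b)
  have h2 := h0 (position b + 1)
  omega

/-- Far to the left every letter occurs once, and the letter at position `t` has index `-t - c - 1`.
-/
theorem LetterCounts.eq_of_hasCharge (h : LetterCounts w M) {c : ℤ}
    (hc : HasCharge w c) : ∃ T : ℤ, ∀ t ≤ T, M t = -t - c := by
  obtain ⟨K, hK⟩ := hc.position_eq
  refine ⟨-(K + 1 + c), fun t ht => ?_⟩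
  obtain ⟨k, hk⟩ : ∃ k : ℕ, (k : ℤ) = -t - c - 1 := ⟨(-t - c - 1).toNat, by omega⟩
  have h1 := hK k (by omega)
  have h2 := hK (k + 1) (by omega)
  have h3 := (h t k).1 (by omega)
  have h4 := (h t (k + 1)).not.1 (by push_cast at h2; omega)
  push_cast at h4
  omega

theorem LetterCounts.mult {w : Word} (h : LetterCounts w.letter M) (h0 : ∀ t, 0 ≤ M t)
    (b : Letter) : w.mult b =
      M (position b) - M (position b + 1) - if position b < 0 then 1 else 0 := by
  simp only [Word.mult, h.ncard h0 b, deg_eq_zero_iff]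

theorem LetterCounts.le_succ {w : Word} (h : LetterCounts w.letter M) (h0 : ∀ t, 0 ≤ M t)
    {t : ℤ} (ht : t < 0) : M t ≤ M (t + 1) + 1 := by
  suffices M t - 1 ≤ M (t + 1) by omega
  refine le_of_forall_nat_lt (h0 _) fun k hk => ?_
  have h1 := (h t (k + 1)).2 (by push_cast; omega)
  rw [← h (t + 1) k]
  by_contra hcon
  have h2 := position_le_iff.2 (w.weak k)
  have h3 := w.strict k (position_injective (by omega))
  rw [deg_eq_one_iff] at h3
  omega

end LetterCounts

theorem wt_snd_apply {u : ℕ} (w : Fin u → Word) (b : Letter) :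
    (wt w).2 b = ∑ i, (w i).mult b := by
  rw [wt, Prod.snd_sum, Finsupp.finsetSum_apply]
  rfl

theorem Word.mult_sign (w : Word) (b : Letter) :
    (deg b = 0 → w.mult b ≤ 0) ∧ (deg b = 1 → 0 ≤ w.mult b) := by
  obtain ⟨M, hM, h0⟩ := w.exists_letterCounts
  rw [hM.mult h0, deg_eq_zero_iff, deg_eq_one_iff]
  constructor
  · intro h
    have := hM.le_succ h0 h
    rw [if_pos h]
    omega
  · intro h
    have := hM.succ_le h0 (position b)
    rw [if_neg (by omega)]
    omega

/-- The exponents of the weights are non-positive at barred and non-negative at unbarred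
letters. -/
def HasWeightSigns (γ : Letter →₀ ℤ) : Prop :=
  ∀ b, (deg b = 0 → γ b ≤ 0) ∧ (deg b = 1 → 0 ≤ γ b)

theorem weightSpace_eq_empty {u : ℕ} (lam : GenPartition u) {γ : Letter →₀ ℤ}
    (hγ : ¬ HasWeightSigns γ) : weightSpace lam γ = ∅ := by
  rw [Set.eq_empty_iff_forall_notMem]
  rintro w ⟨-, rfl⟩
  refine hγ fun b => ?_
  rw [wt_snd_apply]
  exact ⟨fun h => sum_nonpos fun i _ => ((w i).mult_sign b).1 h,
    fun h => sum_nonneg fun i _ => ((w i).mult_sign b).2 h⟩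

/-- For a fixed letter the multiplicities in all words have the same sign, so they cannot cancel. -/
theorem mult_eq_zero {u : ℕ} {w : Fin u → Word} {b : Letter} (h : (wt w).2 b = 0) (i : Fin u) :
    (w i).mult b = 0 := by
  rw [wt_snd_apply] at h
  by_cases hb : deg b = 0
  · exact (sum_eq_zero_iff_of_nonpos fun i _ => ((w i).mult_sign b).1 hb).1 h i (mem_univ i)
  · have hb : deg b = 1 := by
      rw [deg_eq_one_iff]
      rw [deg_eq_zero_iff] at hb
      omega
    exact (sum_eq_zero_iff_of_nonneg fun i _ => ((w i).mult_sign b).2 hb).1 h i (mem_univ i)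

/-- The steps that correspond to the letters of the positions `-N, …, N-1`. -/
def wordSteps (N : ℕ) (γ : Letter →₀ ℤ) (n : ℕ) : StepKind :=
  if n < N then .vert (γ (letterAt (n - N))).natAbs else .horiz (γ (letterAt (n - N))).natAbs

/-- The letter counts of the `i`-th word that belongs to a chain. -/
def chainCounts {u : ℕ} (lam : GenPartition u) (N : ℕ) (α : ℕ → Fin u → ℤ) (i : Fin u) (t : ℤ) :
    ℤ :=
  -- Solves `α (t + N) i.rev = -(λ_i + M_i(t) + min t 0)` for `M_i(t)`. This normalisation vanishes
  -- at `t = -N`, where `M_i(t) = -t - λ_i`, and is `-λ_i` at `t = N`, where `M_i(t) = 0`.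
  -α (t + N).toNat i.rev - lam.1 i - min t 0

section Chain

variable {u : ℕ} {lam : GenPartition u} {N : ℕ} {γ : Letter →₀ ℤ} {α : ℕ → Fin u → ℤ}

theorem IsChain.step_vert (h : IsChain (wordSteps N γ) (2 * N) α) {t : ℤ} (h1 : -(N : ℤ) ≤ t)
    (h2 : t < 0) :
    IsStep (.vert (γ (letterAt t)).natAbs) (α (t + N).toNat) (α (t + 1 + N).toNat) := by
  have := h.step (t + N).toNat (by omega)
  rw [wordSteps, if_pos (by omega), show (((t + N).toNat : ℤ) - N) = t by omega,
    show (t + N).toNat + 1 = (t + 1 + N).toNat by omega] at this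
  exact this

theorem IsChain.step_horiz (h : IsChain (wordSteps N γ) (2 * N) α) {t : ℤ} (h1 : 0 ≤ t)
    (h2 : t < N) :
    IsStep (.horiz (γ (letterAt t)).natAbs) (α (t + N).toNat) (α (t + 1 + N).toNat) := by
  have := h.step (t + N).toNat (by omega)
  rw [wordSteps, if_neg (by omega), show (((t + N).toNat : ℤ) - N) = t by omega,
    show (t + N).toNat + 1 = (t + 1 + N).toNat by omega] at this
  exact this

theorem IsChain.antitone_apply {s : ℕ → StepKind} (h : IsChain s N α) (n : ℕ) :
    Antitone (α n) := by
  rcases le_or_gt N n with hn | hn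
  · rw [h.const n hn]
    exact h.antitone
  · rcases n with _ | n
    · rw [h.zero]
      exact fun _ _ _ => le_rfl
    · exact (h.step n (by omega)).antitone

theorem chainCounts_of_ge (h : IsChain (wordSteps N γ) (2 * N) α)
    (hα : α (2 * N) = lam.star.1) (i : Fin u) {t : ℤ} (ht : N ≤ t) :
    chainCounts lam N α i t = 0 := by
  rw [chainCounts, h.const _ (by omega), hα]
  simp only [GenPartition.star, Fin.rev_rev]
  omega

theorem chainCounts_of_le (h : IsChain (wordSteps N γ) (2 * N) α) (i : Fin u) {t : ℤ}
    (ht : t ≤ -(N : ℤ)) : chainCounts lam N α i t = -t - lam.1 i := by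
  rw [chainCounts, show (t + N).toNat = 0 by omega, h.zero]
  simp only [Pi.zero_apply]
  omega

theorem chainCounts_succ (h : IsChain (wordSteps N γ) (2 * N) α)
    (hα : α (2 * N) = lam.star.1) (i : Fin u) (t : ℤ) :
    chainCounts lam N α i (t + 1) ≤ chainCounts lam N α i t ∧
      (t < 0 → chainCounts lam N α i t ≤ chainCounts lam N α i (t + 1) + 1) := by
  rcases lt_or_ge t (-N) with h1 | h1
  · rw [chainCounts_of_le h i (by omega), chainCounts_of_le h i h1.le]
    omega
  rcases lt_or_ge t 0 with h2 | h2
  · have := (h.step_vert h1 h2).1 i.rev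
    simp only [chainCounts]
    omega
  rcases lt_or_ge t N with h3 | h3
  · have := (h.step_horiz h2 h3).1 i.rev
    simp only [chainCounts]
    omega
  · rw [chainCounts_of_ge h hα i (by omega), chainCounts_of_ge h hα i h3]
    omega

theorem chainCounts_antitone (h : IsChain (wordSteps N γ) (2 * N) α)
    (hα : α (2 * N) = lam.star.1) (i : Fin u) : Antitone (chainCounts lam N α i) :=
  antitone_int_of_succ_le fun t => (chainCounts_succ h hα i t).1

theorem chainCounts_nonneg (h : IsChain (wordSteps N γ) (2 * N) α)
    (hα : α (2 * N) = lam.star.1) (i : Fin u) (t : ℤ) : 0 ≤ chainCounts lam N α i t := by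
  rw [← chainCounts_of_ge h hα i (le_max_right t N)]
  exact chainCounts_antitone h hα i (le_max_left t N)

theorem sum_rev_eq (f : Fin u → ℤ) : ∑ i : Fin u, f i.rev = ∑ i, f i :=
  Equiv.sum_comp Fin.revPerm f

theorem sum_chainCounts_sub (hγ : HasWeightSigns γ)
    (hN : ∀ t : ℤ, t < -N ∨ N ≤ t → γ (letterAt t) = 0)
    (h : IsChain (wordSteps N γ) (2 * N) α) (hα : α (2 * N) = lam.star.1) (t : ℤ) :
    ∑ i, (chainCounts lam N α i t - chainCounts lam N α i (t + 1) - if t < 0 then 1 else 0) =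
      γ (letterAt t) := by
  have hsign := hγ (letterAt t)
  rw [deg_eq_zero_iff, deg_eq_one_iff, position_letterAt] at hsign
  rcases lt_or_ge t (-N) with h1 | h1
  · rw [hN t (Or.inl h1)]
    refine sum_eq_zero fun i _ => ?_
    rw [chainCounts_of_le h i h1.le, chainCounts_of_le h i (by omega), if_pos (by omega)]
    omega
  rcases lt_or_ge t 0 with h2 | h2
  · have h3 := (h.step_vert h1 h2).2.2
    have h4 : ∀ i ∈ (univ : Finset (Fin u)), chainCounts lam N α i t -
        chainCounts lam N α i (t + 1) - (if t < 0 then 1 else 0) =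
        α (t + 1 + N).toNat i.rev - α (t + N).toNat i.rev := fun i _ => by
      rw [if_pos h2, chainCounts, chainCounts, min_eq_left h2.le, min_eq_left (by omega)]
      ring
    rw [sum_congr rfl h4, sum_sub_distrib, sum_rev_eq, sum_rev_eq]
    have := hsign.1 h2
    omega
  rcases lt_or_ge t N with h3 | h3
  · have h4 := (h.step_horiz h2 h3).2.2
    have h5 : ∀ i ∈ (univ : Finset (Fin u)), chainCounts lam N α i t -
        chainCounts lam N α i (t + 1) - (if t < 0 then 1 else 0) =
        α (t + 1 + N).toNat i.rev - α (t + N).toNat i.rev := fun i _ => by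
      rw [if_neg (by omega), chainCounts, chainCounts, min_eq_right h2, min_eq_right (by omega)]
      ring
    rw [sum_congr rfl h5, sum_sub_distrib, sum_rev_eq, sum_rev_eq]
    have := hsign.2 h2
    omega
  · rw [hN t (Or.inr h3)]
    refine sum_eq_zero fun i _ => ?_
    rw [chainCounts_of_ge h hα i h3, chainCounts_of_ge h hα i (by omega), if_neg (by omega)]
    rfl

/-- The letter with index `k` sits at the greatest position `t` where the count still exceeds `k`.
-/
theorem exists_word (h : IsChain (wordSteps N γ) (2 * N) α) (hα : α (2 * N) = lam.star.1)
    (i : Fin u) : ∃ w : Word, LetterCounts w.letter (chainCounts lam N α i) ∧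
      HasCharge w.letter (lam.1 i) := by
  have hanti := chainCounts_antitone h hα i
  have hex : ∀ k : ℕ, ∃ t, (k : ℤ) < chainCounts lam N α i t ∧
      ∀ t', (k : ℤ) < chainCounts lam N α i t' → t' ≤ t := by
    intro k
    refine Int.exists_greatest_of_bdd ⟨N, fun t ht => ?_⟩
      ⟨min (-(N : ℤ)) (-k - 1 - lam.1 i), ?_⟩
    · by_contra hcon
      rw [chainCounts_of_ge h hα i (by omega)] at ht
      omega
    · rw [chainCounts_of_le h i (min_le_left _ _)]
      have := min_le_right (-(N : ℤ)) (-k - 1 - lam.1 i)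
      omega
  choose f hf hmax using hex
  have hcounts : LetterCounts (fun k => letterAt (f k)) (chainCounts lam N α i) := by
    intro t k
    rw [position_letterAt]
    exact ⟨fun ht => (hf k).trans_le (hanti ht), fun ht => hmax k t ht⟩
  have hcharge : HasCharge (fun k => letterAt (f k)) (lam.1 i) := by
    -- From this index on, both `t` and `t + 1` are at most `-N`, where the counts are known
    -- explicitly.
    refine Filter.eventually_atTop.2 ⟨(N - lam.1 i).toNat, fun k hk => ?_⟩
    set t : ℤ := -((k : ℤ) + 1 + lam.1 i) with ht
    have h1 := hcounts t k
    have h2 := hcounts (t + 1) k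
    rw [chainCounts_of_le h i (by omega), position_letterAt] at h1 h2
    have hft : f k = t := by omega
    simp only [hft, letterAt]
    split_ifs
    · rfl
    · omega
  refine ⟨⟨fun k => letterAt (f k), fun k => ?_, fun k hk => ?_, _, hcharge⟩, hcounts, hcharge⟩
  · rw [← position_le_iff, hcounts]
    have := (hcounts _ (k + 1)).1 le_rfl
    push_cast at this
    omega
  · rw [deg_eq_one_iff]
    by_contra hcon
    have h1 := (hcounts _ (k + 1)).1 le_rfl
    simp only [hk] at h1
    have h2 := (chainCounts_succ h hα i (position (letterAt (f k)))).2 (by omega)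
    have h3 := (hcounts (position (letterAt (f k)) + 1) k).2 (by push_cast at h1; omega)
    simp only at h3
    omega

end Chain

/-- Semi-infinite tableaux are chains of vertical and horizontal strips. -/
theorem ncard_weightSpace {u : ℕ} (lam : GenPartition u) {γ : Letter →₀ ℤ}
    (hγ : HasWeightSigns γ) {N : ℕ} (hN : ∀ t : ℤ, t < -N ∨ N ≤ t → γ (letterAt t) = 0) :
    (weightSpace lam γ).ncard = {α : ℕ → Fin u → ℤ | IsChain (wordSteps N γ) (2 * N) α ∧
      α (2 * N) = lam.star.1}.ncard ∧
    ({α : ℕ → Fin u → ℤ | IsChain (wordSteps N γ) (2 * N) α ∧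
      α (2 * N) = lam.star.1}.Finite → (weightSpace lam γ).Finite) := by
  refine ncard_eq_of_relation
    (fun w α => ∀ i, LetterCounts (w i).letter (chainCounts lam N α i)) ?_ ?_ ?_ ?_
  · rintro w ⟨⟨hcharge, hrow⟩, hwt⟩
    choose M hM h0 using fun i => (w i).exists_letterCounts
    have hmult : ∀ i (t : ℤ), t < -N ∨ N ≤ t → M i t - M i (t + 1) - (if t < 0 then 1 else 0) = 0 := by
      intro i t ht
      have := mult_eq_zero (w := w) (b := letterAt t) (by rw [hwt, hN t ht]) i
      rwa [(hM i).mult (h0 i), position_letterAt] at this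
    -- Below `-N` the multiplicities vanish, that is, each barred letter occurs exactly once in each
    -- word; this propagates the asymptotic value given by the charge up to `-N`.
    have hlow : ∀ i (t : ℤ), t ≤ -N → M i t = -t - lam.1 i := by
      intro i
      obtain ⟨T, hT⟩ := (hM i).eq_of_hasCharge (hcharge i)
      have hind : ∀ t, min T (-N) ≤ t → t ≤ -N → M i t = -t - lam.1 i := by
        intro t ht
        induction t, ht using Int.leInduction with
        | base => exact fun _ => hT _ (min_le_left _ _)
        | succ t ht ih =>
          intro htN
          have h1 := ih (by omega)
          have h2 := hmult i t (Or.inl (by omega))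
          rw [if_pos (by omega)] at h2
          omega
      intro t ht
      rcases le_total (min T (-N)) t with h | h
      · exact hind t h ht
      · exact hT t (h.trans (min_le_left _ _))
    have hhigh : ∀ i (t : ℤ), N ≤ t → M i t = 0 := by
      intro i t ht
      by_contra hcon
      have hpos : 0 < M i t := lt_of_le_of_ne (h0 i t) (Ne.symm hcon)
      have h1 := (hM i t 0).2 hpos
      have h2 := hmult i (position ((w i).letter 0)) (Or.inr (by omega))
      have h3 := (hM i (position ((w i).letter 0)) 0).1 le_rfl
      have h4 := (hM i (position ((w i).letter 0) + 1) 0).not.1 (by omega)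
      rw [if_neg (by omega)] at h2
      omega
    -- The weak condition between neighbouring words is dominance of the chain; strictness at
    -- unbarred letters, in `hrow2`, is the horizontal strip condition.
    have hrow1 : ∀ i j : Fin u, (i : ℕ) + 1 = j → ∀ t, lam.1 j + M j t ≤ lam.1 i + M i t := by
      intro i j hij t
      have hd := lam.2 (Fin.le_def.2 (by omega) : i ≤ j)
      suffices M j t - (lam.1 i - lam.1 j) ≤ M i t by omega
      refine le_of_forall_nat_lt (h0 i t) fun k hk => ?_
      have h1 := (hM j t (k + (lam.1 i - lam.1 j).toNat)).2 (by push_cast; omega)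
      exact (hM i t k).1 (h1.trans (position_le_iff.2 (hrow i j hij k).1))
    have hrow2 : ∀ i j : Fin u, (i : ℕ) + 1 = j → ∀ t, 0 ≤ t →
        lam.1 j + M j t ≤ lam.1 i + M i (t + 1) := by
      intro i j hij t ht
      have hd := lam.2 (Fin.le_def.2 (by omega) : i ≤ j)
      suffices M j t - (lam.1 i - lam.1 j) ≤ M i (t + 1) by omega
      refine le_of_forall_nat_lt (h0 i _) fun k hk => ?_
      have h1 := (hM j t (k + (lam.1 i - lam.1 j).toNat)).2 (by push_cast; omega)
      obtain ⟨h2, h3⟩ := hrow i j hij k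
      have h2 := position_le_iff.2 h2
      rw [deg_eq_zero_iff] at h3
      refine (hM i (t + 1) k).1 ?_
      by_contra hcon
      have := h3 (position_injective (by omega))
      omega
    have hsum : ∀ t, ∑ i, (M i t - M i (t + 1) - if t < 0 then 1 else 0) = γ (letterAt t) := by
      intro t
      rw [← hwt, wt_snd_apply]
      refine sum_congr rfl fun i _ => ?_
      rw [(hM i).mult (h0 i), position_letterAt]
    have hsign : ∀ t, (t < 0 → γ (letterAt t) ≤ 0) ∧ (0 ≤ t → 0 ≤ γ (letterAt t)) := by
      intro t
      have := hγ (letterAt t)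
      rwa [deg_eq_zero_iff, deg_eq_one_iff, position_letterAt] at this
    refine ⟨fun n i => -(lam.1 i.rev + M i.rev (n - N) + min ((n : ℤ) - N) 0),
      ⟨⟨?_, fun n hn => ?_, fun n hn => ?_⟩, ?_⟩, fun i => ?_⟩
    · funext i
      simp only [Nat.cast_zero, zero_sub, Pi.zero_apply]
      rw [hlow i.rev _ le_rfl]
      omega
    · have hcast : ((n + 1 : ℕ) : ℤ) - N = n - N + 1 := by
        push_cast
        ring
      obtain ⟨G, hG⟩ : ∃ G : Fin u → ℤ, ∀ i, G i =
          M i (n - N) - M i (n - N + 1) - if (n : ℤ) - N < 0 then 1 else 0 := ⟨_, fun _ => rfl⟩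
      rw [wordSteps]
      split_ifs with h
      · have hs := (hsign (n - N)).1 (by omega)
        refine ⟨fun i => ?_, antitone_of_succ fun i j hij => ?_, ?_⟩
        · have h1 := (hM i.rev).le_succ (h0 i.rev) (t := n - N) (by omega)
          have h2 := (hM i.rev).succ_le (h0 i.rev) (n - N)
          simp only [hcast]
          omega
        · have h1 := hrow1 j.rev i.rev (by rw [Fin.val_rev, Fin.val_rev]; omega) (n - N + 1)
          simp only [hcast]
          omega
        · rw [← sub_eq_iff_eq_add', ← sum_sub_distrib]
          have h1 : ∀ i ∈ (univ : Finset (Fin u)),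
              -(lam.1 i.rev + M i.rev (n - N) + min ((n : ℤ) - N) 0) -
              -(lam.1 i.rev + M i.rev ((n + 1 : ℕ) - N) + min (((n + 1 : ℕ) : ℤ) - N) 0) =
              -G i.rev := fun i _ => by
            rw [hG, hcast, if_pos (by omega)]
            omega
          rw [sum_congr rfl h1, sum_neg_distrib, sum_rev_eq, sum_congr rfl fun i _ => hG i, hsum]
          omega
      · have hs := (hsign (n - N)).2 (by omega)
        refine ⟨fun i => ?_, fun i j hij => ?_, ?_⟩
        · have h2 := (hM i.rev).succ_le (h0 i.rev) (n - N)
          simp only [hcast]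
          omega
        · have h1 := hrow2 j.rev i.rev (by rw [Fin.val_rev, Fin.val_rev]; omega) (n - N)
            (by omega)
          simp only [hcast]
          omega
        · rw [← sub_eq_iff_eq_add', ← sum_sub_distrib]
          have h1 : ∀ i ∈ (univ : Finset (Fin u)),
              -(lam.1 i.rev + M i.rev ((n + 1 : ℕ) - N) + min (((n + 1 : ℕ) : ℤ) - N) 0) -
              -(lam.1 i.rev + M i.rev (n - N) + min ((n : ℤ) - N) 0) =
              G i.rev := fun i _ => by
            rw [hG, hcast, if_neg (by omega)]
            omega
          rw [sum_congr rfl h1, sum_rev_eq, sum_congr rfl fun i _ => hG i, hsum]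
          omega
    · funext i
      rw [hhigh i.rev _ (by omega), hhigh i.rev _ (by push_cast; omega)]
      push_cast
      omega
    · funext i
      simp only [GenPartition.star]
      rw [hhigh i.rev _ (by push_cast; omega)]
      push_cast
      omega
    · have : chainCounts lam N (fun n i => -(lam.1 i.rev + M i.rev (n - N) +
          min ((n : ℤ) - N) 0)) i = M i := by
        funext t
        simp only [chainCounts, Fin.rev_rev]
        rcases le_total t (-N) with ht | ht
        · rw [show (t + N).toNat = 0 by omega, Nat.cast_zero, zero_sub, hlow i _ le_rfl,
            hlow i t ht]
          omega
        · rw [show (((t + N).toNat : ℕ) : ℤ) - N = t by omega]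
          omega
      rw [this]
      exact hM i
  · rintro α ⟨h, hα⟩
    choose w hw hcharge using exists_word h hα
    refine ⟨w, ⟨⟨hcharge, fun i j hij k => ?_⟩, ?_⟩, hw⟩
    · have hd := lam.2 (Fin.le_def.2 (by omega) : i ≤ j)
      have hrev : j.rev ≤ i.rev := Fin.rev_le_rev.2 (Fin.le_def.2 (by omega))
      set t := position ((w j).letter (k + (lam.1 i - lam.1 j).toNat)) with ht
      have h1 := (hw j t (k + (lam.1 i - lam.1 j).toNat)).1 le_rfl
      push_cast at h1
      have h2 := h.antitone_apply (t + N).toNat hrev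
      have h3 : (k : ℤ) < chainCounts lam N α i t := by
        simp only [chainCounts] at h1 ⊢
        omega
      refine ⟨position_le_iff.1 ((hw i t k).2 h3), fun heq => ?_⟩
      rw [deg_eq_zero_iff, heq, ← ht]
      -- Equal unbarred letters at position `t` contradict the horizontal strip condition, which
      -- puts the letter of the upper word at position at least `t + 1`; for `t ≥ N` there are no
      -- letters at all.
      by_contra hcon
      rcases lt_or_ge t N with htN | htN
      · have h4 := (h.step_horiz (by omega) htN).2.1 j.rev i.rev
          (by rw [Fin.val_rev, Fin.val_rev]; omega)
        have h5 := (hw i (t + 1) k).2 (by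
          simp only [chainCounts] at h1 ⊢
          omega)
        rw [heq, ← ht] at h5
        omega
      · rw [chainCounts_of_ge h hα j htN] at h1
        omega
    · ext b
      rw [wt_snd_apply, ← position_injective (position_letterAt (position b)),
        ← sum_chainCounts_sub hγ hN h hα]
      refine sum_congr rfl fun i _ => ?_
      rw [(hw i).mult (chainCounts_nonneg h hα i), position_letterAt]
  · rintro w - α ⟨h, hα⟩ α' ⟨h', hα'⟩ hw hw'
    funext n i
    have := congrFun ((hw i.rev).counts_unique (hw' i.rev) (chainCounts_nonneg h hα _)
      (chainCounts_nonneg h' hα' _)) (n - N)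
    simp only [chainCounts, Fin.rev_rev, sub_add_cancel, Int.toNat_natCast] at this
    omega
  · rintro w - w' - α - hw hw'
    funext i
    exact Word.ext ((hw i).word_unique (hw' i))

/-! ### Expansions in Schur functions -/

/-- The content determines the size of the shape; this makes the sums over partitions finite. -/
theorem card_eq_of_mem_ssytWithContent {ν : YoungDiagram} {c : ℕ → ℕ} {N : ℕ}
    (hc : ∀ n, N ≤ n → c n = 0) {T : SemistandardYoungTableau ν} (hT : T ∈ ssytWithContent ν c) :
    ν.card = ∑ k ∈ range N, c k := by
  have hmaps : ∀ x ∈ ν.cells, T x.1 x.2 ∈ range N := by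
    intro x hx
    rw [mem_range]
    by_contra hcon
    have h := (hT (T x.1 x.2)).trans (hc _ (not_lt.1 hcon))
    rw [card_eq_zero] at h
    exact notMem_empty x (h ▸ mem_filter.2 ⟨hx, rfl⟩)
  rw [YoungDiagram.card, card_eq_sum_card_fiberwise hmaps]
  exact sum_congr rfl fun k _ => hT k

theorem finite_setOf_card_eq (m : ℕ) : {ν : YoungDiagram | ν.card = m}.Finite := by
  refine Set.Finite.of_finite_image (f := YoungDiagram.cells)
    ((finite_toSet (range m ×ˢ range m).powerset).subset ?_)
    (fun ν _ ν' _ h => YoungDiagram.ext h)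
  rintro _ ⟨ν, rfl, rfl⟩
  rw [mem_coe, mem_powerset]
  rintro ⟨i, j⟩ hij
  rw [YoungDiagram.mem_cells] at hij
  rw [mem_product, mem_range, mem_range]
  constructor
  · refine (YoungDiagram.mem_iff_lt_colLen.1 hij).trans_le ?_
    rw [YoungDiagram.colLen_eq_card]
    exact card_le_card (filter_subset _ _)
  · refine (YoungDiagram.mem_iff_lt_rowLen.1 hij).trans_le ?_
    rw [YoungDiagram.rowLen_eq_card]
    exact card_le_card (filter_subset _ _)

theorem exists_youngDiagram {u : ℕ} {v : Fin u → ℤ} (hv : Antitone v) (h0 : ∀ i, 0 ≤ v i) :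
    ∃ ν : YoungDiagram, ν.colLen 0 ≤ u ∧ (GenPartition.ofPartition u ν).1 = v := by
  let ν : YoungDiagram :=
    { cells := (univ.sigma fun i : Fin u => range (v i).toNat).image fun x => ((x.1 : ℕ), x.2)
      isLowerSet := by
        rintro ⟨i, j⟩ ⟨i', j'⟩ hle hx
        have hle1 : i' ≤ i := hle.1
        have hle2 : j' ≤ j := hle.2
        rw [mem_coe, mem_image] at hx ⊢
        obtain ⟨⟨a, b⟩, hab, heq⟩ := hx
        rw [Prod.mk.injEq] at heq
        obtain ⟨rfl, rfl⟩ := heq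
        have hb := mem_range.1 (mem_sigma.1 hab).2
        have ha := hv (Fin.le_def.2 hle1 : (⟨i', hle1.trans_lt a.2⟩ : Fin u) ≤ a)
        exact ⟨⟨⟨i', hle1.trans_lt a.2⟩, j'⟩, mem_sigma.2 ⟨mem_univ _,
          mem_range.2 (hle2.trans_lt (hb.trans_le (Int.toNat_le_toNat ha)))⟩, rfl⟩ }
  have hmem : ∀ i j, (i, j) ∈ ν ↔ ∃ h : i < u, (j : ℤ) < v ⟨i, h⟩ := by
    intro i j
    rw [← YoungDiagram.mem_cells]
    simp only [ν, mem_image, mem_sigma, mem_univ, true_and, mem_range, Prod.mk.injEq]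
    constructor
    · rintro ⟨⟨a, b⟩, hab, rfl, rfl⟩
      exact ⟨a.2, Int.lt_toNat.1 hab⟩
    · rintro ⟨h, hj⟩
      exact ⟨⟨⟨i, h⟩, j⟩, Int.lt_toNat.2 hj, rfl, rfl⟩
  refine ⟨ν, ?_, funext fun i => ?_⟩
  · by_contra hcon
    have := (hmem u 0).1 (YoungDiagram.mem_iff_lt_colLen.2 (not_le.1 hcon))
    exact lt_irrefl _ this.1
  · have key : ∀ j : ℕ, j < ν.rowLen i ↔ (j : ℤ) < v i := fun j => by
      rw [← YoungDiagram.mem_iff_lt_rowLen, hmem]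
      exact ⟨fun h => h.2, fun h => ⟨i.2, h⟩⟩
    refine le_antisymm (le_of_forall_nat_lt (h0 i) fun j hj => (key j).1 (Nat.cast_lt.1 hj))
      (le_of_forall_nat_lt (Int.natCast_nonneg _) fun j hj => Nat.cast_lt.2 ((key j).2 hj))

theorem ofPartition_injOn {u : ℕ} {μ ν : YoungDiagram} (hμ : μ.colLen 0 ≤ u)
    (hν : ν.colLen 0 ≤ u)
    (h : GenPartition.ofPartition u μ = GenPartition.ofPartition u ν) : μ = ν := by
  ext ⟨i, j⟩
  rw [YoungDiagram.mem_cells, YoungDiagram.mem_cells]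
  by_cases hi : i < u
  · have : (μ.rowLen i : ℤ) = ν.rowLen i :=
      congrFun (congrArg Subtype.val h) (⟨i, hi⟩ : Fin u)
    rw [YoungDiagram.mem_iff_lt_rowLen, YoungDiagram.mem_iff_lt_rowLen]
    omega
  · exact ⟨fun h => absurd (row_lt_of_mem hμ h) hi, fun h => absurd (row_lt_of_mem hν h) hi⟩

theorem star_star {u : ℕ} (κ : GenPartition u) : κ.star.star = κ := by
  apply Subtype.ext
  funext i
  simp only [GenPartition.star, Fin.rev_rev, neg_neg]

/-- Grouping chains by their last element. -/
theorem prod_poly_eq_sum {u : ℕ} (s : ℕ → StepKind) (N : ℕ) (f : YoungDiagram → GenPartition u)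
    (F : Finset YoungDiagram)
    (hinj : ∀ μ ν : YoungDiagram, μ.colLen 0 ≤ u → ν.colLen 0 ≤ u → f μ = f ν → μ = ν)
    (hF : ∀ α, IsChain s N α → ∃ μ ∈ F, μ.colLen 0 ≤ u ∧ (f μ).1 = α N) :
    ∏ n ∈ range N, (s n).poly u =
      ∑ μ ∈ F, {α : ℕ → Fin u → ℤ | IsChain s N α ∧ α N = (f μ).1}.ncard •
        if μ.colLen 0 ≤ u then rationalSchur (f μ) else 0 := by
  classical
  obtain ⟨C, hC, hsum⟩ := exists_chains (u := u) s N
  choose! m hmF hmu hm using hF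
  have hP := eq_sum_rationalSchur C (fun α => f (m α)) (hsum.trans (sum_congr rfl fun α hα => by
    rw [hm α ((hC α).1 hα)]))
  rw [hP, ← sum_fiberwise_of_maps_to (g := m) (fun α hα => hmF α ((hC α).1 hα))]
  refine sum_congr rfl fun μ _ => ?_
  rw [sum_congr rfl (g := fun _ => rationalSchur (f μ)) fun α hα => by rw [(mem_filter.1 hα).2],
    sum_const]
  split_ifs with hμ
  · congr 1
    rw [← Set.ncard_coe_finset]
    congr 1
    ext α
    simp only [coe_filter, Set.mem_ofPred_eq, hC]
    refine and_congr_right fun hα => ⟨fun h => by rw [← hm α hα, h], fun h => ?_⟩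
    exact hinj _ _ (hmu α hα) hμ (Subtype.ext ((hm α hα).trans h))
  · have : {α ∈ C | m α = μ} = ∅ := by
      rw [filter_eq_empty_iff]
      rintro α hα rfl
      exact hμ (hmu α ((hC α).1 hα))
    rw [this, card_empty, zero_smul, smul_zero]

theorem ncard_chains_ne_zero {u : ℕ} {s : ℕ → StepKind} {N : ℕ} {α : ℕ → Fin u → ℤ}
    (hα : IsChain s N α) (κ : GenPartition u) (h : α N = κ.1) :
    {α : ℕ → Fin u → ℤ | IsChain s N α ∧ α N = κ.1}.ncard ≠ 0 :=
  (Set.ncard_pos (finite_chains s N κ).1).2 ⟨α, hα, h⟩ |>.ne'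

/-- A product of complete symmetric polynomials in terms of Schur polynomials. -/
theorem prod_horiz_eq_sum (u : ℕ) {c : ℕ → ℕ} {N : ℕ} (hc : ∀ n, N ≤ n → c n = 0) :
    ∏ n ∈ range N, (StepKind.horiz (c n)).poly u =
      ∑ ν ∈ (finite_setOf_card_eq (∑ k ∈ range N, c k)).toFinset,
        (ssytWithContent ν c).ncard • schurY u ν := by
  rw [prod_poly_eq_sum (fun n => .horiz (c n)) N (GenPartition.ofPartition u) _
    (fun _ _ hμ hν h => ofPartition_injOn hμ hν h)]
  · refine sum_congr rfl fun ν _ => ?_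
    rw [schurY]
    split_ifs with hν
    · rw [ncard_ssytWithContent_eq_horiz hν hc]
    · rw [smul_zero, smul_zero]
  · intro α hα
    have hmono : ∀ i, Monotone fun n => α n i := fun i =>
      monotone_nat_of_le_succ fun n => chain_monotone_horiz hα n i
    obtain ⟨ν, hν, hνα⟩ := exists_youngDiagram hα.antitone fun i => by
      have := hmono i (Nat.zero_le N)
      simp only [hα.zero, Pi.zero_apply] at this
      exact this
    refine ⟨ν, ?_, hν, hνα⟩
    -- The chain gives rise to a tableau of shape `ν` with content `c`, from which the size of `ν`
    -- is read off.
    have hne := ncard_chains_ne_zero hα _ hνα.symm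
    rw [← ncard_ssytWithContent_eq_horiz hν hc] at hne
    obtain ⟨T, hT⟩ := Set.nonempty_of_ncard_ne_zero hne
    rw [Set.Finite.mem_toFinset]
    exact card_eq_of_mem_ssytWithContent hc hT

theorem card_transpose (μ : YoungDiagram) : μ.transpose.card = μ.card := by
  rw [YoungDiagram.card, YoungDiagram.card]
  refine card_bij (fun x _ => x.swap) (fun x hx => ?_) (fun x _ y _ h => Prod.swap_injective h)
    (fun x hx => ⟨x.swap, ?_, Prod.swap_swap x⟩)
  · rwa [YoungDiagram.mem_cells, YoungDiagram.mem_transpose, ← YoungDiagram.mem_cells] at hx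
  · rwa [YoungDiagram.mem_cells, YoungDiagram.mem_transpose, Prod.swap_swap,
      ← YoungDiagram.mem_cells]

/-- A product of elementary symmetric polynomials in terms of dual Schur polynomials. -/
theorem prod_vert_eq_sum (u : ℕ) {c : ℕ → ℕ} {N : ℕ} (hc : ∀ n, N ≤ n → c n = 0) :
    ∏ n ∈ range N, (StepKind.vert (c n)).poly u =
      ∑ μ ∈ (finite_setOf_card_eq (∑ k ∈ range N, c k)).toFinset,
        (ssytWithContent μ.transpose c).ncard • schurYStar u μ := by
  rw [prod_poly_eq_sum (fun n => .vert (c n)) N (fun μ => (GenPartition.ofPartition u μ).star) _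
    (fun _ _ hμ hν h => ofPartition_injOn hμ hν
      (by rw [← star_star (GenPartition.ofPartition u _), h, star_star]))]
  · refine sum_congr rfl fun μ _ => ?_
    rw [schurYStar]
    split_ifs with hμ
    · rw [ncard_ssytWithContent_transpose_eq_vert hμ hc]
    · rw [smul_zero, smul_zero]
  · intro α hα
    have hanti : ∀ i, Antitone fun n => α n i := fun i =>
      antitone_nat_of_succ_le fun n => chain_antitone_vert hα n i
    obtain ⟨μ, hμ, hμα⟩ := exists_youngDiagram
      (GenPartition.star ⟨α N, hα.antitone⟩).2 fun i => by
        have := hanti i.rev (Nat.zero_le N)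
        simp only [hα.zero, Pi.zero_apply] at this
        simp only [GenPartition.star]
        omega
    have hμα : (GenPartition.ofPartition u μ).star.1 = α N := by
      rw [Subtype.ext hμα, star_star]
    refine ⟨μ, ?_, hμ, hμα⟩
    have hne := ncard_chains_ne_zero hα _ hμα.symm
    rw [← ncard_ssytWithContent_transpose_eq_vert hμ hc] at hne
    obtain ⟨T, hT⟩ := Set.nonempty_of_ncard_ne_zero hne
    rw [Set.Finite.mem_toFinset, Set.mem_ofPred_eq, ← card_transpose]
    exact card_eq_of_mem_ssytWithContent hc hT

/-! ### Coefficients of products of Schur functions -/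

open Classical in
theorem coeff_schur {σ : Type} {v : ℕ → σ} (hv : Function.Injective v) (ν : YoungDiagram)
    (n : σ →₀ ℕ) : MvPowerSeries.coeff n (schur v ν) =
      if ∀ b, b ∉ Set.range v → n b = 0 then ((ssytWithContent ν fun k => n (v k)).ncard : ℤ)
      else 0 := by
  have happ : ∀ (T : SemistandardYoungTableau ν) b,
      (∑ c ∈ ν.cells, Finsupp.single (v (T c.1 c.2)) 1 : σ →₀ ℕ) b =
        #{c ∈ ν.cells | v (T c.1 c.2) = b} := fun T b => by
    rw [Finsupp.finsetSum_apply, card_filter]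
    exact sum_congr rfl fun c _ => Finsupp.single_apply
  have hcoeff : MvPowerSeries.coeff n (schur v ν) = (Nat.card {T : SemistandardYoungTableau ν //
    ∑ c ∈ ν.cells, Finsupp.single (v (T c.1 c.2)) 1 = n} : ℤ) := rfl
  rw [hcoeff]
  have hset : {T : SemistandardYoungTableau ν |
      ∑ c ∈ ν.cells, Finsupp.single (v (T c.1 c.2)) 1 = n}.ncard =
      Nat.card {T : SemistandardYoungTableau ν //
        ∑ c ∈ ν.cells, Finsupp.single (v (T c.1 c.2)) 1 = n} := rfl
  rw [← hset]
  split_ifs with h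
  · congr 2
    ext T
    simp only [ssytWithContent, Set.mem_ofPred_eq, Finsupp.ext_iff, happ]
    constructor
    · intro hT k
      rw [← hT (v k)]
      simp only [hv.eq_iff]
    · intro hT b
      by_cases hb : b ∈ Set.range v
      · obtain ⟨k, rfl⟩ := hb
        rw [← hT k]
        simp only [hv.eq_iff]
      · rw [h b hb, card_eq_zero, filter_eq_empty_iff]
        exact fun c _ hc => hb ⟨_, hc⟩
  · rw [Nat.cast_eq_zero]
    refine (congrArg Set.ncard ?_).trans (Set.ncard_empty _)
    rw [Set.eq_empty_iff_forall_notMem]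
    rintro T rfl
    refine h fun b hb => ?_
    rw [happ, card_eq_zero, filter_eq_empty_iff]
    exact fun c _ hc => hb ⟨_, hc⟩

theorem mem_range_barLetter {b : Letter} : b ∈ Set.range barLetter ↔ deg b = 0 := by
  rw [deg_eq_zero_iff]
  constructor
  · rintro ⟨k, rfl⟩
    rw [position_barLetter]
    omega
  · intro h
    exact ⟨(-position b - 1).toNat, position_injective (by rw [position_barLetter]; omega)⟩

theorem mem_range_posLetter {b : Letter} : b ∈ Set.range posLetter ↔ ¬ deg b = 0 := by
  rw [deg_eq_zero_iff]
  constructor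
  · rintro ⟨k, rfl⟩
    rw [position_posLetter]
    omega
  · intro h
    exact ⟨(position b).toNat, position_injective (by rw [position_posLetter]; omega)⟩

theorem barLetter_injective : Function.Injective barLetter := fun k k' h => by
  have := congrArg position h
  rw [position_barLetter, position_barLetter] at this
  omega

theorem posLetter_injective : Function.Injective posLetter := fun k k' h => by
  have := congrArg position h
  rw [position_posLetter, position_posLetter] at this
  omega

/-- The two alphabets are disjoint, so the only splitting of `n` that contributes is the one by
degree. -/
theorem coeff_schur_mul_schur (μ ν : YoungDiagram) (n : Letter →₀ ℕ) :
    MvPowerSeries.coeff n (schur barLetter μ * schur posLetter ν) =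
      ((ssytWithContent μ fun k => n (barLetter k)).ncard : ℤ) *
        (ssytWithContent ν fun k => n (posLetter k)).ncard := by
  classical
  have hbar : ∀ k, deg (barLetter k) = 0 := fun k => mem_range_barLetter.1 ⟨k, rfl⟩
  have hpos : ∀ k, ¬ deg (posLetter k) = 0 := fun k => mem_range_posLetter.1 ⟨k, rfl⟩
  rw [MvPowerSeries.coeff_mul, sum_eq_single
    (n.filter fun b => deg b = 0, n.filter fun b => ¬ deg b = 0)]
  · rw [coeff_schur barLetter_injective, coeff_schur posLetter_injective, if_pos, if_pos]
    · simp only [Finsupp.filter_apply_pos (fun b => deg b = 0) n (hbar _),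
        Finsupp.filter_apply_pos (fun b => ¬ deg b = 0) n (hpos _)]
    · intro b hb
      rw [mem_range_posLetter] at hb
      exact Finsupp.filter_apply_neg _ _ hb
    · intro b hb
      rw [mem_range_barLetter] at hb
      exact Finsupp.filter_apply_neg _ _ hb
  · rintro ⟨p, q⟩ hpq hne
    rw [coeff_schur barLetter_injective, coeff_schur posLetter_injective]
    split_ifs with h1 h2
    · refine absurd ?_ hne
      rw [HasAntidiagonal.mem_antidiagonal] at hpq
      simp only at hpq h1 h2
      subst hpq
      rw [Prod.mk.injEq]
      constructor <;> ext b <;> by_cases hb : deg b = 0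
      · rw [Finsupp.filter_apply_pos (fun b => deg b = 0) _ hb, Finsupp.add_apply,
          h2 b (by rw [mem_range_posLetter]; exact not_not.2 hb), add_zero]
      · rw [Finsupp.filter_apply_neg (fun b => deg b = 0) _ hb,
          h1 b (by rwa [mem_range_barLetter])]
      · rw [Finsupp.filter_apply_neg (fun b => ¬ deg b = 0) _ (not_not.2 hb),
          h2 b (by rw [mem_range_posLetter]; exact not_not.2 hb)]
      · rw [Finsupp.filter_apply_pos (fun b => ¬ deg b = 0) _ hb, Finsupp.add_apply,
          h1 b (by rwa [mem_range_barLetter]), zero_add]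
    · rw [mul_zero]
    · rw [zero_mul]
    · rw [zero_mul]
  · intro h
    refine absurd ?_ h
    rw [HasAntidiagonal.mem_antidiagonal]
    exact Finsupp.filter_add_filter_not _ _

theorem schurProduct_apply (μ ν : YoungDiagram) {γ : Letter →₀ ℤ} (hγ : HasWeightSigns γ) :
    schurProduct μ ν γ =
      ((ssytWithContent μ.transpose fun k => (γ (barLetter k)).natAbs).ncard : ℤ) *
        (ssytWithContent ν fun k => (γ (posLetter k)).natAbs).ncard := by
  rw [schurProduct, toFormalSeries]
  exact (if_pos hγ).trans (coeff_schur_mul_schur _ _ _)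

theorem schurProduct_of_not_signs (μ ν : YoungDiagram) {γ : Letter →₀ ℤ}
    (hγ : ¬ HasWeightSigns γ) : schurProduct μ ν γ = 0 := by
  rw [schurProduct, toFormalSeries]
  exact if_neg hγ

/-! ### Littlewood–Richardson coefficients -/

theorem schurCoeff_sum {u : ℕ} (n : GenPartition u →₀ ℕ) (κ : GenPartition u) :
    schurCoeff κ (n.sum fun ν m => m • rationalSchur ν) = n κ := by
  classical
  rw [Finsupp.sum, map_sum]
  simp only [map_nsmul, schurCoeff_rationalSchur]
  simp only [nsmul_eq_mul, mul_ite, mul_one, mul_zero]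
  rw [sum_ite_eq']
  split_ifs with h
  · rfl
  · rw [Finsupp.notMem_support_iff.1 h, Nat.cast_zero]

/-- Gives uniqueness, and replaces `N` by a functional that is additive in the product. -/
theorem IsLRCoefficients.eq_schurCoeff {u : ℕ}
    {N : YoungDiagram → YoungDiagram → GenPartition u →₀ ℕ} (hN : IsLRCoefficients u N)
    (μ ν : YoungDiagram) (κ : GenPartition u) :
    (N μ ν κ : ℤ) = schurCoeff κ (schurYStar u μ * schurY u ν) := by
  rw [hN μ ν, schurCoeff_sum]

theorem existsUnique_isLRCoefficients (u : ℕ) :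
    ∃! N : YoungDiagram → YoungDiagram → GenPartition u →₀ ℕ, IsLRCoefficients u N := by
  have hex : ∀ μ ν : YoungDiagram, ∃ n : GenPartition u →₀ ℕ,
      schurYStar u μ * schurY u ν = n.sum fun κ m => m • rationalSchur κ := by
    intro μ ν
    rw [schurYStar, schurY]
    split_ifs
    · exact exists_rationalSchur_mul _ _
    · exact ⟨0, by rw [mul_zero, Finsupp.sum_zero_index]⟩
    · exact ⟨0, by rw [zero_mul, Finsupp.sum_zero_index]⟩
    · exact ⟨0, by rw [zero_mul, Finsupp.sum_zero_index]⟩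
  choose N hN using hex
  refine ⟨N, hN, fun N' hN' => ?_⟩
  funext μ ν
  ext κ
  have h1 := IsLRCoefficients.eq_schurCoeff hN μ ν κ
  have h2 := IsLRCoefficients.eq_schurCoeff hN' μ ν κ
  omega

/-! ### The character formula -/

theorem exists_support_bound (γ : Letter →₀ ℤ) :
    ∃ N : ℕ, ∀ t : ℤ, t < -N ∨ N ≤ t → γ (letterAt t) = 0 := by
  refine ⟨γ.support.sup fun b => (position b).natAbs + 1, fun t ht => ?_⟩
  by_contra hcon
  have h := le_sup (f := fun b => (position b).natAbs + 1) (Finsupp.mem_support_iff.2 hcon)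
  simp only [position_letterAt] at h
  omega

theorem letterAt_neg (k : ℕ) : letterAt (-((k : ℤ) + 1)) = barLetter k :=
  position_injective (by rw [position_letterAt, position_barLetter])

theorem letterAt_natCast (k : ℕ) : letterAt k = posLetter k :=
  position_injective (by rw [position_letterAt, position_posLetter])

theorem prod_wordSteps (u N : ℕ) (γ : Letter →₀ ℤ) :
    ∏ n ∈ range (2 * N), (wordSteps N γ n).poly u =
      (∏ k ∈ range N, (StepKind.vert (γ (barLetter k)).natAbs).poly u) *
        ∏ k ∈ range N, (StepKind.horiz (γ (posLetter k)).natAbs).poly u := by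
  rw [two_mul, prod_range_add]
  congr 1
  -- Chains read barred letters upwards from the position `-N`, whereas `barLetter` enumerates them
  -- downwards from `-1`.
  · rw [← prod_range_reflect]
    refine prod_congr rfl fun k hk => ?_
    have hk := mem_range.1 hk
    rw [wordSteps, if_pos (by omega), ← letterAt_neg]
    congr 5
    omega
  · refine prod_congr rfl fun k _ => ?_
    rw [wordSteps, if_neg (by omega), ← letterAt_natCast]
    congr 5
    push_cast
    ring

theorem finite_weightSpace {u : ℕ} (lam : GenPartition u) (γ : Letter →₀ ℤ) :
    (weightSpace lam γ).Finite := by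
  by_cases hγ : HasWeightSigns γ
  · obtain ⟨N, hN⟩ := exists_support_bound γ
    exact (ncard_weightSpace lam hγ hN).2 (finite_chains _ _ _).1
  · rw [weightSpace_eq_empty lam hγ]
    exact Set.finite_empty

theorem hasSum_ch {u : ℕ} {N : YoungDiagram → YoungDiagram → GenPartition u →₀ ℕ}
    (hN : IsLRCoefficients u N) (lam : GenPartition u) :
    HasSum (fun p : YoungDiagram × YoungDiagram => N p.1 p.2 lam.star • schurProduct p.1 p.2)
      (ch lam) := by
  refine Pi.hasSum.2 fun γ => ?_
  by_cases hγ : HasWeightSigns γ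
  swap
  · have h1 : ch lam γ = 0 := by rw [ch, weightSpace_eq_empty lam hγ, Set.ncard_empty, Nat.cast_zero]
    have h2 : (fun p : YoungDiagram × YoungDiagram =>
        (N p.1 p.2 lam.star • schurProduct p.1 p.2) γ) = fun _ => 0 := funext fun p => by
      rw [Pi.smul_apply, schurProduct_of_not_signs _ _ hγ, smul_zero]
    rw [h1, h2]
    exact hasSum_zero
  obtain ⟨K, hK⟩ := exists_support_bound γ
  have hcm : ∀ n, K ≤ n → (γ (barLetter n)).natAbs = 0 := fun n hn => by
    rw [← letterAt_neg, hK _ (Or.inl (by omega)), Int.natAbs_zero]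
  have hcp : ∀ n, K ≤ n → (γ (posLetter n)).natAbs = 0 := fun n hn => by
    rw [← letterAt_natCast, hK _ (Or.inr (by omega)), Int.natAbs_zero]
  set Fm := (finite_setOf_card_eq (∑ k ∈ range K, (γ (barLetter k)).natAbs)).toFinset with hFm
  set Fp := (finite_setOf_card_eq (∑ k ∈ range K, (γ (posLetter k)).natAbs)).toFinset with hFp
  -- The coefficient of `s_{λ*}` in one product is computed twice: as a number of chains, and by
  -- expanding the vertical and the horizontal factors separately.
  have hch : ch lam γ = ∑ p ∈ Fm ×ˢ Fp, (N p.1 p.2 lam.star • schurProduct p.1 p.2) γ := by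
    rw [ch, (ncard_weightSpace lam hγ hK).1, ← (finite_chains _ _ lam.star).2, prod_wordSteps,
      prod_vert_eq_sum u hcm, prod_horiz_eq_sum u hcp, sum_mul_sum, ← sum_product', map_sum]
    refine sum_congr rfl fun p _ => ?_
    rw [smul_mul_smul_comm, map_nsmul, ← hN.eq_schurCoeff, Pi.smul_apply,
      schurProduct_apply _ _ hγ, nsmul_eq_mul, nsmul_eq_mul]
    push_cast
    ring
  rw [hch]
  refine hasSum_sum_of_ne_finset_zero fun p hp => ?_
  rw [Pi.smul_apply, schurProduct_apply _ _ hγ]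
  rw [mem_product, not_and_or] at hp
  rcases hp with hp | hp
  · have : (ssytWithContent p.1.transpose fun k => (γ (barLetter k)).natAbs).ncard = 0 := by
      by_contra hne
      obtain ⟨T, hT⟩ := Set.nonempty_of_ncard_ne_zero hne
      apply hp
      rw [hFm, Set.Finite.mem_toFinset, Set.mem_ofPred_eq, ← card_transpose]
      exact card_eq_of_mem_ssytWithContent hcm hT
    rw [this, Nat.cast_zero, zero_mul, smul_zero]
  · have : (ssytWithContent p.2 fun k => (γ (posLetter k)).natAbs).ncard = 0 := by
      by_contra hne
      obtain ⟨T, hT⟩ := Set.nonempty_of_ncard_ne_zero hne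
      apply hp
      rw [hFp, Set.Finite.mem_toFinset]
      exact card_eq_of_mem_ssytWithContent hcp hT
    rw [this, Nat.cast_zero, mul_zero, smul_zero]

end SemiInf

end

theorem mainTheorem10 (u : ℕ) (hu : 1 ≤ u) :
    (∃! N : YoungDiagram → YoungDiagram → SemiInf.GenPartition u →₀ ℕ,
      SemiInf.IsLRCoefficients u N) ∧
    ∀ N : YoungDiagram → YoungDiagram → SemiInf.GenPartition u →₀ ℕ,
      SemiInf.IsLRCoefficients u N →
      ∀ lam : SemiInf.GenPartition u,
        (∀ γ : SemiInf.Letter →₀ ℤ, (SemiInf.weightSpace lam γ).Finite) ∧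
        HasSum (fun p : YoungDiagram × YoungDiagram =>
            N p.1 p.2 lam.star • SemiInf.schurProduct p.1 p.2)
          (SemiInf.ch lam) :=
  ⟨SemiInf.existsUnique_isLRCoefficients u, fun _ hN lam =>
    ⟨SemiInf.finite_weightSpace lam, SemiInf.hasSum_ch hN lam⟩⟩
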